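/- Let $k\in\mathbb{C}\setminus\{0\}$. The Lie superalgebra $\mathfrak{gl}(1|1)$ has even basis elements $N,E$ and odd basis elements $\psi^\pm$, with non-zero brackets $[N,\psi^\pm]=\pm\psi^\pm$, $\{\psi^+,\psi^-\}=E$ and invariant form $\kappa(N,E)=\kappa(E,N)=\kappa(\psi^+,\psi^-)=-\kappa(\psi^-,\psi^+)=1$. The affine Lie superalgebra $\widehat{\mathfrak{gl}(1|1)}=\mathfrak{gl}(1|1)\otimes\mathbb{C}[t,t^{-1}]\oplus\mathbb{C}\mathbf{k}$ has bracket $[a_r,b_s]=[a,b]_{r+s}+r\,\kappa(a,b)\,\delta_{r+s,0}\mathbf{k}$, where $a_r=a\otimes t^r$ and $\mathbf{k}$ is central. A (grading-restricted generalized) $V_k(\mathfrak{gl}(1|1))$-module is a $\mathbb{Z}_2$-graded $\widehat{\mathfrak{gl}(1|1)}$-module $W$ on which $\mathbf{k}$ acts as $k$, such that for each $w\in W$ one has $a_rw=0$ for all sufficiently large $r$, and such that $W$ is the direct sum of the generalized eigenspaces $W_{[h]}$, $h\in\mathbb{C}$, of the Sugawara operator $$L_0=\tfrac1k\sum_{r>0}\left(N_{-r}E_r+E_{-r}N_r-\psi^+_{-r}\psi^-_r+\psi^-_{-r}\psi^+_r\right)+\tfrac1{k^2}\sum_{r>0}E_{-r}E_r+\tfrac1k\left(N_0E_0-\psi^+_0\psi^-_0\right)+\tfrac1{2k}E_0+\tfrac1{2k^2}E_0^2,$$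 where each $W_{[h]}$ is finite-dimensional and $W_{[h-m]}=0$ for all sufficiently large $m\in\mathbb{N}$. Let $\mathcal{O}_k^{fin}$ be the supercategory of those $V_k(\mathfrak{gl}(1|1))$-modules of finite length on which $N_0$ and $E_0$ act semisimply; its morphisms are the sums of an even and an odd homomorphism, where a linear map $f$ of parity $|f|$ is a homomorphism if $a_rf(w)=(-1)^{|a||f|}f(a_rw)$. A projective cover of $S$ in $\mathcal{O}_k^{fin}$ is an essential surjection $P\to S$ in $\mathcal{O}_k^{fin}$ with $P$ projective in $\mathcal{O}_k^{fin}$. For a $\mathfrak{gl}(1|1)$-module $M$ let $\widehat M$ be the level-$k$ $\widehat{\mathfrak{gl}(1|1)}$-module induced from $M$, with $a_r$, $r>0$, acting on $M$ by zero. Let $V_{n,e}$ be the Verma module generated by $v$ with $Nv=(n+\frac12)v$, $Ev=ev$, $\psi^+v=0$; let $A_n$ be the one-dimensional module with $N=n$, $E=\psi^\pm=0$; let $P_n$ be the $\mathfrak{gl}(1|1)$-module induced from the one-dimensional module of the even part with $N=n$, $E=0$. Let $\widehat A_{n,0}=\widehat{A_n}$, and for $\ell\in\mathbb{Z}\setminus\{0\}$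 let $\widehat A_{n,\ell k}$ be the irreducible quotient of $\widehat V_{n,\ell k}$. Let $\varepsilon(\ell)=\frac12,0,-\frac12$ for $\ell>0$, $\ell=0$, $\ell<0$ respectively. Let $\sigma^\ell$ be the automorphism $N_r\mapsto N_r$, $E_r\mapsto E_r-\ell\delta_{r,0}\mathbf{k}$, $\psi^\pm_r\mapsto\psi^\pm_{r\mp\ell}$, $\mathbf{k}\mapsto\mathbf{k}$ and $w$ the automorphism $N_r\mapsto-N_r$, $E_r\mapsto-E_r$, $\psi^+_r\mapsto\psi^-_r$, $\psi^-_r\mapsto-\psi^+_r$, $\mathbf{k}\mapsto\mathbf{k}$; for an automorphism $\alpha$ the module $\alpha(W)$ is $W$ with $a_r$ acting as $\alpha^{-1}(a_r)$. Put $\widehat P_{n,0}=\widehat P_n$, $\widehat P_{n-\ell+\varepsilon(\ell),\ell k}=\sigma^\ell(\widehat P_n)$ for $\ell<0$, and $\widehat P_{n-\ell+\varepsilon(\ell),\ell k}=\sigma^\ell(w(\widehat P_{-n}))$ for $\ell>0$. Then: 1. Every irreducible $V_k(\mathfrak{gl}(1|1))$-module has a projective cover in $\mathcal{O}_k^{fin}$.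 2. For $n,e\in\mathbb{C}$ with $e/k\notin\mathbb{Z}$, the typical module $\widehat V_{n,e}$ is irreducible and projective in $\mathcal{O}_k^{fin}$, hence is its own projective cover. Every short exact sequence $0\to\widehat V_{n',e'}\to A\to\widehat V_{n,e}\to0$ in $\mathcal{O}_k^{fin}$ with $e/k,e'/k\notin\mathbb{Z}$ splits. 3. For $n\in\mathbb{C}$ and $\ell\in\mathbb{Z}$, the atypical module $\widehat A_{n-\ell+\varepsilon(\ell),\ell k}$ is irreducible, and $\widehat P_{n-\ell+\varepsilon(\ell),\ell k}$ has length $4$ and is a projective cover of it in $\mathcal{O}_k^{fin}$. -/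

import Mathlib

namespace AffGL

noncomputable section

/-- The basis `N, E, ψ⁺, ψ⁻` of the Lie superalgebra `gl(1|1)`. -/
inductive Gen : Type
  | N
  | E
  | psiP
  | psiM
  deriving DecidableEq

open Gen

instance : Fintype Gen := ⟨{N, E, psiP, psiM}, fun a => by cases a <;> decide⟩

theorem sum_gen {A : Type} [AddCommMonoid A] (f : Gen → A) :
    ∑ c, f c = f N + (f E + (f psiP + f psiM)) := by
  have h : (Finset.univ : Finset Gen) = {N, E, psiP, psiM} := rfl
  rw [h, Finset.sum_insert (by decide), Finset.sum_insert (by decide),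
    Finset.sum_insert (by decide), Finset.sum_singleton]

/-- Parity of a basis element: `N, E` are even, `ψ⁺, ψ⁻` are odd. -/
def par : Gen → ℕ
  | N => 0
  | E => 0
  | psiP => 1
  | psiM => 1

/-- Structure constants of `gl(1|1)`: `[a, b] = ∑ c, bracket a b c • c` for the superbracket,
that is `[N, ψ^±] = ± ψ^±` and `{ψ⁺, ψ⁻} = E`. -/
def bracket : Gen → Gen → Gen → ℂ
  | N, psiP, psiP => 1
  | psiP, N, psiP => -1
  | N, psiM, psiM => -1
  | psiM, N, psiM => 1
  | psiP, psiM, E => 1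
  | psiM, psiP, E => 1
  | _, _, _ => 0

/-- The invariant supersymmetric form: `κ(N, E) = κ(E, N) = 1`,
`κ(ψ⁺, ψ⁻) = - κ(ψ⁻, ψ⁺) = 1`. -/
def kappa : Gen → Gen → ℂ
  | N, E => 1
  | E, N => 1
  | psiP, psiM => 1
  | psiM, psiP => -1
  | _, _ => 0

/-- The sign `(-1)^{|a||b|}`. -/
def sgn (a b : Gen) : ℂ := (-1) ^ (par a * par b)

/-- The value at the level `k` of the central term `κ(a, b) r δ_{r+s,0} 𝐤` of the affine bracket. -/
def central (k : ℂ) (a b : Gen) (r s : ℤ) : ℂ :=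
  if r + s = 0 then kappa a b * (r : ℂ) * k else 0

/-- A level-`k` module for the affine Lie superalgebra
`gl(1|1)^ = gl(1|1) ⊗ ℂ[t, t⁻¹] ⊕ ℂ𝐤`, on a complex vector superspace.
`act a r` is the operator of `a_r = a ⊗ t^r`, and `𝐤` acts as `k`.  The `ℤ/2`-grading is recorded
by its parity involution `θ`, equal to `1` on the even and to `-1` on the odd part. -/
structure AffMod (k : ℂ) where
  W : Type
  [acg : AddCommGroup W]
  [mod : Module ℂ W]
  act : Gen → ℤ → Module.End ℂ W
  θ : Module.End ℂ W
  θ_sq : θ * θ = 1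
  θ_act : ∀ a r, θ * act a r = ((-1 : ℂ) ^ par a) • (act a r * θ)
  rel : ∀ a b r s, act a r * act b s - sgn a b • (act b s * act a r) =
    (∑ c, bracket a b c • act c (r + s)) + central k a b r s • (1 : Module.End ℂ W)

attribute [instance] AffMod.acg AffMod.mod

namespace AffMod

variable {k : ℂ}

/-! ### Submodules and quotients -/

/-- Stability of a subspace under the affine action and under the parity involution. -/
def IsGraded (M : AffMod k) (X : Submodule ℂ M.W) : Prop :=
  (∀ a r, X ≤ X.comap (M.act a r)) ∧ X ≤ X.comap M.θ

/-- The ordered set of (`ℤ/2`-graded) submodules. -/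
abbrev GSub (M : AffMod k) : Type := {X : Submodule ℂ M.W // M.IsGraded X}

/-- The graded submodule generated by a set of vectors. -/
def generated (M : AffMod k) (s : Set M.W) : M.GSub :=
  ⟨sInf {X | M.IsGraded X ∧ s ⊆ X}, by
    refine ⟨fun a r w hw => ?_, fun w hw => ?_⟩
    · rw [Submodule.mem_comap, Submodule.mem_sInf]
      rw [Submodule.mem_sInf] at hw
      exact fun X hX => hX.1.1 a r (hw X hX)
    · rw [Submodule.mem_comap, Submodule.mem_sInf]
      rw [Submodule.mem_sInf] at hw
      exact fun X hX => hX.1.2 (hw X hX)⟩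

/-- The sum of all proper graded submodules. -/
def sumProper (M : AffMod k) : M.GSub :=
  ⟨sSup {X | M.IsGraded X ∧ X ≠ ⊤},
    fun a r => sSup_le fun _ hX => (hX.1.1 a r).trans (Submodule.comap_mono (le_sSup hX)),
    sSup_le fun _ hX => hX.1.2.trans (Submodule.comap_mono (le_sSup hX))⟩

/-- The quotient of a module by a graded submodule. -/
def quot (M : AffMod k) (X : M.GSub) : AffMod k where
  W := M.W ⧸ X.1
  act a r := X.1.mapQ X.1 (M.act a r) (X.2.1 a r)
  θ := X.1.mapQ X.1 M.θ X.2.2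
  θ_sq := by
    ext w
    simpa using congrArg X.1.mkQ (LinearMap.congr_fun M.θ_sq w)
  θ_act a r := by
    ext w
    simpa using congrArg X.1.mkQ (LinearMap.congr_fun (M.θ_act a r) w)
  rel a b r s := by
    ext w
    simpa [sum_gen] using congrArg X.1.mkQ (LinearMap.congr_fun (M.rel a b r s) w)

/-- Irreducibility: non-zero, and without graded submodules other than zero and itself. -/
def IsIrreducible (M : AffMod k) : Prop :=
  Nontrivial M.W ∧ ∀ X : Submodule ℂ M.W, M.IsGraded X → X = ⊥ ∨ X = ⊤

/-- `M` has a composition series of length `l` (the successive quotients of a chain of graded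
submodules in which each covers the previous one are irreducible). -/
def HasLength (M : AffMod k) (l : ℕ) : Prop :=
  ∃ F : ℕ → M.GSub, (F 0).1 = ⊥ ∧ (F l).1 = ⊤ ∧ ∀ i < l, F i ⋖ F (i + 1)

/-! ### The operator `L₀` and the categories -/

/-- Each vector is annihilated by all `a_r` with `r` sufficiently large, that is, the fields
`a(x) = ∑ a_r x^{-r-1}` are lower truncated. -/
def IsSmooth (M : AffMod k) : Prop :=
  ∀ w : M.W, ∃ R : ℤ, ∀ a r, R ≤ r → M.act a r w = 0

/-- The `r`-th summand (`r ≥ 1`) of the infinite sum in the Sugawara operator `L₀`. -/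
def sugawaraTerm (M : AffMod k) (r : ℤ) : Module.End ℂ M.W :=
  (1 / k) • (M.act N (-r) * M.act E r + M.act E (-r) * M.act N r
    - M.act psiP (-r) * M.act psiM r + M.act psiM (-r) * M.act psiP r)
  + (1 / k ^ 2) • (M.act E (-r) * M.act E r)

/-- The part of the Sugawara operator `L₀` that involves zero modes only. -/
def sugawaraZero (M : AffMod k) : Module.End ℂ M.W :=
  (1 / k) • (M.act N 0 * M.act E 0 - M.act psiP 0 * M.act psiM 0)
  + (1 / (2 * k)) • M.act E 0 + (1 / (2 * k ^ 2)) • (M.act E 0 * M.act E 0)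

theorem sugawara_finite (M : AffMod k) (h : M.IsSmooth) (w : M.W) :
    (Function.support fun r : ℕ => M.sugawaraTerm ((r : ℤ) + 1) w).Finite := by
  obtain ⟨R, hR⟩ := h w
  refine (Set.finite_lt_nat R.toNat).subset fun r hr => ?_
  by_contra hlt
  apply hr
  have h1 : R ≤ (r : ℤ) + 1 := by
    simp only [Set.mem_ofPred_eq, not_lt] at hlt
    omega
  simp [sugawaraTerm, hR _ _ h1]

/-- The Virasoro zero mode `L₀` of the (modified) Sugawara construction, on a smooth module. -/
def L0 (M : AffMod k) (h : M.IsSmooth) : Module.End ℂ M.W where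
  toFun w := (∑ᶠ r : ℕ, M.sugawaraTerm ((r : ℤ) + 1) w) + M.sugawaraZero w
  map_add' v w := by
    simp only [map_add]
    rw [finsum_add_distrib (M.sugawara_finite h v) (M.sugawara_finite h w)]
    abel
  map_smul' c w := by
    simp only [map_smul, RingHom.id_apply, smul_add]
    rw [smul_finsum]

/-- Grading-restricted generalized `V_k(gl(1|1))`-modules: smooth level-`k` modules that are the
direct sum of their generalized `L₀`-eigenspaces `W_[h]`, where every `W_[h]` is
finite-dimensional and `W_[h - m] = 0` for all sufficiently large `m ∈ ℕ`. -/
def IsGradingRestricted (M : AffMod k) : Prop :=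
  ∃ hs : M.IsSmooth,
    (⨆ h : ℂ, (M.L0 hs).maxGenEigenspace h) = ⊤ ∧
    (∀ h : ℂ, FiniteDimensional ℂ ((M.L0 hs).maxGenEigenspace h)) ∧
    ∀ h : ℂ, ∃ m₀ : ℕ, ∀ m : ℕ, m₀ ≤ m → (M.L0 hs).maxGenEigenspace (h - m) = ⊥

/-- Objects of the Kazhdan–Lusztig category `KL_k`. -/
def IsKL (M : AffMod k) : Prop := M.IsGradingRestricted ∧ ∃ l, M.HasLength l

/-- Objects of `O_k^fin`: objects of `KL_k` on which `N₀` and `E₀` act semisimply. -/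
def IsOfin (M : AffMod k) : Prop :=
  M.IsKL ∧ (⨆ μ : ℂ, (M.act N 0).eigenspace μ) = ⊤ ∧ (⨆ μ : ℂ, (M.act E 0).eigenspace μ) = ⊤

/-! ### Morphisms of the supercategory, projective objects, projective covers -/

/-- Parity-homogeneous homomorphisms: `f` has parity `p`, and
`a_r f(w) = (-1)^{|a| p} f(a_r w)`. -/
def IsHomogHom (M M' : AffMod k) (p : ℕ) (f : M.W →ₗ[ℂ] M'.W) : Prop :=
  (∀ w, M'.θ (f w) = ((-1 : ℂ) ^ p) • f (M.θ w)) ∧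
  ∀ a r w, M'.act a r (f w) = ((-1 : ℂ) ^ (par a * p)) • f (M.act a r w)

/-- Morphisms: sums of an even and an odd homomorphism. -/
def IsHom (M M' : AffMod k) (f : M.W →ₗ[ℂ] M'.W) : Prop :=
  ∃ f₀ f₁ : M.W →ₗ[ℂ] M'.W, IsHomogHom M M' 0 f₀ ∧ IsHomogHom M M' 1 f₁ ∧ f = f₀ + f₁

/-- Projective objects of `O_k^fin`. -/
def IsProjective (P : AffMod k) : Prop :=
  P.IsOfin ∧ ∀ A B : AffMod k, A.IsOfin → B.IsOfin →
    ∀ (π : A.W →ₗ[ℂ] B.W) (q : P.W →ₗ[ℂ] B.W), IsHom A B π → Function.Surjective π →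
      IsHom P B q → ∃ q' : P.W →ₗ[ℂ] A.W, IsHom P A q' ∧ π ∘ₗ q' = q

/-- `p : P → S` is a projective cover in `O_k^fin`: `P` is projective and `p` is an essential
surjection. -/
def IsProjectiveCover (P S : AffMod k) (p : P.W →ₗ[ℂ] S.W) : Prop :=
  S.IsOfin ∧ P.IsProjective ∧ IsHom P S p ∧ Function.Surjective p ∧
  ∀ X : AffMod k, X.IsOfin → ∀ g : X.W →ₗ[ℂ] P.W, IsHom X P g →
    Function.Surjective (p ∘ₗ g) → Function.Surjective g

/-! ### Twists by automorphisms -/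

/-- The operators `σ^{-ℓ}(a_r)` on `M`, where `σ^ℓ` is the spectral flow automorphism
`N_r ↦ N_r`, `E_r ↦ E_r - ℓ δ_{r,0} 𝐤`, `ψ^±_r ↦ ψ^±_{r ∓ ℓ}`, `𝐤 ↦ 𝐤`. -/
def flowAct (M : AffMod k) (l : ℤ) : Gen → ℤ → Module.End ℂ M.W
  | N, r => M.act N r
  | E, r => M.act E r + (if r = 0 then (l : ℂ) * k else 0) • (1 : Module.End ℂ M.W)
  | psiP, r => M.act psiP (r + l)
  | psiM, r => M.act psiM (r - l)

/-- The operators `w⁻¹(a_r)` on `M`, where `w` is the conjugation automorphism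
`N_r ↦ -N_r`, `E_r ↦ -E_r`, `ψ⁺_r ↦ ψ⁻_r`, `ψ⁻_r ↦ -ψ⁺_r`, `𝐤 ↦ 𝐤`. -/
def conjAct (M : AffMod k) : Gen → ℤ → Module.End ℂ M.W
  | N, r => - M.act N r
  | E, r => - M.act E r
  | psiP, r => - M.act psiM r
  | psiM, r => M.act psiP r

/-- The spectral flow module `σ^ℓ(M)`: the space `M` on which `a_r` acts as `σ^{-ℓ}(a_r)`. -/
def flow (M : AffMod k) (l : ℤ) : AffMod k where
  W := M.W
  act := M.flowAct l
  θ := M.θ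
  θ_sq := M.θ_sq
  θ_act a r := by
    cases a
    · exact M.θ_act N r
    · have h := M.θ_act E r
      simp only [par, pow_zero, one_smul] at h ⊢
      simp only [flowAct, mul_add, add_mul, h, mul_smul_comm, smul_mul_assoc, mul_one, one_mul]
    · exact M.θ_act psiP _
    · exact M.θ_act psiM _
  rel a b r s := by
    have h := M.rel
    simp only [sum_gen] at h ⊢
    have e1 : r + l + s = r + s + l := by ring
    have e2 : r + (s + l) = r + s + l := by ring
    have e3 : r - l + s = r + s - l := by ring
    have e4 : r + (s - l) = r + s - l := by ring
    have e5 : r + l + (s - l) = r + s := by ring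
    have e6 : r - l + (s + l) = r + s := by ring
    cases a <;> cases b
    · simpa [flowAct, bracket, kappa, central, sgn, par] using h N N r s
    · simpa [flowAct, bracket, kappa, central, sgn, par, mul_add, add_mul] using h N E r s
    · simpa [flowAct, bracket, kappa, central, sgn, par, e2] using h N psiP r (s + l)
    · simpa [flowAct, bracket, kappa, central, sgn, par, e4] using h N psiM r (s - l)
    · simpa [flowAct, bracket, kappa, central, sgn, par, mul_add, add_mul] using h E N r s
    · have := h E E r s
      simp only [bracket, kappa, central, sgn, par, zero_smul, add_zero, zero_mul, ite_self,
        pow_zero, one_smul, flowAct, mul_add, add_mul, mul_smul_comm, smul_mul_assoc, mul_one,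
        one_mul] at this ⊢
      rw [sub_eq_zero] at this
      rw [this, smul_add, smul_add, smul_comm]
      abel
    · simpa [flowAct, bracket, kappa, central, sgn, par, mul_add, add_mul] using h E psiP r (s + l)
    · simpa [flowAct, bracket, kappa, central, sgn, par, mul_add, add_mul] using h E psiM r (s - l)
    · simpa [flowAct, bracket, kappa, central, sgn, par, e1] using h psiP N (r + l) s
    · simpa [flowAct, bracket, kappa, central, sgn, par, mul_add, add_mul] using h psiP E (r + l) s
    · simpa [flowAct, bracket, kappa, central, sgn, par] using h psiP psiP (r + l) (s + l)
    · have := h psiP psiM (r + l) (s - l)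
      by_cases h0 : r + s = 0
      · simp [flowAct, bracket, kappa, central, sgn, par, e5, h0, add_mul, add_smul] at this ⊢
        rw [this]
        abel
      · simpa [flowAct, bracket, kappa, central, sgn, par, e5, h0] using this
    · simpa [flowAct, bracket, kappa, central, sgn, par, e3] using h psiM N (r - l) s
    · simpa [flowAct, bracket, kappa, central, sgn, par, mul_add, add_mul] using h psiM E (r - l) s
    · have := h psiM psiP (r - l) (s + l)
      by_cases h0 : r + s = 0
      · simp [flowAct, bracket, kappa, central, sgn, par, e6, h0, sub_mul, sub_smul] at this ⊢
        rw [this]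
        abel
      · simpa [flowAct, bracket, kappa, central, sgn, par, e6, h0] using this
    · simpa [flowAct, bracket, kappa, central, sgn, par] using h psiM psiM (r - l) (s - l)

/-- The conjugate module `w(M)`: the space `M` on which `a_r` acts as `w⁻¹(a_r)`. -/
def conj (M : AffMod k) : AffMod k where
  W := M.W
  act := M.conjAct
  θ := M.θ
  θ_sq := M.θ_sq
  θ_act a r := by
    cases a
    · simpa [conjAct, par] using M.θ_act N r
    · simpa [conjAct, par] using M.θ_act E r
    · simpa [conjAct, par] using congrArg Neg.neg (M.θ_act psiM r)
    · simpa [conjAct, par] using M.θ_act psiP r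
  rel a b r s := by
    have h := M.rel
    simp only [sum_gen] at h ⊢
    cases a <;> cases b
    · simpa [conjAct, bracket, kappa, central, sgn, par] using h N N r s
    · simpa [conjAct, bracket, kappa, central, sgn, par] using h N E r s
    · simpa [conjAct, bracket, kappa, central, sgn, par] using h N psiM r s
    · simpa [conjAct, bracket, kappa, central, sgn, par, neg_add_eq_sub] using
        congrArg Neg.neg (h N psiP r s)
    · simpa [conjAct, bracket, kappa, central, sgn, par] using h E N r s
    · simpa [conjAct, bracket, kappa, central, sgn, par] using h E E r s
    · simpa [conjAct, bracket, kappa, central, sgn, par] using h E psiM r s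
    · simpa [conjAct, bracket, kappa, central, sgn, par, neg_add_eq_sub] using
        congrArg Neg.neg (h E psiP r s)
    · simpa [conjAct, bracket, kappa, central, sgn, par] using h psiM N r s
    · simpa [conjAct, bracket, kappa, central, sgn, par] using h psiM E r s
    · simpa [conjAct, bracket, kappa, central, sgn, par] using h psiM psiM r s
    · have := congrArg Neg.neg (h psiM psiP r s)
      by_cases h0 : r + s = 0 <;>
        simp [conjAct, bracket, kappa, central, sgn, par, h0] at this ⊢ <;>
        rw [sub_eq_add_neg, add_comm] <;> simpa [add_comm] using this
    · simpa [conjAct, bracket, kappa, central, sgn, par, neg_add_eq_sub] using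
        congrArg Neg.neg (h psiP N r s)
    · simpa [conjAct, bracket, kappa, central, sgn, par, neg_add_eq_sub] using
        congrArg Neg.neg (h psiP E r s)
    · have := congrArg Neg.neg (h psiP psiM r s)
      by_cases h0 : r + s = 0 <;>
        simp [conjAct, bracket, kappa, central, sgn, par, h0] at this ⊢ <;>
        rw [sub_eq_add_neg, add_comm] <;> simpa [add_comm] using this
    · simpa [conjAct, bracket, kappa, central, sgn, par] using h psiP psiP r s

end AffMod

/-! ### The universal enveloping algebra at level `k` -/

/-- The free algebra on the symbols `a_r`. -/
abbrev Free : Type := FreeAlgebra ℂ (Gen × ℤ)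

/-- The defining relations of `U(gl(1|1)^) / (𝐤 - k)`. -/
inductive Rel (k : ℂ) : Free → Free → Prop
  | mk (a b : Gen) (r s : ℤ) : Rel k
      (FreeAlgebra.ι ℂ (a, r) * FreeAlgebra.ι ℂ (b, s)
        - sgn a b • (FreeAlgebra.ι ℂ (b, s) * FreeAlgebra.ι ℂ (a, r)))
      ((∑ c, bracket a b c • FreeAlgebra.ι ℂ (c, r + s)) + central k a b r s • (1 : Free))

/-- The level-`k` universal enveloping algebra `U(gl(1|1)^) / (𝐤 - k)`. -/
def Ulev (k : ℂ) : Type := (ringConGen (Rel k)).Quotient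
  deriving Ring, Algebra ℂ

/-- The quotient map from the free algebra. -/
def quotMap (k : ℂ) : Free →ₐ[ℂ] Ulev k := RingCon.mkₐ ℂ (ringConGen (Rel k))

/-- The class of `a_r` in the enveloping algebra. -/
def mode (k : ℂ) (a : Gen) (r : ℤ) : Ulev k :=
  quotMap k (FreeAlgebra.ι ℂ (a, r))

theorem mode_rel (k : ℂ) (a b : Gen) (r s : ℤ) :
    mode k a r * mode k b s - sgn a b • (mode k b s * mode k a r) =
      (∑ c, bracket a b c • mode k c (r + s)) + central k a b r s • (1 : Ulev k) := by
  have h : quotMap k _ = quotMap k _ := 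
    Quotient.sound (RingCon.le_ringConGen _ _ (Rel.mk (k := k) a b r s))
  simpa [mode] using h

/-- The parity automorphism `a_r ↦ (-1)^{|a|} a_r` of the enveloping algebra. -/
def parityAut (k : ℂ) : Ulev k →ₐ[ℂ] Ulev k :=
  RingCon.liftₐ _ (FreeAlgebra.lift ℂ fun x : Gen × ℤ => ((-1 : ℂ) ^ par x.1) • mode k x.1 x.2) <| by
    apply RingCon.ringConGen_le.2
    rintro _ _ ⟨a, b, r, s⟩
    have h := congrArg (fun u => ((-1 : ℂ) ^ par a * (-1 : ℂ) ^ par b) • u) (mode_rel k a b r s)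
    simp only [sum_gen] at h ⊢
    by_cases h0 : r + s = 0 <;> cases a <;> cases b <;>
      simpa [par, bracket, central, kappa, sgn, h0, neg_add_eq_sub] using h

theorem parityAut_mode (k : ℂ) (a : Gen) (r : ℤ) :
    parityAut k (mode k a r) = ((-1 : ℂ) ^ par a) • mode k a r :=
  (FreeAlgebra.lift_ι_apply (R := ℂ)
    (fun x : Gen × ℤ => ((-1 : ℂ) ^ par x.1) • mode k x.1 x.2) (a, r) :)

theorem parityAut_sq (k : ℂ) : (parityAut k).comp (parityAut k) = AlgHom.id ℂ (Ulev k) := by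
  apply RingCon.Quotient.hom_extₐ
  apply FreeAlgebra.hom_ext
  funext x
  have h := parityAut_mode k x.1 x.2
  change parityAut k (parityAut k (mode k x.1 x.2)) = mode k x.1 x.2
  rw [h, map_smul, h, smul_smul, ← mul_pow]
  simp

/-- The enveloping algebra at level `k` as a left module over itself. -/
def regular (k : ℂ) : AffMod k where
  W := Ulev k
  act a r := LinearMap.mulLeft ℂ (mode k a r)
  θ := (parityAut k).toLinearMap
  θ_sq := by
    apply LinearMap.ext
    intro u
    exact AlgHom.congr_fun (parityAut_sq k) u
  θ_act a r := by
    apply LinearMap.ext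
    intro u
    simp [parityAut_mode]
  rel a b r s := by
    apply LinearMap.ext
    intro u
    have h := congrArg (fun x => x * u) (mode_rel k a b r s)
    simpa [sum_gen, sub_mul, add_mul, mul_assoc] using h

/-! ### The modules `V_{n,e}^`, `A_{n,e}^`, `P_n^` and `P_{n,ℓk}^` -/

/-- The cyclic module `U / U s`, where `s` is a set of (parity-homogeneous) elements of the
level-`k` enveloping algebra `U`; its generator is even. -/
def cyclic (k : ℂ) (s : Set (Ulev k)) : AffMod k :=
  (regular k).quot ((regular k).generated s)

/-- The positive modes `a_r`, `r ≥ 1`. -/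
def posModes (k : ℂ) : Set (Ulev k) := {u | ∃ (a : Gen) (r : ℤ), 0 < r ∧ u = mode k a r}

/-- The Verma module `V_{n,e}^`: the module induced from the `gl(1|1)`-Verma module `V_{n,e}` with
highest-weight vector `v`, `N v = (n + 1/2) v`, `E v = e v`, `ψ⁺ v = 0`, on which the positive modes
act by zero and `𝐤` by `k`. -/
def Vhat (k n e : ℂ) : AffMod k :=
  cyclic k (posModes k ∪ {mode k psiP 0, mode k N 0 - (n + 1 / 2) • 1, mode k E 0 - e • 1})

/-- The module induced from the one-dimensional `gl(1|1)`-module `A_n`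
(`N = n`, `E = 0`, `ψ^± = 0`). -/
def AhatZero (k n : ℂ) : AffMod k :=
  cyclic k (posModes k ∪ {mode k psiP 0, mode k psiM 0, mode k N 0 - n • 1, mode k E 0})

open Classical in
/-- The atypical modules `A_{n,e}^`, `e / k ∈ ℤ`: for `e = 0` the module induced from `A_n`, and for
`e ≠ 0` the irreducible quotient of `V_{n,e}^`. -/
def Ahat (k n e : ℂ) : AffMod k :=
  if e = 0 then AhatZero k n else (Vhat k n e).quot (Vhat k n e).sumProper

/-- The module `P_n^` induced from `P_n = U(gl(1|1)) ⊗_{U(gl(1|1)_0)} ℂ v_n`, where `N v_n = n v_n`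
and `E v_n = 0`. -/
def PhatZero (k n : ℂ) : AffMod k :=
  cyclic k (posModes k ∪ {mode k N 0 - n • 1, mode k E 0})

/-- The modules `P_{m,ℓk}^`: `P_{m,0}^ = P_m^`, `P_{n-ℓ-1/2,ℓk}^ = σ^ℓ(P_n^)` for `ℓ < 0` and
`P_{-n-ℓ+1/2,ℓk}^ = σ^ℓ(w(P_n^))` for `ℓ > 0`. -/
def Phat (k m : ℂ) (l : ℤ) : AffMod k :=
  if l = 0 then PhatZero k m
  else if l < 0 then (PhatZero k (m + l + 1 / 2)).flow l
  else (PhatZero k (-m - l + 1 / 2)).conj.flow l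

/-- `ε(ℓ) = 1/2, 0, -1/2` for `ℓ > 0`, `ℓ = 0`, `ℓ < 0`. -/
def eps (l : ℤ) : ℂ := if 0 < l then 1 / 2 else if l = 0 then 0 else -(1 / 2)

end

end AffGL

open AffGL

/-!
The proof works with the operator `T = L₀ - (e/k) N₀` on the part of a module where `E₀ = e`.  The
modes are homogeneous for `T`: `[T, a_r] = -(r + χ(a) e/k) a_r`, where `χ(a) ∈ {0, 1, -1}` is the
charge of `a` (`L0_act`, `numOp_act`).  Spectral flow by `σ^ℓ` replaces `e` by `e + ℓ k`, and so one
may assume that `e = 0`, or that `φ(e/k)` lies strictly between `0` and `1` for a real-linear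
functional `φ` on `ℂ` with `φ(1) = 1` (`Strip`, `exists_strip`).  After this normalisation the value
of `φ` on the degree of a mode decides whether it is a creation or an annihilation operator.

The arguments take place in a class of modules (`Nice`) that contains `O_k^fin`, is closed under
quotients and spectral flow, and on which an Engel-type argument produces vacuum vectors, that is,
non-zero vectors annihilated by all positive modes (`Nice.engel`, `Nice.exists_vac`).  On such
vectors `T` satisfies a quadratic equation; hence `T` is locally algebraic on every nice module
(`Nice.algebraic`), and the vacuum vectors are exactly the generalised eigenvectors of `T` for one
explicit eigenvalue (`Nice.isVac_of_numOp`).  Projecting to this generalised eigenspace lifts vacuum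
vectors along surjections (`lift_vac`); graded submodules are determined by their vacuum vectors
(`Nice.exists_vac_notMem`), and a submodule generated by vacuum vectors has no unexpected ones
(`Nice.vac_generated`).

In the typical case, odd reflections (`VacV.reach`, `lift_vacV`) carry the highest-weight vector of
the Verma module to a vacuum vector of its normalised spectral flow and back.  The space of vacuum
vectors there is a line, which gives irreducibility, and lifting gives projectivity; the splitting of
extensions follows.  In the atypical case, the vacuum vectors of `P_n^` form the four-dimensional
module `P_n`, whose composition series induces one of `P_n^`; projectivity is again the lifting of
vacuum vectors, and essential surjectivity is a computation in `P_n` (`StdP.hasLength`,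
`StdP.isProjective_flow`, `StdP.essential`).  The modules `A_{n,ℓk}^` with `ℓ ≠ 0` are identified by
their highest-weight vectors, again by odd reflections (`Ahat_atypical`).  Finally, an irreducible
grading-restricted module belongs to `O_k^fin` by Schur's lemma, and contains a vacuum vector.

All this needs the generators of the modules given by generators and relations to be non-zero.  This
is shown by a free-field realization (`exists_vec`): the modes of `E` and `ψ^±` act on an exterior
algebra, and the modes of `N` are adjoined by inducing, and then coinducing along those of
non-negative index, so that some vector is annihilated by all positive modes.
-/

namespace AffGL

open Gen

namespace AffMod

variable {k : ℂ}

/-! ### Commutation relations on vectors -/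

theorem rel_apply (M : AffMod k) (a b : Gen) (r s : ℤ) (w : M.W) :
    M.act a r (M.act b s w) = sgn a b • M.act b s (M.act a r w)
      + ((∑ c, bracket a b c • M.act c (r + s) w) + central k a b r s • w) := by
  have h := LinearMap.congr_fun (M.rel a b r s) w
  simp only [sum_gen, LinearMap.sub_apply, Module.End.mul_apply, LinearMap.smul_apply,
    LinearMap.add_apply, Module.End.one_apply] at h ⊢
  rw [← h]; abel

theorem EE (M : AffMod k) (r s : ℤ) (w : M.W) :
    M.act E r (M.act E s w) = M.act E s (M.act E r w) := by
  simpa [sum_gen, sgn, par, bracket, central, kappa] using M.rel_apply E E r s w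

theorem NN (M : AffMod k) (r s : ℤ) (w : M.W) :
    M.act N r (M.act N s w) = M.act N s (M.act N r w) := by
  simpa [sum_gen, sgn, par, bracket, central, kappa] using M.rel_apply N N r s w

theorem NE (M : AffMod k) (r s : ℤ) (w : M.W) :
    M.act N r (M.act E s w) =
      M.act E s (M.act N r w) + (if r + s = 0 then (r : ℂ) * k else 0) • w := by
  simpa [sum_gen, sgn, par, bracket, central, kappa] using M.rel_apply N E r s w

theorem EN (M : AffMod k) (r s : ℤ) (w : M.W) :
    M.act E r (M.act N s w) =
      M.act N s (M.act E r w) + (if r + s = 0 then (r : ℂ) * k else 0) • w := by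
  simpa [sum_gen, sgn, par, bracket, central, kappa] using M.rel_apply E N r s w

theorem NP (M : AffMod k) (r s : ℤ) (w : M.W) :
    M.act N r (M.act psiP s w) = M.act psiP s (M.act N r w) + M.act psiP (r + s) w := by
  simpa [sum_gen, sgn, par, bracket, central, kappa] using M.rel_apply N psiP r s w

theorem NM (M : AffMod k) (r s : ℤ) (w : M.W) :
    M.act N r (M.act psiM s w) = M.act psiM s (M.act N r w) - M.act psiM (r + s) w := by
  simpa [sum_gen, sgn, par, bracket, central, kappa, sub_eq_add_neg] using
    M.rel_apply N psiM r s w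

theorem EP (M : AffMod k) (r s : ℤ) (w : M.W) :
    M.act E r (M.act psiP s w) = M.act psiP s (M.act E r w) := by
  simpa [sum_gen, sgn, par, bracket, central, kappa] using M.rel_apply E psiP r s w

theorem EM (M : AffMod k) (r s : ℤ) (w : M.W) :
    M.act E r (M.act psiM s w) = M.act psiM s (M.act E r w) := by
  simpa [sum_gen, sgn, par, bracket, central, kappa] using M.rel_apply E psiM r s w

theorem PP (M : AffMod k) (r s : ℤ) (w : M.W) :
    M.act psiP r (M.act psiP s w) = - M.act psiP s (M.act psiP r w) := by
  simpa [sum_gen, sgn, par, bracket, central, kappa] using M.rel_apply psiP psiP r s w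

theorem MM (M : AffMod k) (r s : ℤ) (w : M.W) :
    M.act psiM r (M.act psiM s w) = - M.act psiM s (M.act psiM r w) := by
  simpa [sum_gen, sgn, par, bracket, central, kappa] using M.rel_apply psiM psiM r s w

theorem PM (M : AffMod k) (r s : ℤ) (w : M.W) :
    M.act psiP r (M.act psiM s w) = - M.act psiM s (M.act psiP r w) + M.act E (r + s) w
      + (if r + s = 0 then (r : ℂ) * k else 0) • w := by
  simpa [sum_gen, sgn, par, bracket, central, kappa, add_assoc] using M.rel_apply psiP psiM r s w

theorem MP (M : AffMod k) (r s : ℤ) (w : M.W) :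
    M.act psiM r (M.act psiP s w) = - M.act psiP s (M.act psiM r w) + M.act E (r + s) w
      + (if r + s = 0 then -((r : ℂ) * k) else 0) • w := by
  simpa [sum_gen, sgn, par, bracket, central, kappa, add_assoc] using M.rel_apply psiM psiP r s w

theorem PP_self (M : AffMod k) (r : ℤ) (w : M.W) : M.act psiP r (M.act psiP r w) = 0 := by
  have h := M.PP r r w
  rw [eq_neg_iff_add_eq_zero, ← two_smul ℂ] at h
  exact (smul_eq_zero.1 h).resolve_left two_ne_zero

theorem MM_self (M : AffMod k) (r : ℤ) (w : M.W) : M.act psiM r (M.act psiM r w) = 0 := by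
  have h := M.MM r r w
  rw [eq_neg_iff_add_eq_zero, ← two_smul ℂ] at h
  exact (smul_eq_zero.1 h).resolve_left two_ne_zero

theorem θ_act_apply (M : AffMod k) (a : Gen) (r : ℤ) (w : M.W) :
    M.θ (M.act a r w) = ((-1 : ℂ) ^ par a) • M.act a r (M.θ w) := by
  simpa using LinearMap.congr_fun (M.θ_act a r) w

theorem θ_θ (M : AffMod k) (w : M.W) : M.θ (M.θ w) = w := by
  simpa using LinearMap.congr_fun M.θ_sq w

/-- A subspace that contains `b_s a_r w` also contains `a_r b_s w`, provided that it contains the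
terms of their supercommutator: the modes of index `r + s` on `w`, and `w` itself if `r + s = 0`. -/
theorem rel_mem (M : AffMod k) (Y : Submodule ℂ M.W) (a b : Gen) (r s : ℤ) (w : M.W)
    (h1 : M.act b s (M.act a r w) ∈ Y) (h2 : ∀ c, M.act c (r + s) w ∈ Y)
    (h3 : r + s = 0 → w ∈ Y) : M.act a r (M.act b s w) ∈ Y := by
  rw [rel_apply]
  refine Y.add_mem (Y.smul_mem _ h1) (Y.add_mem (Y.sum_mem fun c _ => Y.smul_mem _ (h2 c)) ?_)
  by_cases h0 : r + s = 0
  · exact Y.smul_mem _ (h3 h0)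
  · simp [central, h0]

/-! ### The operator `L₀` -/

/-- `L₀ w` as a finite sum. -/
theorem L0_eq (M : AffMod k) (h : M.IsSmooth) (w : M.W) (K : ℕ)
    (hK : ∀ a (r : ℤ), (K : ℤ) < r → M.act a r w = 0) :
    M.L0 h w = ∑ j ∈ Finset.range K, M.sugawaraTerm ((j : ℤ) + 1) w + M.sugawaraZero w := by
  change (∑ᶠ r : ℕ, M.sugawaraTerm ((r : ℤ) + 1) w) + M.sugawaraZero w = _
  congr 1
  apply finsum_eq_sum_of_support_subset
  intro j hj
  by_contra hlt
  apply hj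
  have h1 : (K : ℤ) < (j : ℤ) + 1 := by
    simp only [Finset.coe_range, Set.mem_Iio, not_lt] at hlt
    omega
  simp [sugawaraTerm, hK _ _ h1]

theorem exists_bound (M : AffMod k) (h : M.IsSmooth) (w : M.W) :
    ∃ K : ℕ, ∀ a (r : ℤ), (K : ℤ) < r → M.act a r w = 0 := by
  obtain ⟨R, hR⟩ := h w
  exact ⟨R.toNat, fun a r hr => hR a r (by omega)⟩

/-- `L₀` maps a vector into every subspace that is stable under all modes and contains it. -/
theorem L0_mem (M : AffMod k) (h : M.IsSmooth) (X : Submodule ℂ M.W)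
    (hX : ∀ a r, ∀ w ∈ X, M.act a r w ∈ X) (w : M.W) (hw : w ∈ X) : M.L0 h w ∈ X := by
  obtain ⟨K, hK⟩ := M.exists_bound h w
  rw [M.L0_eq h w K hK]
  have h2 : ∀ a r b s, M.act a r (M.act b s w) ∈ X := fun a r b s => hX _ _ _ (hX _ _ _ hw)
  refine X.add_mem (X.sum_mem fun j _ => ?_) ?_
  · simp only [sugawaraTerm, LinearMap.add_apply, LinearMap.smul_apply, LinearMap.sub_apply,
      Module.End.mul_apply]
    exact X.add_mem (X.smul_mem _ (X.add_mem (X.sub_mem (X.add_mem (h2 _ _ _ _) (h2 _ _ _ _))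
      (h2 _ _ _ _)) (h2 _ _ _ _))) (X.smul_mem _ (h2 _ _ _ _))
  · simp only [sugawaraZero, LinearMap.add_apply, LinearMap.smul_apply, LinearMap.sub_apply,
      Module.End.mul_apply]
    exact X.add_mem (X.add_mem (X.smul_mem _ (X.sub_mem (h2 _ _ _ _) (h2 _ _ _ _)))
      (X.smul_mem _ (hX _ _ _ hw))) (X.smul_mem _ (h2 _ _ _ _))

/-- The value of `L₀` on a vector annihilated by the positive modes. -/
theorem L0_vac (M : AffMod k) (h : M.IsSmooth) (w : M.W)
    (hw : ∀ a (r : ℤ), 0 < r → M.act a r w = 0) :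
    M.L0 h w = M.sugawaraZero w := by
  rw [M.L0_eq h w 0 (by simpa using hw)]
  simp

theorem sum_range_sub_shift {V : Type*} [AddCommGroup V] (f : ℤ → V) (m K : ℕ)
    (hf : ∀ j : ℤ, (K : ℤ) ≤ j → f j = 0) :
    ∑ j ∈ Finset.range K, (f j - f (j + m)) = ∑ j ∈ Finset.range m, f j := by
  have h1 : ∑ j ∈ Finset.range (m + K), f j = ∑ j ∈ Finset.range (K + m), f j := by rw [add_comm]
  rw [Finset.sum_range_add, Finset.sum_range_add] at h1
  have h2 : ∑ j ∈ Finset.range m, f ((K + j : ℕ) : ℤ) = 0 :=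
    Finset.sum_eq_zero fun j _ => hf _ (by push_cast; omega)
  rw [h2, add_zero] at h1
  rw [Finset.sum_sub_distrib, ← h1]
  simp only [Nat.cast_add, add_comm (m : ℤ)]
  abel

theorem sum_range_delta {V : Type*} [AddCommGroup V] (x : V) (s : ℤ) (K : ℕ) (hs : 0 < s)
    (hK : s ≤ K) : ∑ j ∈ Finset.range K, (if (j : ℤ) + 1 = s then x else 0) = x := by
  rw [Finset.sum_eq_single (s - 1).toNat]
  · rw [if_pos (by omega)]
  · intro b _ hb
    rw [if_neg (by omega)]
  · intro hb
    simp only [Finset.mem_range, not_lt] at hb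
    omega

/-- The commutator of `N_s` with one summand of `L₀`: terms at `j = ± s`, and differences under the
shift `j ↦ j + s`, which telescope in the sum over `j`. -/
theorem term_N (M : AffMod k) (hk : k ≠ 0) (j s : ℤ) (w : M.W) (hj : 0 < j) :
    M.sugawaraTerm j (M.act N s w) - M.act N s (M.sugawaraTerm j w) =
      (if j = s then -((s : ℂ) • (M.act N s w + (1 / k) • M.act E s w)) else 0)
      + (if j = -s then -((s : ℂ) • (M.act N s w + (1 / k) • M.act E s w)) else 0)
      + (1 / k) • ((M.act psiP (s - j) (M.act psiM j w)
          - M.act psiP (s - (j + s)) (M.act psiM (j + s) w))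
        + (M.act psiM (s - j) (M.act psiP j w)
          - M.act psiM (s - (j + s)) (M.act psiP (j + s) w))) := by
  have e1 : s - (j + s) = -j := by ring
  have e2 : s - j = s + -j := by ring
  have e3 : j + s = s + j := by ring
  rw [e1, e2, e3]
  simp only [sugawaraTerm, LinearMap.add_apply, LinearMap.smul_apply, LinearMap.sub_apply,
    Module.End.mul_apply, map_add, map_sub, map_smul, M.NE s, M.NP s, M.NM s, M.NN s j,
    M.NN s (-j)]
  have c1 : (s + j = 0) ↔ (j = -s) := by omega
  have c2 : (s + -j = 0) ↔ (j = s) := by omega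
  simp only [c1, c2]
  by_cases h1 : j = s
  · have h2 : ¬ j = -s := by omega
    simp only [if_pos h1, if_neg h2, zero_smul, add_zero]
    subst h1
    match_scalars <;> field_simp <;> ring
  · by_cases h2 : j = -s
    · simp only [if_neg h1, if_pos h2, zero_smul, add_zero]
      obtain rfl : s = -j := by omega
      push_cast
      match_scalars <;> field_simp <;> ring
    · simp only [h1, h2, if_false, zero_smul, add_zero]
      match_scalars <;> field_simp <;> ring

/-- The commutator of `N_s` with the zero-mode part of `L₀`. -/
theorem zero_N (M : AffMod k) (s : ℤ) (w : M.W) :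
    M.sugawaraZero (M.act N s w) - M.act N s (M.sugawaraZero w) =
      (1 / k) • (M.act psiP s (M.act psiM 0 w) - M.act psiP 0 (M.act psiM s w)) := by
  have hz : (if s = 0 then (s : ℂ) * k else 0) = 0 := by
    split_ifs with h <;> simp [h]
  have e : ∀ w, M.act E 0 (M.act N s w) = M.act N s (M.act E 0 w) := by
    intro w
    rw [EN]; simp
  simp only [sugawaraZero, LinearMap.add_apply, LinearMap.smul_apply, LinearMap.sub_apply,
    Module.End.mul_apply, map_add, map_sub, map_smul, e, NP, NM, add_zero, M.NN 0 s]
  match_scalars <;> field_simp <;> ring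

/-- The telescoping sum in the commutator of `L₀` with `N_s`. -/
theorem telescope (M : AffMod k) (s : ℤ) (w : M.W) (K : ℕ) (hsK : |s| ≤ K)
    (hK : ∀ a (r : ℤ), (K : ℤ) - |s| < r → M.act a r w = 0) :
    ∑ j ∈ Finset.range K, ((M.act psiP (s - ((j : ℤ) + 1)) (M.act psiM ((j : ℤ) + 1) w)
          - M.act psiP (s - ((j : ℤ) + 1 + s)) (M.act psiM ((j : ℤ) + 1 + s) w))
        + (M.act psiM (s - ((j : ℤ) + 1)) (M.act psiP ((j : ℤ) + 1) w)
          - M.act psiM (s - ((j : ℤ) + 1 + s)) (M.act psiP ((j : ℤ) + 1 + s) w)))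
      + (M.act psiP s (M.act psiM 0 w) - M.act psiP 0 (M.act psiM s w))
      = (s : ℂ) • M.act E s w := by
  set a : ℤ → M.W := fun j => M.act psiP (s - j) (M.act psiM j w) with ha
  set b : ℤ → M.W := fun j => M.act psiM (s - j) (M.act psiP j w) with hb
  have hz : ∀ j : ℤ, (K : ℤ) - |s| < j → a j = 0 ∧ b j = 0 := by
    intro j hj
    simp [ha, hb, hK _ _ hj]
  -- the two families are related by `{ψ⁺_{s-j}, ψ⁻_j} = E_s` (up to a multiple of `δ_{s,0}`)
  have key : ∀ j, a j + b (s - j) = M.act E s w + (if s = 0 then ((s - j : ℤ) : ℂ) * k else 0) • w := by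
    intro j
    simp only [ha, hb, sub_sub_cancel]
    rw [PM]
    simp only [sub_add_cancel]
    abel
  have h0 : (M.act psiP s (M.act psiM 0 w) - M.act psiP 0 (M.act psiM s w)) = a 0 - a (0 + s) := by
    simp [ha]
  rw [h0]
  change ∑ j ∈ Finset.range K, ((a ((j : ℤ) + 1) - a ((j : ℤ) + 1 + s))
    + (b ((j : ℤ) + 1) - b ((j : ℤ) + 1 + s))) + (a 0 - a (0 + s)) = _
  rcases lt_trichotomy s 0 with hs | rfl | hs
  · obtain ⟨m, hm⟩ : ∃ m : ℕ, s = -m := ⟨s.natAbs, by omega⟩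
    have habs : |s| = m := by rw [hm]; simp
    rw [habs] at hsK hz
    have t1 := sum_range_sub_shift (fun j => a (j + 1 - m)) m K (fun j hj => (hz _ (by omega)).1)
    have t2 := sum_range_sub_shift (fun j => b (j + 1 - m)) m K (fun j hj => (hz _ (by omega)).2)
    have e1 : ∀ j : ℕ, (a ((j : ℤ) + 1) - a ((j : ℤ) + 1 + s))
        + (b ((j : ℤ) + 1) - b ((j : ℤ) + 1 + s)) =
        -((a ((j : ℤ) + 1 - m) - a ((j : ℤ) + m + 1 - m))
          + (b ((j : ℤ) + 1 - m) - b ((j : ℤ) + m + 1 - m))) := by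
      intro j
      have : (j : ℤ) + 1 + s = j + 1 - m := by omega
      rw [this]
      have : (j : ℤ) + m + 1 - m = j + 1 := by ring
      rw [this]
      abel
    rw [Finset.sum_congr rfl fun j _ => e1 j, Finset.sum_neg_distrib, Finset.sum_add_distrib, t1, t2]
    have t3 : ∑ j ∈ Finset.range m, b ((j : ℤ) + 1 - m) = ∑ j ∈ Finset.range m, b (s - ((j:ℤ) - m)) := by
      rw [← Finset.sum_range_reflect]
      refine Finset.sum_congr rfl fun j hj => ?_
      have := Finset.mem_range.1 hj
      congr 1
      omega
    have t4 : ∑ j ∈ Finset.range m, a ((j : ℤ) + 1 - m) + a s =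
        ∑ j ∈ Finset.range m, a ((j : ℤ) - m) + a 0 := by
      have u1 := Finset.sum_range_succ (fun j : ℕ => a ((j : ℤ) - m)) m
      have u2 := Finset.sum_range_succ' (fun j : ℕ => a ((j : ℤ) - m)) m
      have u3 : ((m : ℕ) : ℤ) - m = 0 := by ring
      have u4 : ((0 : ℕ) : ℤ) - m = s := by omega
      rw [u1] at u2
      rw [u3] at u2
      simp only [u4] at u2
      rw [u2]
      simp only [Nat.cast_add, Nat.cast_one]
    have t5 : ∑ j ∈ Finset.range m, a ((j : ℤ) - m) + ∑ j ∈ Finset.range m, b (s - ((j:ℤ) - m))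
        = (m : ℂ) • M.act E s w := by
      rw [← Finset.sum_add_distrib]
      simp only [key, hs.ne, if_false, zero_smul, add_zero]
      simp [Nat.cast_smul_eq_nsmul]
    rw [zero_add, t3]
    have : (s : ℂ) = -(m : ℂ) := by rw [hm]; simp
    rw [this, neg_smul, ← t5, eq_sub_of_add_eq t4]
    abel
  · simp
  · obtain ⟨m, hm⟩ : ∃ m : ℕ, s = m := ⟨s.natAbs, by omega⟩
    have habs : |s| = m := by rw [hm]; simp
    rw [habs] at hsK hz
    have t1 := sum_range_sub_shift (fun j => a (j + 1)) m K (fun j hj => (hz _ (by omega)).1)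
    have t2 := sum_range_sub_shift (fun j => b (j + 1)) m K (fun j hj => (hz _ (by omega)).2)
    have e1 : ∀ j : ℕ, (a ((j : ℤ) + 1) - a ((j : ℤ) + 1 + s))
        + (b ((j : ℤ) + 1) - b ((j : ℤ) + 1 + s)) =
        ((a ((j : ℤ) + 1) - a ((j : ℤ) + m + 1))
          + (b ((j : ℤ) + 1) - b ((j : ℤ) + m + 1))) := by
      intro j
      have : (j : ℤ) + 1 + s = j + m + 1 := by omega
      rw [this]
    rw [Finset.sum_congr rfl fun j _ => e1 j, Finset.sum_add_distrib, t1, t2]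
    have t3 : ∑ j ∈ Finset.range m, b ((j : ℤ) + 1) = ∑ j ∈ Finset.range m, b (s - (j:ℤ)) := by
      rw [← Finset.sum_range_reflect]
      refine Finset.sum_congr rfl fun j hj => ?_
      have := Finset.mem_range.1 hj
      congr 1
      omega
    have t4 : ∑ j ∈ Finset.range m, a ((j : ℤ) + 1) + a 0 =
        ∑ j ∈ Finset.range m, a (j : ℤ) + a s := by
      have u1 := Finset.sum_range_succ (fun j : ℕ => a (j : ℤ)) m
      have u2 := Finset.sum_range_succ' (fun j : ℕ => a (j : ℤ)) m
      rw [u1] at u2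
      rw [hm, u2]
      simp only [Nat.cast_add, Nat.cast_one, Nat.cast_zero]
    have t5 : ∑ j ∈ Finset.range m, a (j : ℤ) + ∑ j ∈ Finset.range m, b (s - (j:ℤ))
        = (m : ℂ) • M.act E s w := by
      rw [← Finset.sum_add_distrib]
      simp only [key, hs.ne', if_false, zero_smul, add_zero]
      simp [Nat.cast_smul_eq_nsmul]
    rw [zero_add, t3]
    have : (s : ℂ) = (m : ℂ) := by rw [hm]; simp
    rw [this, ← t5, eq_sub_of_add_eq t4]
    abel

theorem L0_N (M : AffMod k) (hk : k ≠ 0) (h : M.IsSmooth) (s : ℤ) (w : M.W) :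
    M.L0 h (M.act N s w) = M.act N s (M.L0 h w) - (s : ℂ) • M.act N s w := by
  obtain ⟨K₁, hK₁⟩ := M.exists_bound h w
  obtain ⟨K₂, hK₂⟩ := M.exists_bound h (M.act N s w)
  set K : ℕ := K₁ + K₂ + s.natAbs with hK
  have hsK : |s| ≤ K := by rw [Int.abs_eq_natAbs]; omega
  rw [M.L0_eq h w K fun a r hr => hK₁ a r (by omega),
    M.L0_eq h _ K fun a r hr => hK₂ a r (by omega), map_add, map_sum, ← sub_eq_zero]
  have t := M.telescope s w K hsK fun a r hr => hK₁ a r (by rw [Int.abs_eq_natAbs] at hr; omega)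
  have e : ∀ x y z u v : M.W, x + y - (z + u - v) = (x - z) + (y - u) + v := by intros; abel
  have e2 : ∀ p x y z : M.W, p + (1 / k) • x + (1 / k) • y + z = p + (1 / k) • (x + y) + z := by
    intros; rw [smul_add]; abel
  rw [e, ← Finset.sum_sub_distrib, zero_N,
    Finset.sum_congr rfl fun (j : ℕ) _ => M.term_N hk ((j : ℤ) + 1) s w (by omega),
    Finset.sum_add_distrib, Finset.sum_add_distrib, ← Finset.smul_sum, e2, t]
  rcases lt_trichotomy s 0 with hs | rfl | hs
  · rw [sum_range_delta _ (-s) K (by omega) (by rw [abs_of_neg hs] at hsK; exact hsK),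
      Finset.sum_eq_zero fun j _ => if_neg (by omega)]
    match_scalars <;> field_simp <;> ring
  · simp
  · rw [sum_range_delta _ s K hs (by rw [abs_of_pos hs] at hsK; exact hsK),
      Finset.sum_eq_zero (f := fun x : ℕ => if (x : ℤ) + 1 = -s then _ else _)
        fun j _ => if_neg (by omega)]
    match_scalars <;> field_simp <;> ring

theorem L0_P0 (M : AffMod k) (h : M.IsSmooth) (w : M.W) :
    M.L0 h (M.act psiP 0 w) = M.act psiP 0 (M.L0 h w) := by
  obtain ⟨K₁, hK₁⟩ := M.exists_bound h w
  obtain ⟨K₂, hK₂⟩ := M.exists_bound h (M.act psiP 0 w)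
  rw [M.L0_eq h w (K₁ + K₂) fun a r hr => hK₁ a r (by omega),
    M.L0_eq h _ (K₁ + K₂) fun a r hr => hK₂ a r (by omega), map_add, map_sum]
  congr 1
  · refine Finset.sum_congr rfl fun j _ => ?_
    set i : ℤ := j + 1
    have hi : i ≠ 0 := by omega
    simp only [sugawaraTerm, LinearMap.add_apply, LinearMap.smul_apply, LinearMap.sub_apply,
      Module.End.mul_apply, map_add, map_sub, map_smul, NP, EP, add_zero, MP, M.PP i 0,
      M.PP (-i) 0, map_neg, hi, if_false, zero_smul, neg_eq_zero]
    match_scalars <;> field_simp <;> ring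
  · simp only [sugawaraZero, LinearMap.add_apply, LinearMap.smul_apply, LinearMap.sub_apply,
      Module.End.mul_apply, map_add, map_sub, map_smul, NP, EP, add_zero, MP, PP_self,
      map_neg, if_true]
    simp only [Int.cast_zero, zero_mul, neg_zero, zero_smul, add_zero]
    match_scalars <;> field_simp <;> ring

theorem L0_M0 (M : AffMod k) (h : M.IsSmooth) (w : M.W) :
    M.L0 h (M.act psiM 0 w) = M.act psiM 0 (M.L0 h w) := by
  obtain ⟨K₁, hK₁⟩ := M.exists_bound h w
  obtain ⟨K₂, hK₂⟩ := M.exists_bound h (M.act psiM 0 w)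
  rw [M.L0_eq h w (K₁ + K₂) fun a r hr => hK₁ a r (by omega),
    M.L0_eq h _ (K₁ + K₂) fun a r hr => hK₂ a r (by omega), map_add, map_sum]
  congr 1
  · refine Finset.sum_congr rfl fun j _ => ?_
    set i : ℤ := j + 1
    have hi : i ≠ 0 := by omega
    have hi' : -i ≠ 0 := by omega
    simp only [sugawaraTerm, LinearMap.add_apply, LinearMap.smul_apply, LinearMap.sub_apply,
      Module.End.mul_apply, map_add, map_sub, map_smul, NM, EM, add_zero, PM, M.MM i 0,
      M.MM (-i) 0, map_neg, hi, hi', if_false, zero_smul]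
    match_scalars <;> field_simp <;> ring
  · simp only [sugawaraZero, LinearMap.add_apply, LinearMap.smul_apply, LinearMap.sub_apply,
      Module.End.mul_apply, map_add, map_sub, map_smul, NM, EM, add_zero, MM_self]
    rw [M.PM 0 0 w]
    simp only [Int.cast_zero, zero_mul, zero_smul, add_zero, map_add, map_neg, map_zero, MM_self,
      ite_self]
    match_scalars <;> field_simp

/-- The modes are homogeneous for `L₀`: `[L₀, a_r] = -r a_r`.  All modes are commutators of `N_s`
with `ψ^±_0`, for which the commutator is computed directly. -/
theorem L0_act (M : AffMod k) (hk : k ≠ 0) (h : M.IsSmooth) (a : Gen) (r : ℤ) (w : M.W) :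
    M.L0 h (M.act a r w) = M.act a r (M.L0 h w) - (r : ℂ) • M.act a r w := by
  have hP : ∀ w, M.L0 h (M.act psiP r w) = M.act psiP r (M.L0 h w) - (r : ℂ) • M.act psiP r w := by
    intro w
    have e : ∀ w, M.act psiP r w = M.act N r (M.act psiP 0 w) - M.act psiP 0 (M.act N r w) := by
      intro w; rw [NP]; simp
    rw [e w, map_sub, L0_N M hk, L0_P0, L0_P0, L0_N M hk, e]
    simp only [map_sub, map_smul, smul_sub]
    abel
  have hM : ∀ w, M.L0 h (M.act psiM r w) = M.act psiM r (M.L0 h w) - (r : ℂ) • M.act psiM r w := by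
    intro w
    have e : ∀ w, M.act psiM r w = M.act psiM 0 (M.act N r w) - M.act N r (M.act psiM 0 w) := by
      intro w; rw [NM]; simp
    rw [e w, map_sub, L0_N M hk, L0_M0, L0_M0, L0_N M hk, e]
    simp only [map_sub, map_smul, smul_sub]
    abel
  cases a
  · exact M.L0_N hk h r w
  · have e : ∀ w, M.act E r w = M.act psiM 0 (M.act psiP r w) + M.act psiP r (M.act psiM 0 w) := by
      intro w; rw [MP]; simp
    rw [e w, map_add, hP, L0_M0, L0_M0, hP, e]
    simp only [map_sub, map_smul, smul_add]
    abel
  · exact hP w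
  · exact hM w

end AffMod

end AffGL
namespace AffGL

open Gen Polynomial

/-! ### Locally semisimple and locally algebraic operators -/

section LinearAlgebra

variable {V V' : Type*} [AddCommGroup V] [Module ℂ V] [AddCommGroup V'] [Module ℂ V']

theorem map_aeval_apply (f : V →ₗ[ℂ] V') (A : Module.End ℂ V) (B : Module.End ℂ V')
    (h : ∀ w, f (A w) = B (f w)) (p : ℂ[X]) (w : V) : f (aeval A p w) = aeval B p (f w) := by
  induction p using Polynomial.induction_on' generalizing w with
  | add p q hp hq => simp [hp, hq]
  | monomial n c =>
    have : ∀ n : ℕ, ∀ w, f ((A ^ n) w) = (B ^ n) (f w) := by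
      intro n
      induction n with
      | zero => simp
      | succ n ih => intro w; rw [pow_succ, pow_succ, Module.End.mul_apply, Module.End.mul_apply, ih, h]
    simp [aeval_monomial, this]

theorem map_pow_apply (f : V →ₗ[ℂ] V') (A : Module.End ℂ V) (B : Module.End ℂ V')
    (h : ∀ w, f (A w) = B (f w)) (n : ℕ) (w : V) : f ((A ^ n) w) = (B ^ n) (f w) := by
  simpa using map_aeval_apply f A B h (X ^ n) w

theorem iSup_eigenspace_of_surjective (f : V →ₗ[ℂ] V') (hf : Function.Surjective f)
    (A : Module.End ℂ V) (B : Module.End ℂ V') (h : ∀ w, f (A w) = B (f w))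
    (hA : (⨆ μ : ℂ, A.eigenspace μ) = ⊤) : (⨆ μ : ℂ, B.eigenspace μ) = ⊤ := by
  have h1 : (⨆ μ : ℂ, A.eigenspace μ) ≤ (⨆ μ : ℂ, B.eigenspace μ).comap f := by
    refine iSup_le fun μ w hw => ?_
    refine Submodule.mem_iSup_of_mem μ ?_
    rw [Module.End.mem_eigenspace_iff] at hw ⊢
    rw [← h, hw, map_smul]
  rw [hA] at h1
  rw [eq_top_iff]
  intro w _
  obtain ⟨v, rfl⟩ := hf w
  exact h1 (Submodule.mem_top)

theorem iSup_eigenspace_add (A : Module.End ℂ V) (c : ℂ) (hA : (⨆ μ : ℂ, A.eigenspace μ) = ⊤) :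
    (⨆ μ : ℂ, (A + c • (1 : Module.End ℂ V)).eigenspace μ) = ⊤ := by
  rw [eq_top_iff, ← hA]
  refine iSup_le fun μ w hw => Submodule.mem_iSup_of_mem (μ + c) ?_
  rw [Module.End.mem_eigenspace_iff] at hw ⊢
  simp [hw, add_smul]

/-- On a locally semisimple operator, the projection to an eigenspace is locally a polynomial. -/
theorem exists_poly_eigen (A : Module.End ℂ V) (hA : (⨆ μ : ℂ, A.eigenspace μ) = ⊤) (w : V)
    (μ : ℂ) : ∃ g : ℂ[X], g.eval μ ≠ 0 ∧ A (aeval A g w) = μ • aeval A g w := by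
  have hw : w ∈ ⨆ μ : ℂ, A.eigenspace μ := hA ▸ Submodule.mem_top
  have comm : ∀ (g : ℂ[X]) (v : V), A (aeval A g v) = aeval A g (A v) := fun g v =>
    (map_aeval_apply A A A (fun _ => rfl) g v)
  induction hw using Submodule.iSup_induction' with
  | mem ν v hv =>
    rw [Module.End.mem_eigenspace_iff] at hv
    by_cases h : ν = μ
    · exact ⟨1, by simp, by simp [hv, h]⟩
    · refine ⟨X - C ν, by simpa [sub_eq_zero] using fun e => h e.symm, ?_⟩
      simp [hv]
  | zero => exact ⟨1, by simp, by simp⟩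
  | add v v' _ _ h1 h2 =>
    obtain ⟨g, hg, h⟩ := h1
    obtain ⟨g', hg', h'⟩ := h2
    refine ⟨g * g', by simp [hg, hg'], ?_⟩
    have e1 : aeval A (g * g') v = aeval A g' (aeval A g v) := by
      rw [mul_comm, map_mul, Module.End.mul_apply]
    have e2 : aeval A (g * g') v' = aeval A g (aeval A g' v') := by
      rw [map_mul, Module.End.mul_apply]
    rw [map_add, e1, e2, map_add, comm g', h, comm g, h', map_smul, map_smul, smul_add]

theorem aeval_apply_of_eigen (A : Module.End ℂ V) (w : V) (μ : ℂ) (h : A w = μ • w) (g : ℂ[X]) :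
    aeval A g w = g.eval μ • w := by
  induction g using Polynomial.induction_on' with
  | add p q hp hq => simp [hp, hq, add_smul]
  | monomial n c =>
    have : (A ^ n) w = μ ^ n • w := by
      induction n with
      | zero => simp
      | succ n ih => rw [pow_succ', Module.End.mul_apply, ih, map_smul, h, smul_smul, pow_succ]
    simp [aeval_monomial, this, smul_smul, mul_comm]

/-- Commuting operators: polynomials of one preserve the eigenvectors of the other. -/
theorem aeval_comm_apply (A B : Module.End ℂ V) (h : ∀ w, A (B w) = B (A w)) (g : ℂ[X]) (w : V) :
    A (aeval B g w) = aeval B g (A w) := map_aeval_apply A B B h g w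

end LinearAlgebra

namespace AffMod

variable {k : ℂ} {M M' M'' : AffMod k}

/-! ### Homomorphisms and graded submodules -/

theorem IsHomogHom.sugawaraTerm {p : ℕ} {f : M.W →ₗ[ℂ] M'.W} (hf : IsHomogHom M M' p f) (r : ℤ)
    (w : M.W) : M'.sugawaraTerm r (f w) = f (M.sugawaraTerm r w) := by
  have h : ((-1 : ℂ) ^ p) * (-1) ^ p = 1 := by rw [← mul_pow]; simp
  simp [AffMod.sugawaraTerm, hf.2, par, smul_smul, h]

theorem IsHomogHom.sugawaraZero {p : ℕ} {f : M.W →ₗ[ℂ] M'.W} (hf : IsHomogHom M M' p f)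
    (w : M.W) : M'.sugawaraZero (f w) = f (M.sugawaraZero w) := by
  have h : ((-1 : ℂ) ^ p) * (-1) ^ p = 1 := by rw [← mul_pow]; simp
  simp [AffMod.sugawaraZero, hf.2, par, smul_smul, h]

theorem IsHom.act_even {f : M.W →ₗ[ℂ] M'.W} (hf : IsHom M M' f) {a : Gen} (ha : par a = 0) (r : ℤ)
    (w : M.W) : M'.act a r (f w) = f (M.act a r w) := by
  obtain ⟨f₀, f₁, h0, h1, rfl⟩ := hf
  simp [h0.2, h1.2, ha]

theorem IsHom.L0 {f : M.W →ₗ[ℂ] M'.W} (hf : IsHom M M' f) (h : M.IsSmooth) (h' : M'.IsSmooth)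
    (w : M.W) : M'.L0 h' (f w) = f (M.L0 h w) := by
  obtain ⟨f₀, f₁, h0, h1, rfl⟩ := hf
  obtain ⟨K₁, hK₁⟩ := M.exists_bound h w
  obtain ⟨K₂, hK₂⟩ := M'.exists_bound h' ((f₀ + f₁) w)
  rw [M.L0_eq h w (K₁ + K₂) fun a r hr => hK₁ a r (by omega),
    M'.L0_eq h' _ (K₁ + K₂) fun a r hr => hK₂ a r (by omega)]
  simp [h0.sugawaraTerm, h1.sugawaraTerm, h0.sugawaraZero, h1.sugawaraZero, Finset.sum_add_distrib]
  abel

/-- The conjugate `θ f θ` of a linear map by the parity involutions. -/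
def twist (M M' : AffMod k) (f : M.W →ₗ[ℂ] M'.W) : M.W →ₗ[ℂ] M'.W := M'.θ ∘ₗ f ∘ₗ M.θ

theorem twist_twist (f : M.W →ₗ[ℂ] M'.W) : twist M M' (twist M M' f) = f := by
  ext w; simp [twist, θ_θ]

theorem twist_apply (f : M.W →ₗ[ℂ] M'.W) (w : M.W) : twist M M' f w = M'.θ (f (M.θ w)) := rfl

theorem IsHomogHom.twist {p : ℕ} {f : M.W →ₗ[ℂ] M'.W} (hf : IsHomogHom M M' p f) :
    AffMod.twist M M' f = ((-1 : ℂ) ^ p) • f := by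
  ext w
  simp [AffMod.twist, hf.1, θ_θ]

theorem IsHomogHom.smul {p : ℕ} {f : M.W →ₗ[ℂ] M'.W} (hf : IsHomogHom M M' p f) (c : ℂ) :
    IsHomogHom M M' p (c • f) := by
  refine ⟨fun w => ?_, fun a r w => ?_⟩
  · simp [hf.1, smul_comm c]
  · simp [hf.2, smul_comm c]

theorem IsHomogHom.add {p : ℕ} {f g : M.W →ₗ[ℂ] M'.W} (hf : IsHomogHom M M' p f)
    (hg : IsHomogHom M M' p g) : IsHomogHom M M' p (f + g) :=
  ⟨fun w => by simp [hf.1, hg.1], fun a r w => by simp [hf.2, hg.2]⟩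

theorem IsHomogHom.zero (p : ℕ) : IsHomogHom M M' p 0 :=
  ⟨fun w => by simp, fun a r w => by simp⟩

theorem IsHomogHom.isHom_zero {f : M.W →ₗ[ℂ] M'.W} (hf : IsHomogHom M M' 0 f) : IsHom M M' f :=
  ⟨f, 0, hf, .zero 1, by simp⟩

theorem IsHomogHom.isHom_one {f : M.W →ₗ[ℂ] M'.W} (hf : IsHomogHom M M' 1 f) : IsHom M M' f :=
  ⟨0, f, .zero 0, hf, by simp⟩

theorem IsHom.twist {f : M.W →ₗ[ℂ] M'.W} (hf : IsHom M M' f) :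
    IsHom M M' (AffMod.twist M M' f) := by
  obtain ⟨f₀, f₁, h0, h1, rfl⟩ := hf
  refine ⟨f₀, (-1 : ℂ) • f₁, h0, h1.smul _, ?_⟩
  have e0 := h0.twist
  have e1 := h1.twist
  rw [pow_zero, one_smul] at e0
  rw [pow_one] at e1
  rw [← e1]
  conv_rhs => rw [← e0]
  ext w
  simp [AffMod.twist]

/-- Odd modes intertwine a homomorphism with its parity conjugate. -/
theorem IsHom.act_odd {f : M.W →ₗ[ℂ] M'.W} (hf : IsHom M M' f) {a : Gen} (ha : par a = 1) (r : ℤ)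
    (w : M.W) : M'.act a r (f w) = AffMod.twist M M' f (M.act a r w) := by
  obtain ⟨f₀, f₁, h0, h1, rfl⟩ := hf
  have e0 := LinearMap.congr_fun h0.twist (M.act a r w)
  have e1 := LinearMap.congr_fun h1.twist (M.act a r w)
  simp only [twist_apply, LinearMap.smul_apply] at e0 e1
  simp [AffMod.twist, h0.2, h1.2, ha, e0, e1]

theorem IsHom.act_zero {f : M.W →ₗ[ℂ] M'.W} (hf : IsHom M M' f) (a : Gen) (r : ℤ) (w : M.W)
    (h : M.act a r w = 0) : M'.act a r (f w) = 0 := by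
  obtain ⟨f₀, f₁, h0, h1, rfl⟩ := hf
  simp [h0.2, h1.2, h]

theorem twist_surjective {f : M.W →ₗ[ℂ] M'.W} (hf : Function.Surjective f) :
    Function.Surjective (twist M M' f) := by
  intro w
  obtain ⟨v, hv⟩ := hf (M'.θ w)
  exact ⟨M.θ v, by simp [twist, θ_θ, hv]⟩

theorem IsHom.comp {g : M'.W →ₗ[ℂ] M''.W} {f : M.W →ₗ[ℂ] M'.W} (hg : IsHom M' M'' g)
    (hf : IsHom M M' f) : IsHom M M'' (g ∘ₗ f) := by
  obtain ⟨f₀, f₁, f0, f1, rfl⟩ := hf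
  obtain ⟨g₀, g₁, g0, g1, rfl⟩ := hg
  have neg1 : ∀ a : Gen, ((-1 : ℂ) ^ par a) * (-1) ^ par a = 1 := by
    intro a; rw [← mul_pow]; simp
  refine ⟨g₀ ∘ₗ f₀ + g₁ ∘ₗ f₁, g₀ ∘ₗ f₁ + g₁ ∘ₗ f₀, ⟨fun w => ?_, fun a r w => ?_⟩,
    ⟨fun w => ?_, fun a r w => ?_⟩, ?_⟩
  · simp [f0.1, f1.1, g0.1, g1.1]
  · simp [f0.2, f1.2, g0.2, g1.2, smul_smul, neg1]
  · simp [f0.1, f1.1, g0.1, g1.1]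
  · simp [f0.2, f1.2, g0.2, g1.2]
  · ext w; simp; abel

theorem IsHom.sub {f g : M.W →ₗ[ℂ] M'.W} (hf : IsHom M M' f) (hg : IsHom M M' g) :
    IsHom M M' (f - g) := by
  obtain ⟨f₀, f₁, f0, f1, rfl⟩ := hf
  obtain ⟨g₀, g₁, g0, g1, rfl⟩ := hg
  exact ⟨f₀ + (-1 : ℂ) • g₀, f₁ + (-1 : ℂ) • g₁, f0.add (g0.smul _), f1.add (g1.smul _), by
    ext w; simp; abel⟩

theorem isHomogHom_id (M : AffMod k) : IsHomogHom M M 0 LinearMap.id :=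
  ⟨fun w => by simp, fun a r w => by simp⟩

theorem isHomogHom_mkQ (M : AffMod k) (X : M.GSub) : IsHomogHom M (M.quot X) 0 X.1.mkQ :=
  ⟨fun w => by rw [pow_zero, one_smul]; rfl, fun a r w => by rw [mul_zero, pow_zero, one_smul]; rfl⟩

theorem subset_generated (M : AffMod k) (s : Set M.W) : s ⊆ (M.generated s).1 := by
  intro w hw
  exact (Submodule.mem_sInf (x := w)).2 fun X hX => hX.2 hw

theorem generated_le (M : AffMod k) (s : Set M.W) (X : Submodule ℂ M.W) (hX : M.IsGraded X)
    (hs : s ⊆ X) : (M.generated s).1 ≤ X := sInf_le ⟨hX, hs⟩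

theorem mem_generated_self (M : AffMod k) (v : M.W) : v ∈ (M.generated {v}).1 :=
  M.subset_generated _ rfl

/-- The kernel of a homomorphism meets its parity conjugate in a graded submodule. -/
theorem IsHom.isGraded_ker {f : M.W →ₗ[ℂ] M'.W} (hf : IsHom M M' f) :
    M.IsGraded (LinearMap.ker f ⊓ LinearMap.ker (AffMod.twist M M' f)) := by
  refine ⟨fun a r w hw => ?_, fun w hw => ?_⟩
  · obtain ⟨h1, h2⟩ := hw
    rw [SetLike.mem_coe, LinearMap.mem_ker] at h1 h2
    have hpar : par a = 0 ∨ par a = 1 := by cases a <;> simp [par]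
    rcases hpar with ha | ha
    · refine ⟨?_, ?_⟩ <;> rw [SetLike.mem_coe, LinearMap.mem_ker]
      · rw [← hf.act_even ha, h1, map_zero]
      · rw [← hf.twist.act_even ha, h2, map_zero]
    · refine ⟨?_, ?_⟩ <;> rw [SetLike.mem_coe, LinearMap.mem_ker]
      · have := hf.twist.act_odd ha r w
        rw [twist_twist] at this
        rw [← this, h2, map_zero]
      · rw [← hf.act_odd ha, h1, map_zero]
  · obtain ⟨h1, h2⟩ := hw
    rw [SetLike.mem_coe, LinearMap.mem_ker] at h1 h2
    refine ⟨?_, ?_⟩ <;> rw [SetLike.mem_coe, LinearMap.mem_ker]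
    · rw [twist_apply] at h2
      rw [← M'.θ_θ (f (M.θ w)), h2, map_zero]
    · rw [twist_apply, θ_θ, h1, map_zero]

/-- A homomorphism that vanishes on an even generator is zero. -/
theorem IsHom.eq_zero {f : M.W →ₗ[ℂ] M'.W} (hf : IsHom M M' f) {v : M.W}
    (hv : (M.generated {v}).1 = ⊤) (hθ : M.θ v = v) (h : f v = 0) : f = 0 := by
  have h1 := M.generated_le {v} _ hf.isGraded_ker (by
    rintro _ rfl
    exact ⟨by simpa using h, by simp [twist_apply, hθ, h]⟩)
  rw [hv] at h1
  ext w
  exact (h1 (Submodule.mem_top (x := w))).1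

/-- The range of a homomorphism contains the graded submodule generated by each homogeneous vector
in it. -/
theorem IsHom.generated_le_range {f : M.W →ₗ[ℂ] M'.W} (hf : IsHom M M' f) {y : M'.W} {c : ℂ}
    (hy : y ∈ LinearMap.range f) (hθ : M'.θ y = c • y) :
    (M'.generated {y}).1 ≤ LinearMap.range f := by
  have key : M'.IsGraded (LinearMap.range f ⊓ LinearMap.range (AffMod.twist M M' f)) := by
    refine ⟨fun a r w hw => ?_, fun w hw => ?_⟩
    · obtain ⟨⟨x, hx⟩, ⟨x', hx'⟩⟩ := hw
      have hpar : par a = 0 ∨ par a = 1 := by cases a <;> simp [par]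
      rcases hpar with ha | ha
      · exact ⟨⟨M.act a r x, by rw [← hx, hf.act_even ha]⟩,
          ⟨M.act a r x', by rw [← hx', hf.twist.act_even ha]⟩⟩
      · refine ⟨⟨M.act a r x', ?_⟩, ⟨M.act a r x, ?_⟩⟩
        · rw [← hx', hf.twist.act_odd ha, twist_twist]
        · rw [← hx, hf.act_odd ha]
    · obtain ⟨⟨x, hx⟩, ⟨x', hx'⟩⟩ := hw
      refine ⟨⟨M.θ x', ?_⟩, ⟨M.θ x, ?_⟩⟩
      · rw [← hx', twist_apply, θ_θ]
      · rw [← hx, twist_apply, θ_θ]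
  refine (M'.generated_le {y} _ key ?_).trans inf_le_left
  rw [Set.singleton_subset_iff]
  refine ⟨hy, ?_⟩
  obtain ⟨x, hx⟩ := hy
  have hcc : (c * c) • y = y := by
    rw [mul_smul, ← hθ, ← map_smul, ← hθ, θ_θ]
  refine ⟨c • M.θ x, ?_⟩
  rw [map_smul, twist_apply, θ_θ, hx, hθ, smul_smul, hcc]

/-- The range of a parity-homogeneous homomorphism is a graded submodule. -/
theorem IsHomogHom.isGraded_range {p : ℕ} {f : M.W →ₗ[ℂ] M'.W} (hf : IsHomogHom M M' p f) :
    M'.IsGraded (LinearMap.range f) := by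
  refine ⟨fun a r => ?_, ?_⟩
  · rintro _ ⟨x, rfl⟩
    exact ⟨((-1 : ℂ) ^ (par a * p)) • M.act a r x, by rw [hf.2, map_smul]⟩
  · rintro _ ⟨x, rfl⟩
    exact ⟨((-1 : ℂ) ^ p) • M.θ x, by rw [hf.1, map_smul]⟩

/-! ### Spanning by words in creation operators -/

/-- Words in the modes selected by `C`, applied to vectors of `Y`. -/
inductive Words (M : AffMod k) (C : Gen → ℤ → Prop) (Y : Submodule ℂ M.W) : M.W → Prop
  | base (y : M.W) (hy : y ∈ Y) : Words M C Y y
  | step (a : Gen) (r : ℤ) (w : M.W) (ha : C a r) (hw : Words M C Y w) : Words M C Y (M.act a r w)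

/-- If the modes outside `C` preserve `Y`, then words in the modes of `C` applied to `Y` span the
submodule generated by `Y`. -/
theorem generated_le_span_words (M : AffMod k) (C : Gen → ℤ → Prop) (Y : Submodule ℂ M.W)
    (hY : ∀ a r, ¬ C a r → ∀ y ∈ Y, M.act a r y ∈ Y) (hθ : ∀ y ∈ Y, M.θ y ∈ Y) :
    (M.generated Y).1 ≤ Submodule.span ℂ {w | Words M C Y w} := by
  set Z := Submodule.span ℂ {w | Words M C Y w} with hZ
  have hC : ∀ a r, C a r → ∀ w ∈ Z, M.act a r w ∈ Z := by
    intro a r ha w hw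
    have : Z ≤ Z.comap (M.act a r) := by
      rw [hZ, Submodule.span_le]
      intro w hw
      exact Submodule.subset_span (Words.step a r w ha hw)
    exact this hw
  have hword : ∀ w, Words M C Y w → ∀ a r, M.act a r w ∈ Z := by
    intro w hw
    induction hw with
    | base y hy =>
      intro a r
      by_cases ha : C a r
      · exact Submodule.subset_span (Words.step a r y ha (Words.base y hy))
      · exact Submodule.subset_span (Words.base _ (hY a r ha y hy))
    | step b s w hb hw ih =>
      intro a r
      exact M.rel_mem Z a b r s w (hC b s hb _ (ih a r)) (fun c => ih c _)
        (fun _ => Submodule.subset_span hw)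
  refine M.generated_le _ Z ⟨fun a r => ?_, ?_⟩ fun y hy => Submodule.subset_span (Words.base y hy)
  · rw [hZ, Submodule.span_le]
    exact fun w hw => hword w hw a r
  · rw [hZ, Submodule.span_le]
    intro w hw
    change M.θ w ∈ Z
    induction hw with
    | base y hy => exact Submodule.subset_span (Words.base _ (hθ y hy))
    | step a r w ha hw ih =>
      rw [θ_act_apply]
      exact Z.smul_mem _ (hC a r ha _ ih)

/-! ### Locally nilpotent modules -/

/-- Smooth modules on which the positive Heisenberg modes are locally nilpotent and `N₀`, `E₀` are
semisimple.  This class contains `O_k^fin`, and is closed under spectral flow. -/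
structure Nice (M : AffMod k) : Prop where
  smooth : M.IsSmooth
  nilE : ∀ r : ℤ, 0 < r → ∀ w, ∃ j : ℕ, (M.act E r ^ j) w = 0
  nilN : ∀ r : ℤ, 0 < r → ∀ w, ∃ j : ℕ, (M.act N r ^ j) w = 0
  ssN : (⨆ μ : ℂ, (M.act N 0).eigenspace μ) = ⊤
  ssE : (⨆ μ : ℂ, (M.act E 0).eigenspace μ) = ⊤

theorem Nice.nil (hM : M.Nice) (a : Gen) (r : ℤ) (hr : 0 < r) (w : M.W) :
    ∃ j : ℕ, (M.act a r ^ j) w = 0 := by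
  cases a
  · exact hM.nilN r hr w
  · exact hM.nilE r hr w
  · exact ⟨2, by simp [pow_two, PP_self]⟩
  · exact ⟨2, by simp [pow_two, MM_self]⟩

theorem flow_E (M : AffMod k) (l r : ℤ) (hr : r ≠ 0) : (M.flow l).act E r = M.act E r := by
  simp only [flow, flowAct, hr, if_false, zero_smul, add_zero]
  rfl

theorem flow_E_zero (M : AffMod k) (l : ℤ) (w : M.W) :
    (M.flow l).act E 0 w = M.act E 0 w + ((l : ℂ) * k) • w := by
  simp only [flow, flowAct, if_true]
  rfl

theorem Nice.flow (hM : M.Nice) (l : ℤ) : (M.flow l).Nice where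
  smooth w := by
    obtain ⟨R, hR⟩ := hM.smooth w
    refine ⟨max 1 (R + |l|), fun a r hr => ?_⟩
    have h1 : 1 ≤ r := le_trans (le_max_left _ _) hr
    have h2 : R + |l| ≤ r := le_trans (le_max_right _ _) hr
    have h3 := neg_abs_le l
    have h4 := le_abs_self l
    cases a
    · exact hR N r (by omega)
    · rw [flow_E _ _ _ (by omega)]
      exact hR E r (by omega)
    · exact hR psiP (r + l) (by omega)
    · exact hR psiM (r - l) (by omega)
  nilE r hr w := by
    rw [flow_E _ _ _ hr.ne']
    exact hM.nilE r hr w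
  nilN := hM.nilN
  ssN := hM.ssN
  ssE := by
    have h := iSup_eigenspace_add _ ((l : ℂ) * k) hM.ssE
    simp only [AffMod.flow, flowAct, if_true]
    exact h

theorem Nice.of_surjective (hM : M.Nice) (f : M.W →ₗ[ℂ] M'.W) (hf : IsHom M M' f)
    (hs : Function.Surjective f) : M'.Nice where
  smooth w := by
    obtain ⟨v, rfl⟩ := hs w
    obtain ⟨R, hR⟩ := hM.smooth v
    exact ⟨R, fun a r hr => hf.act_zero a r v (hR a r hr)⟩
  nilE r hr w := by
    obtain ⟨v, rfl⟩ := hs w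
    obtain ⟨j, hj⟩ := hM.nilE r hr v
    exact ⟨j, by rw [← map_pow_apply f _ _ fun w => (hf.act_even rfl r w).symm, hj, map_zero]⟩
  nilN r hr w := by
    obtain ⟨v, rfl⟩ := hs w
    obtain ⟨j, hj⟩ := hM.nilN r hr v
    exact ⟨j, by rw [← map_pow_apply f _ _ fun w => (hf.act_even rfl r w).symm, hj, map_zero]⟩
  ssN := iSup_eigenspace_of_surjective f hs _ _ (fun w => (hf.act_even rfl 0 w).symm) hM.ssN
  ssE := iSup_eigenspace_of_surjective f hs _ _ (fun w => (hf.act_even rfl 0 w).symm) hM.ssE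

theorem Nice.quot (hM : M.Nice) (X : M.GSub) : (M.quot X).Nice :=
  hM.of_surjective (M' := M.quot X) X.1.mkQ (M.isHomogHom_mkQ X).isHom_zero X.1.mkQ_surjective

/-- One step of the Engel argument: the mode `a_n` preserves the vectors annihilated by all modes of
index greater than `n` and by the modes `b_n` with `b ∈ S`. -/
theorem engel_step (M : AffMod k) (n : ℤ) (hn : 0 < n) (S : Gen → Prop) (a : Gen) (w : M.W)
    (hw : ∀ b s, (n < s ∨ (s = n ∧ S b)) → M.act b s w = 0) (b : Gen) (s : ℤ)
    (h : n < s ∨ (s = n ∧ S b)) : M.act b s (M.act a n w) = 0 := by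
  have hs : n < s + n := by omega
  have h0 : s + n ≠ 0 := by omega
  rw [rel_apply, hw b s h, Finset.sum_eq_zero fun c _ => by rw [hw c _ (Or.inl hs), smul_zero]]
  simp [central, h0]

/-- An Engel-type theorem: from each nonzero vector one reaches, by applying positive modes, a
nonzero vector annihilated by all positive modes. -/
theorem Nice.engel (hM : M.Nice) (Q : M.W → Prop)
    (hQ : ∀ a r w, 0 < r → Q w → Q (M.act a r w)) (w : M.W) (hw : w ≠ 0) (hq : Q w) :
    ∃ w', w' ≠ 0 ∧ Q w' ∧ ∀ a r, 0 < r → M.act a r w' = 0 := by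
  have step : ∀ (n : ℤ), 0 < n → ∀ (S : Gen → Prop) (a : Gen) (w : M.W), w ≠ 0 → Q w →
      (∀ b s, (n < s ∨ (s = n ∧ S b)) → M.act b s w = 0) →
      ∃ w', w' ≠ 0 ∧ Q w' ∧ ∀ b s, (n < s ∨ (s = n ∧ (S b ∨ b = a))) → M.act b s w' = 0 := by
    intro n hn S a w hw hq hS
    classical
    have hex := hM.nil a n hn w
    set j := Nat.find hex with hj
    have hj0 : j ≠ 0 := by
      intro h0
      have := Nat.find_spec hex
      rw [← hj, h0] at this
      exact hw (by simpa using this)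
    obtain ⟨i, hi⟩ := Nat.exists_eq_succ_of_ne_zero hj0
    have all : ∀ i : ℕ, Q ((M.act a n ^ i) w) ∧
        ∀ b s, (n < s ∨ (s = n ∧ S b)) → M.act b s ((M.act a n ^ i) w) = 0 := by
      intro i
      induction i with
      | zero => exact ⟨by simpa using hq, by simpa using hS⟩
      | succ i ih =>
        rw [pow_succ', Module.End.mul_apply]
        exact ⟨hQ _ _ _ hn ih.1, fun b s h => engel_step M n hn S a _ ih.2 b s h⟩
    refine ⟨(M.act a n ^ i) w, ?_, (all i).1, ?_⟩
    · exact Nat.find_min hex (m := i) (by omega)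
    · rintro b s (h | ⟨rfl, h | rfl⟩)
      · exact (all i).2 b s (Or.inl h)
      · exact (all i).2 b s (Or.inr ⟨rfl, h⟩)
      · have := Nat.find_spec hex
        rw [← hj, hi, Nat.succ_eq_add_one, pow_succ', Module.End.mul_apply] at this
        exact this
  have main : ∀ (n : ℕ) (w : M.W), w ≠ 0 → Q w → (∀ b (s : ℤ), (n : ℤ) < s → M.act b s w = 0) →
      ∃ w', w' ≠ 0 ∧ Q w' ∧ ∀ a r, 0 < r → M.act a r w' = 0 := by
    intro n
    induction n with
    | zero => exact fun w hw hq h => ⟨w, hw, hq, by simpa using h⟩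
    | succ n ih =>
      intro w hw hq h
      have hn : (0 : ℤ) < (n + 1 : ℕ) := by positivity
      obtain ⟨w₁, a1, a2, a3⟩ := step _ hn (fun _ => False) N w hw hq
        (fun b s hs => h b s (by simpa using hs))
      obtain ⟨w₂, b1, b2, b3⟩ := step _ hn _ E w₁ a1 a2 a3
      obtain ⟨w₃, c1, c2, c3⟩ := step _ hn _ psiP w₂ b1 b2 b3
      obtain ⟨w₄, d1, d2, d3⟩ := step _ hn _ psiM w₃ c1 c2 c3
      refine ih w₄ d1 d2 fun b s hs => d3 b s ?_
      rcases (show ((n + 1 : ℕ) : ℤ) < s ∨ s = (n + 1 : ℕ) by push_cast; omega) with h | h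
      · exact Or.inl h
      · exact Or.inr ⟨h, by cases b <;> simp⟩
  obtain ⟨K, hK⟩ := M.exists_bound hM.smooth w
  exact main K w hw hq hK

end AffMod

end AffGL
namespace AffGL

open Gen Polynomial

noncomputable section

section LinearAlgebra

variable {V : Type*} [AddCommGroup V] [Module ℂ V]

theorem eq_zero_of_isCoprime (T : Module.End ℂ V) {p q : ℂ[X]} (h : IsCoprime p q) {w : V}
    (hp : aeval T p w = 0) (hq : aeval T q w = 0) : w = 0 := by
  obtain ⟨a, b, hab⟩ := h
  have : aeval T (a * p + b * q) w = w := by rw [hab]; simp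
  rw [← this]
  simp [hp, hq]

theorem isCoprime_X_sub_C_pow {p : ℂ[X]} {c : ℂ} (h : p.eval c ≠ 0) (m : ℕ) :
    IsCoprime ((X - C c) ^ m) p := by
  refine IsCoprime.pow_left ?_
  rw [(irreducible_X_sub_C c).coprime_iff_not_dvd, dvd_iff_isRoot]
  exact h

/-- The projection to a generalised eigenspace along the others is locally a polynomial. -/
theorem exists_poly_genEigen (T : Module.End ℂ V) (c : ℂ) (w : V)
    (hw : ∃ p : ℂ[X], p ≠ 0 ∧ aeval T p w = 0) :
    ∃ (h : ℂ[X]) (m : ℕ), aeval T ((X - C c) ^ m) (aeval T h w) = 0 ∧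
      ∃ s : ℂ[X], h = 1 - s * (X - C c) ^ 2 := by
  obtain ⟨p, hp, hpw⟩ := hw
  obtain ⟨q, hq, hd⟩ := exists_eq_pow_rootMultiplicity_mul_and_not_dvd p hp c
  have hqc : q.eval c ≠ 0 := fun h => hd (dvd_iff_isRoot.2 h)
  obtain ⟨s, t, hst⟩ := isCoprime_X_sub_C_pow hqc 2
  refine ⟨t * q, p.rootMultiplicity c, ?_, s, by rw [← hst]; ring⟩
  rw [← Module.End.mul_apply, ← map_mul]
  have : (X - C c) ^ p.rootMultiplicity c * (t * q) = t * p := by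
    conv_rhs => rw [hq]
    ring
  rw [this, map_mul, Module.End.mul_apply, hpw, map_zero]

/-- The polynomial of `exists_poly_genEigen` fixes the vectors annihilated by `(T - c) ^ 2`. -/
theorem aeval_proj_apply (T : Module.End ℂ V) (c : ℂ) (h s : ℂ[X]) (v : V)
    (hs : h = 1 - s * (X - C c) ^ 2) (hv : aeval T ((X - C c) ^ 2) v = 0) : aeval T h v = v := by
  rw [hs, map_sub, map_mul, LinearMap.sub_apply, Module.End.mul_apply, hv]
  simp

theorem aeval_mem (T : Module.End ℂ V)
    (Y : Submodule ℂ V) (hY : ∀ w ∈ Y, T w ∈ Y) (p : ℂ[X]) (w : V) (hw : w ∈ Y) :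
    aeval T p w ∈ Y := by
  have hpow : ∀ n : ℕ, (T ^ n) w ∈ Y := by
    intro n
    induction n with
    | zero => simpa using hw
    | succ n ih => rw [pow_succ']; exact hY _ ih
  rw [aeval_eq_sum_range]
  simp only [LinearMap.sum_apply, LinearMap.smul_apply]
  exact Y.sum_mem fun i _ => Y.smul_mem _ (hpow i)

/-- An invariant subspace is the sum of its intersections with the eigenspaces of a locally
semisimple operator. -/
theorem mem_iSup_inf_eigenspace (A : Module.End ℂ V) (hA : (⨆ μ : ℂ, A.eigenspace μ) = ⊤)
    (p : Submodule ℂ V) (hp : ∀ w ∈ p, A w ∈ p) (w : V) (hw : w ∈ p) :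
    w ∈ ⨆ μ : ℂ, p ⊓ A.eigenspace μ := by
  have h1 : ∃ s : Finset ℂ, s.Nonempty ∧ aeval A (Lagrange.nodal s id) w = 0 := by
    have hw' : w ∈ ⨆ μ : ℂ, A.eigenspace μ := hA ▸ Submodule.mem_top
    clear hw
    induction hw' using Submodule.iSup_induction' with
    | mem ν v hv =>
      rw [Module.End.mem_eigenspace_iff] at hv
      exact ⟨{ν}, by simp, by simp [Lagrange.nodal, hv]⟩
    | zero => exact ⟨{0}, by simp, by simp⟩
    | add v v' _ _ h1 h2 =>
      obtain ⟨s, hs, h⟩ := h1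
      obtain ⟨t, ht, h'⟩ := h2
      obtain ⟨a, ha⟩ : Lagrange.nodal s id ∣ Lagrange.nodal (s ∪ t) (id : ℂ → ℂ) :=
        Finset.prod_dvd_prod_of_subset _ _ _ Finset.subset_union_left
      obtain ⟨b, hb⟩ : Lagrange.nodal t id ∣ Lagrange.nodal (s ∪ t) (id : ℂ → ℂ) :=
        Finset.prod_dvd_prod_of_subset _ _ _ Finset.subset_union_right
      refine ⟨s ∪ t, hs.mono Finset.subset_union_left, ?_⟩
      rw [map_add]
      conv_lhs => enter [1]; rw [ha, mul_comm]
      rw [hb, mul_comm _ b, map_mul, map_mul, Module.End.mul_apply, Module.End.mul_apply, h, h']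
      simp
  obtain ⟨s, hs, h⟩ := h1
  have h2 : aeval A (∑ μ ∈ s, Lagrange.basis s id μ) w = w := by
    rw [Lagrange.sum_basis (v := id) (fun _ _ _ _ h => h) hs]
    simp
  rw [← h2, map_sum, LinearMap.sum_apply]
  refine Submodule.sum_mem _ fun μ hμ => Submodule.mem_iSup_of_mem μ ⟨?_, ?_⟩
  · exact aeval_mem A p hp _ w hw
  · rw [SetLike.mem_coe, Module.End.mem_eigenspace_iff]
    have h3 : (X - C μ) * Lagrange.basis s id μ =
        C (Lagrange.nodalWeight s id μ) * Lagrange.nodal s id := by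
      rw [Lagrange.basis_eq_prod_sub_inv_mul_nodal_div hμ, Lagrange.nodal_eq_mul_nodal_erase hμ]
      simp only [id]
      rw [mul_div_cancel_left₀ _ (X_sub_C_ne_zero μ)]
      ring
    have h4 : aeval A ((X - C μ) * Lagrange.basis s id μ) w = 0 := by
      rw [h3, map_mul, Module.End.mul_apply, h, map_zero]
    rw [map_mul, Module.End.mul_apply] at h4
    simpa [sub_eq_zero] using h4

end LinearAlgebra

namespace AffMod

variable {k : ℂ} {M M' A B : AffMod k}

/-- The charge `χ(a)` of a basis element: `[N, a] = χ(a) a`. -/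
def chg : Gen → ℤ
  | N => 0
  | E => 0
  | psiP => 1
  | psiM => -1

theorem N0_act (M : AffMod k) (a : Gen) (r : ℤ) (w : M.W) :
    M.act N 0 (M.act a r w) = M.act a r (M.act N 0 w) + (chg a : ℂ) • M.act a r w := by
  cases a
  · simp [NN, chg]
  · simp [NE, chg]
  · simp [NP, chg]
  · simp [NM, chg, sub_eq_add_neg]

theorem E0_act (M : AffMod k) (a : Gen) (r : ℤ) (w : M.W) :
    M.act E 0 (M.act a r w) = M.act a r (M.act E 0 w) := by
  cases a
  · simp [EN]
  · rw [EE]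
  · rw [EP]
  · rw [EM]

theorem θ_sugawaraTerm (M : AffMod k) (r : ℤ) (w : M.W) :
    M.θ (M.sugawaraTerm r w) = M.sugawaraTerm r (M.θ w) := by
  simp [sugawaraTerm, θ_act_apply, par]

theorem θ_sugawaraZero (M : AffMod k) (w : M.W) :
    M.θ (M.sugawaraZero w) = M.sugawaraZero (M.θ w) := by
  simp [sugawaraZero, θ_act_apply, par]

theorem θ_L0 (M : AffMod k) (h : M.IsSmooth) (w : M.W) : M.θ (M.L0 h w) = M.L0 h (M.θ w) := by
  obtain ⟨K₁, hK₁⟩ := M.exists_bound h w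
  obtain ⟨K₂, hK₂⟩ := M.exists_bound h (M.θ w)
  rw [M.L0_eq h w (K₁ + K₂) fun a r hr => hK₁ a r (by omega),
    M.L0_eq h _ (K₁ + K₂) fun a r hr => hK₂ a r (by omega)]
  simp [θ_sugawaraTerm, θ_sugawaraZero]

/-- The operator `T = L₀ - lam N₀`; with `lam = e / k` it takes a single generalised eigenvalue on
the vacuum vectors with `E₀ = e`. -/
def numOp (M : AffMod k) (h : M.IsSmooth) (lam : ℂ) : Module.End ℂ M.W :=
  M.L0 h - lam • M.act N 0

theorem numOp_apply (M : AffMod k) (h : M.IsSmooth) (lam : ℂ) (w : M.W) :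
    M.numOp h lam w = M.L0 h w - lam • M.act N 0 w := rfl

/-- The degree of the mode `a_r` with respect to `-T`. -/
def deg (lam : ℂ) (a : Gen) (r : ℤ) : ℂ := r + chg a * lam

theorem numOp_act (M : AffMod k) (hk : k ≠ 0) (h : M.IsSmooth) (lam : ℂ) (a : Gen) (r : ℤ)
    (w : M.W) :
    M.numOp h lam (M.act a r w) = M.act a r (M.numOp h lam w) - deg lam a r • M.act a r w := by
  simp only [numOp_apply, L0_act M hk, N0_act, map_sub, map_smul, deg]
  module

theorem aeval_numOp_act (M : AffMod k) (hk : k ≠ 0) (h : M.IsSmooth) (lam : ℂ) (a : Gen) (r : ℤ)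
    (p : ℂ[X]) (w : M.W) :
    aeval (M.numOp h lam) (p.comp (X + C (deg lam a r))) (M.act a r w) =
      M.act a r (aeval (M.numOp h lam) p w) := by
  rw [aeval_comp, map_aeval_apply (M.act a r) (M.numOp h lam)
    (aeval (M.numOp h lam) (X + C (deg lam a r)))]
  intro w
  simp [numOp_act M hk]

theorem aeval_numOp_act_eigen (M : AffMod k) (hk : k ≠ 0) (h : M.IsSmooth) (lam : ℂ) (a : Gen)
    (r : ℤ) (μ : ℂ) (j : ℕ) (w : M.W)
    (hw : aeval (M.numOp h lam) ((X - C μ) ^ j) w = 0) :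
    aeval (M.numOp h lam) ((X - C (μ - deg lam a r)) ^ j) (M.act a r w) = 0 := by
  have := M.aeval_numOp_act hk h lam a r ((X - C μ) ^ j) w
  rw [hw, map_zero] at this
  convert this using 3
  simp
  ring

theorem IsHom.numOp {f : M.W →ₗ[ℂ] M'.W} (hf : IsHom M M' f) (h : M.IsSmooth) (h' : M'.IsSmooth)
    (lam : ℂ) (w : M.W) : f (M.numOp h lam w) = M'.numOp h' lam (f w) := by
  simp only [numOp_apply, map_sub, map_smul, hf.L0 h h', hf.act_even (a := N) rfl]

theorem numOp_mem (M : AffMod k) (h : M.IsSmooth) (lam : ℂ) (X : Submodule ℂ M.W)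
    (hX : M.IsGraded X) (w : M.W) (hw : w ∈ X) : M.numOp h lam w ∈ X :=
  X.sub_mem (M.L0_mem h X (fun a r _ hw => hX.1 a r hw) w hw) (X.smul_mem _ (hX.1 N 0 hw))

theorem numOp_N0 (M : AffMod k) (hk : k ≠ 0) (h : M.IsSmooth) (lam : ℂ) (w : M.W) :
    M.act N 0 (M.numOp h lam w) = M.numOp h lam (M.act N 0 w) := by
  simp [numOp_act M hk, deg, chg]

theorem numOp_E0 (M : AffMod k) (hk : k ≠ 0) (h : M.IsSmooth) (lam : ℂ) (w : M.W) :
    M.act E 0 (M.numOp h lam w) = M.numOp h lam (M.act E 0 w) := by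
  simp [numOp_act M hk, deg, chg]

theorem numOp_θ (M : AffMod k) (h : M.IsSmooth) (lam : ℂ) (w : M.W) :
    M.θ (M.numOp h lam w) = M.numOp h lam (M.θ w) := by
  simp [numOp_apply, θ_L0, θ_act_apply, par]

/-- The action of `T` on a vector annihilated by the positive modes. -/
theorem numOp_vac (M : AffMod k) (hk : k ≠ 0) (h : M.IsSmooth) (lam e β : ℂ) (w : M.W)
    (hw : ∀ a (r : ℤ), 0 < r → M.act a r w = 0) (hE : M.act E 0 w = e • w)
    (hN : (e / k - lam) • M.act N 0 w = β • w) :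
    M.numOp h lam w = (β + e / (2 * k) + e ^ 2 / (2 * k ^ 2)) • w
      - (1 / k) • M.act psiP 0 (M.act psiM 0 w) := by
  rw [numOp_apply, M.L0_vac h w hw]
  have hN' : (e / k) • M.act N 0 w = β • w + lam • M.act N 0 w := by
    rw [← hN]; module
  simp only [sugawaraZero, LinearMap.add_apply, LinearMap.smul_apply, LinearMap.sub_apply,
    Module.End.mul_apply, hE, map_smul, smul_sub, smul_smul]
  rw [show (1 / k * e) = e / k by ring, hN']
  match_scalars <;> field_simp <;> ring

/-- On vectors annihilated by the positive modes, `T` satisfies a quadratic equation, because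
`(ψ⁺₀ ψ⁻₀)² = e ψ⁺₀ ψ⁻₀` there. -/
theorem numOp_vac_poly (M : AffMod k) (hk : k ≠ 0) (h : M.IsSmooth) (lam e β : ℂ) (w : M.W)
    (hw : ∀ a (r : ℤ), 0 < r → M.act a r w = 0) (hE : M.act E 0 w = e • w)
    (hN : (e / k - lam) • M.act N 0 w = β • w) :
    aeval (M.numOp h lam) ((X - C (β + e / (2 * k) + e ^ 2 / (2 * k ^ 2) - e / k)) *
      (X - C (β + e / (2 * k) + e ^ 2 / (2 * k ^ 2)))) w = 0 := by
  set α := β + e / (2 * k) + e ^ 2 / (2 * k ^ 2) with hα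
  have h1 := M.numOp_vac hk h lam e β w hw hE hN
  rw [← hα] at h1
  have hD : M.act psiP 0 (M.act psiM 0 (M.act psiP 0 (M.act psiM 0 w))) =
      e • M.act psiP 0 (M.act psiM 0 w) := by
    rw [M.MP 0 0]
    simp [MM_self, EM, hE]
  have h2 : M.numOp h lam (M.act psiP 0 (M.act psiM 0 w)) =
      (α - e / k) • M.act psiP 0 (M.act psiM 0 w) := by
    rw [numOp_act M hk, numOp_act M hk, h1]
    simp only [map_sub, map_smul, hD, deg, chg]
    push_cast
    match_scalars
    field_simp
    ring
  rw [map_mul, Module.End.mul_apply]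
  simp only [map_sub, aeval_X, aeval_C, LinearMap.sub_apply, Module.algebraMap_end_apply, h1,
    map_smul, h2]
  match_scalars <;> ring

/-! ### Local finiteness of `L₀` -/

/-- A vector that is homogeneous for `N₀`, `E₀` and the parity. -/
def Joint (M : AffMod k) (w : M.W) : Prop :=
  (∃ ν : ℂ, M.act N 0 w = ν • w) ∧ (∃ e : ℂ, M.act E 0 w = e • w) ∧ ∃ c : ℂ, M.θ w = c • w

theorem Joint.act {w : M.W} (h : M.Joint w) (a : Gen) (r : ℤ) : M.Joint (M.act a r w) := by
  obtain ⟨⟨ν, h1⟩, ⟨e, h2⟩, c, h3⟩ := h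
  refine ⟨⟨ν + chg a, ?_⟩, ⟨e, ?_⟩, (-1 : ℂ) ^ par a * c, ?_⟩
  · rw [N0_act, h1, map_smul, add_smul]
  · rw [E0_act, h2, map_smul]
  · rw [θ_act_apply, h3, map_smul, smul_smul]

theorem IsHomogHom.joint {f : M.W →ₗ[ℂ] M'.W} (hf : IsHomogHom M M' 0 f) {w : M.W}
    (h : M.Joint w) : M'.Joint (f w) := by
  obtain ⟨⟨ν, h1⟩, ⟨e, h2⟩, c, h3⟩ := h
  refine ⟨⟨ν, ?_⟩, ⟨e, ?_⟩, c, ?_⟩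
  · rw [hf.isHom_zero.act_even rfl, h1, map_smul]
  · rw [hf.isHom_zero.act_even rfl, h2, map_smul]
  · rw [hf.1, h3]; simp

theorem Nice.span_joint (hM : M.Nice) : Submodule.span ℂ {w | M.Joint w} = ⊤ := by
  rw [eq_top_iff, ← hM.ssN]
  refine iSup_le fun ν v hv => ?_
  have h1 := mem_iSup_inf_eigenspace (M.act E 0) hM.ssE ((M.act N 0).eigenspace ν)
    (fun x hx => by
      rw [Module.End.mem_eigenspace_iff] at hx ⊢
      rw [← E0_act, hx, map_smul]) v hv
  clear hv
  revert v
  change (⨆ μ : ℂ, (M.act N 0).eigenspace ν ⊓ (M.act E 0).eigenspace μ) ≤ _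
  refine iSup_le fun e w hw => ?_
  have hN : M.act N 0 w = ν • w := Module.End.mem_eigenspace_iff.1 hw.1
  have hE : M.act E 0 w = e • w := Module.End.mem_eigenspace_iff.1 hw.2
  have key : ∀ c : ℂ, c * c = 1 → M.Joint (w + c • M.θ w) := by
    intro c hc
    refine ⟨⟨ν, ?_⟩, ⟨e, ?_⟩, c, ?_⟩
    · have : M.act N 0 (M.θ w) = M.θ (M.act N 0 w) := by simp [θ_act_apply, par]
      rw [map_add, map_smul, this, hN, map_smul]; module
    · have : M.act E 0 (M.θ w) = M.θ (M.act E 0 w) := by simp [θ_act_apply, par]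
      rw [map_add, map_smul, this, hE, map_smul]; module
    · rw [map_add, map_smul, θ_θ, smul_add, smul_smul, hc, one_smul, add_comm]
  have e1 : w = (1 / 2 : ℂ) • (w + (1 : ℂ) • M.θ w) + (1 / 2 : ℂ) • (w + (-1 : ℂ) • M.θ w) := by
    module
  rw [e1]
  exact Submodule.add_mem _
    (Submodule.smul_mem _ _ (Submodule.subset_span (key 1 (by ring))))
    (Submodule.smul_mem _ _ (Submodule.subset_span (key (-1) (by ring))))

/-- Every vector is annihilated by a nonzero polynomial in `T`.  The vectors with this property form
a graded submodule; a nonzero quotient by it would contain a vector annihilated by the positive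
modes, on which `T` satisfies a quadratic equation. -/
theorem Nice.algebraic (hM : M.Nice) (hk : k ≠ 0) (lam : ℂ) (w : M.W) :
    ∃ p : ℂ[X], p ≠ 0 ∧ aeval (M.numOp hM.smooth lam) p w = 0 := by
  set T := M.numOp hM.smooth lam with hT
  let G : Submodule ℂ M.W :=
    { carrier := {w | ∃ p : ℂ[X], p ≠ 0 ∧ aeval T p w = 0}
      zero_mem' := ⟨1, one_ne_zero, by simp⟩
      add_mem' := by
        rintro v v' ⟨p, hp, h⟩ ⟨q, hq, h'⟩
        refine ⟨p * q, mul_ne_zero hp hq, ?_⟩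
        rw [map_add]
        conv_lhs => enter [1]; rw [mul_comm]
        rw [map_mul, map_mul, Module.End.mul_apply, Module.End.mul_apply, h, h']
        simp
      smul_mem' := by
        rintro c v ⟨p, hp, h⟩
        exact ⟨p, hp, by rw [map_smul, h, smul_zero]⟩ }
  have hG : M.IsGraded G := by
    refine ⟨?_, ?_⟩
    · rintro a r v ⟨p, hp, h⟩
      refine ⟨p.comp (X + C (deg lam a r)), ?_, ?_⟩
      · intro h0
        apply hp
        have := congrArg (fun q => q.comp (X - C (deg lam a r))) h0
        simpa [comp_assoc] using this
      · rw [hT, aeval_numOp_act M hk, ← hT, h, map_zero]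
    · rintro v ⟨p, hp, h⟩
      refine ⟨p, hp, ?_⟩
      rw [← map_aeval_apply M.θ T T (M.numOp_θ _ _), h, map_zero]
  by_contra hw
  have hGt : ¬ {w | M.Joint w} ⊆ G := by
    intro hsub
    have := Submodule.span_le.2 hsub
    rw [hM.span_joint] at this
    exact hw (this Submodule.mem_top)
  obtain ⟨v, hv, hvG⟩ := Set.not_subset.1 hGt
  have hQ := hM.quot ⟨G, hG⟩
  have hmk := M.isHomogHom_mkQ ⟨G, hG⟩
  obtain ⟨v', hv0, hj, hpos⟩ := hQ.engel (fun v => (M.quot ⟨G, hG⟩).Joint v)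
    (fun a r w _ hw => hw.act a r) (G.mkQ v)
    (by rw [Submodule.mkQ_apply]; exact fun h => hvG ((Submodule.Quotient.mk_eq_zero G).1 h)) (hmk.joint hv)
  obtain ⟨⟨ν, h1⟩, ⟨e, h2⟩, -⟩ := hj
  have hp := (M.quot ⟨G, hG⟩).numOp_vac_poly hk hQ.smooth lam e ((e / k - lam) * ν) v' hpos h2
    (by rw [h1, smul_smul])
  obtain ⟨y, rfl⟩ := G.mkQ_surjective v'
  set p := (X - C ((e / k - lam) * ν + e / (2 * k) + e ^ 2 / (2 * k ^ 2) - e / k)) *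
      (X - C ((e / k - lam) * ν + e / (2 * k) + e ^ 2 / (2 * k ^ 2))) with hpdef
  have hp0 : p ≠ 0 := mul_ne_zero (X_sub_C_ne_zero _) (X_sub_C_ne_zero _)
  have e1 := map_aeval_apply G.mkQ T ((M.quot ⟨G, hG⟩).numOp hQ.smooth lam)
    (hmk.isHom_zero.numOp hM.smooth hQ.smooth lam) p y
  have e2 : G.mkQ (aeval T p y) = 0 := e1.trans hp
  rw [Submodule.mkQ_apply] at e2
  obtain ⟨q, hq, h⟩ := (Submodule.Quotient.mk_eq_zero G).1 e2
  apply hv0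
  have : y ∈ G := ⟨q * p, mul_ne_zero hq hp0, by rw [map_mul, Module.End.mul_apply, h]⟩
  exact (Submodule.Quotient.mk_eq_zero G).2 this

/-! ### Vacuum vectors -/

/-- The normalisation of the eigenvalue `e` of `E₀` achieved by spectral flow: `e = 0`, or the value
of a real-linear functional `φ` (with `φ(1) = 1`) at `e / k` lies strictly between `0` and `1`. -/
def Strip (k e : ℂ) (φ : ℂ →ₗ[ℝ] ℝ) : Prop :=
  φ 1 = 1 ∧ (e = 0 ∨ (0 < φ (e / k) ∧ φ (e / k) < 1))

/-- Vacuum vectors with `E₀ = e`: those annihilated by all modes of positive degree, the degree being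
that of `L₀ - (e/k) N₀`. -/
def IsVac (M : AffMod k) (e : ℂ) (w : M.W) : Prop :=
  M.act E 0 w = e • w ∧ (∀ a (r : ℤ), 0 < r → M.act a r w = 0) ∧ (e ≠ 0 → M.act psiP 0 w = 0)

/-- The modes of positive degree. -/
def Pos (e : ℂ) (a : Gen) (r : ℤ) : Prop := 0 < r ∨ (e ≠ 0 ∧ a = psiP ∧ r = 0)

/-- The eigenvalue of `L₀ - (e/k) N₀` on vacuum vectors. -/
def vacVal (k e : ℂ) : ℂ := e / (2 * k) + e ^ 2 / (2 * k ^ 2) - e / k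

theorem IsVac.sub {e : ℂ} {v w : M.W} (hv : M.IsVac e v) (hw : M.IsVac e w) :
    M.IsVac e (v - w) := by
  refine ⟨by rw [map_sub, hv.1, hw.1, smul_sub], fun a r hr => ?_, fun he => ?_⟩
  · rw [map_sub, hv.2.1 a r hr, hw.2.1 a r hr, sub_zero]
  · rw [map_sub, hv.2.2 he, hw.2.2 he, sub_zero]

theorem IsVac.add {e : ℂ} {v w : M.W} (hv : M.IsVac e v) (hw : M.IsVac e w) :
    M.IsVac e (v + w) := by
  refine ⟨by rw [map_add, hv.1, hw.1, smul_add], fun a r hr => ?_, fun he => ?_⟩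
  · rw [map_add, hv.2.1 a r hr, hw.2.1 a r hr, add_zero]
  · rw [map_add, hv.2.2 he, hw.2.2 he, add_zero]

theorem IsVac.smul {e : ℂ} {v : M.W} (hv : M.IsVac e v) (c : ℂ) : M.IsVac e (c • v) := by
  refine ⟨by rw [map_smul, hv.1, smul_comm], fun a r hr => ?_, fun he => ?_⟩
  · rw [map_smul, hv.2.1 a r hr, smul_zero]
  · rw [map_smul, hv.2.2 he, smul_zero]

theorem IsVac.zero (M : AffMod k) (e : ℂ) : M.IsVac e 0 := by
  refine ⟨by simp, fun a r hr => by simp, fun he => by simp⟩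

theorem IsVac.map {e : ℂ} {v : M.W} (hv : M.IsVac e v) {f : M.W →ₗ[ℂ] M'.W} (hf : IsHom M M' f) :
    M'.IsVac e (f v) :=
  ⟨by rw [hf.act_even rfl, hv.1, map_smul], fun a r hr => hf.act_zero a r v (hv.2.1 a r hr),
    fun he => hf.act_zero psiP 0 v (hv.2.2 he)⟩

theorem IsVac.numOp {e : ℂ} (hk : k ≠ 0) {w : M.W} (hw : M.IsVac e w) (h : M.IsSmooth) :
    aeval (M.numOp h (e / k)) ((X - C (vacVal k e)) ^ 2) w = 0 := by
  by_cases he : e = 0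
  · subst he
    have := M.numOp_vac_poly hk h (0 / k) 0 0 w hw.2.1 hw.1 (by simp)
    simpa [vacVal, pow_two] using this
  · have h1 := M.numOp_vac hk h (e / k) e 0 w hw.2.1 hw.1 (by simp)
    have h2 : M.act psiP 0 (M.act psiM 0 w) = e • w := by
      rw [PM, hw.2.2 he]
      simp [hw.1]
    have h3 : M.numOp h (e / k) w = vacVal k e • w := by
      rw [h1, h2, vacVal]
      match_scalars
      field_simp
      ring
    rw [aeval_apply_of_eigen _ _ _ h3]
    simp

theorem Strip.pos {e : ℂ} {φ : ℂ →ₗ[ℝ] ℝ} (h : Strip k e φ) {a : Gen} {r : ℤ} (hp : Pos e a r) :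
    0 < φ (deg (e / k) a r) := by
  have hr : φ (r : ℂ) = r := by
    have : ((r : ℤ) : ℂ) = (r : ℝ) • (1 : ℂ) := by simp
    rw [this, map_smul, h.1]; simp
  have hc : φ ((chg a : ℂ) * (e / k)) = chg a * φ (e / k) := by
    have : (chg a : ℂ) * (e / k) = (chg a : ℝ) • (e / k) := by
      rw [Complex.real_smul]; push_cast; rfl
    rw [this, map_smul]; simp
  rw [deg, map_add, hr, hc]
  rcases hp with hp | ⟨he, rfl, rfl⟩
  · have h1 : (1 : ℝ) ≤ r := by exact_mod_cast hp
    rcases h.2 with rfl | ⟨h2, h3⟩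
    · simp; linarith
    · cases a <;> simp [chg] <;> linarith
  · rcases h.2 with h0 | ⟨h2, h3⟩
    · exact absurd h0 he
    · simpa [chg] using h2

theorem Strip.neg {e : ℂ} {φ : ℂ →ₗ[ℝ] ℝ} (h : Strip k e φ) {a : Gen} {r : ℤ}
    (hp : r < 0 ∨ (e ≠ 0 ∧ a = psiM ∧ r = 0)) : 0 < φ (- deg (e / k) a r) := by
  have e1 : ∀ b, chg b = - chg a → - deg (e / k) a r = deg (e / k) b (-r) := by
    intro b hb
    simp [deg, hb]
    ring
  rcases hp with hp | ⟨he, rfl, rfl⟩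
  · have hb : ∃ b, chg b = - chg a := by
      cases a
      exacts [⟨N, rfl⟩, ⟨E, rfl⟩, ⟨psiM, rfl⟩, ⟨psiP, rfl⟩]
    obtain ⟨b, hb⟩ := hb
    rw [e1 b hb]
    exact h.pos (Or.inl (by omega))
  · rw [e1 psiP rfl]
    exact h.pos (Or.inr ⟨he, rfl, rfl⟩)

/-- Existence of vacuum vectors. -/
theorem Nice.exists_vac (hM : M.Nice) (e : ℂ) (Q : M.W → Prop)
    (hQ : ∀ a r w, Pos e a r → Q w → Q (M.act a r w)) (hE : ∀ w, Q w → M.act E 0 w = e • w)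
    (w : M.W) (hw : w ≠ 0) (hq : Q w) : ∃ w', w' ≠ 0 ∧ Q w' ∧ M.IsVac e w' := by
  obtain ⟨v, hv0, hvq, hv⟩ := hM.engel Q (fun a r w hr => hQ a r w (Or.inl hr)) w hw hq
  by_cases he : e ≠ 0 ∧ M.act psiP 0 v ≠ 0
  · have hq' := hQ psiP 0 v (Or.inr ⟨he.1, rfl, rfl⟩) hvq
    refine ⟨M.act psiP 0 v, he.2, hq', hE _ hq', fun a r hr => ?_, fun _ => M.PP_self 0 v⟩
    rw [rel_apply, hv a r hr,
      Finset.sum_eq_zero fun c _ => by rw [hv c _ (by omega), smul_zero]]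
    simp [central, hr.ne']
  · refine ⟨v, hv0, hvq, hE v hvq, hv, fun h => ?_⟩
    by_contra h'
    exact he ⟨h, h'⟩

/-- On the part of a module where `E₀ = e`, the vacuum vectors are the generalised eigenvectors of
`L₀ - (e/k) N₀` for the vacuum eigenvalue: a positive mode would produce a vacuum vector
with another eigenvalue. -/
theorem Nice.isVac_of_numOp (hM : M.Nice) (hk : k ≠ 0) {e : ℂ} {φ : ℂ →ₗ[ℝ] ℝ}
    (hφ : Strip k e φ) (w : M.W) (hE : M.act E 0 w = e • w) (j : ℕ)
    (hT : aeval (M.numOp hM.smooth (e / k)) ((X - C (vacVal k e)) ^ j) w = 0) :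
    M.IsVac e w := by
  have key : ∀ a r, Pos e a r → M.act a r w = 0 := by
    intro a r hp
    by_contra h0
    -- positive modes applied to `a_r w` lower the eigenvalue of `T` by some `D` with `φ D > 0`
    obtain ⟨v, hv0, ⟨-, D, hD, j', hj'⟩, hv⟩ := hM.exists_vac e
      (fun v => M.act E 0 v = e • v ∧ ∃ D : ℂ, 0 < φ D ∧ ∃ j : ℕ,
        aeval (M.numOp hM.smooth (e / k)) ((X - C (vacVal k e - D)) ^ j) v = 0)
      (by
        rintro a r v hp ⟨hE, D, hD, j, hj⟩
        refine ⟨by rw [E0_act, hE, map_smul], D + deg (e / k) a r, ?_, j, ?_⟩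
        · rw [map_add]
          exact add_pos hD (hφ.pos hp)
        · rw [← sub_sub]
          exact M.aeval_numOp_act_eigen hk _ _ _ _ _ _ _ hj)
      (fun v hv => hv.1) _ h0
      ⟨by rw [E0_act, hE, map_smul], deg (e / k) a r, hφ.pos hp, j,
        M.aeval_numOp_act_eigen hk _ _ _ _ _ _ _ hT⟩
    refine hv0 (eq_zero_of_isCoprime _ (isCoprime_X_sub_C_pow ?_ 2) (hv.numOp hk hM.smooth) hj')
    have hD0 : D ≠ 0 := by
      rintro rfl
      simp at hD
    simp [hD0]
  exact ⟨hE, fun a r hr => key a r (Or.inl hr), fun he => key psiP 0 (Or.inr ⟨he, rfl, rfl⟩)⟩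

/-- Exactness of the functor of vacuum vectors: vacuum vectors lift along surjections. -/
theorem lift_vac (hk : k ≠ 0) (hA : A.Nice) (hB : B.Nice) {e : ℂ} {φ : ℂ →ₗ[ℝ] ℝ}
    (hφ : Strip k e φ) (π : A.W →ₗ[ℂ] B.W) (hπ : IsHom A B π) (hs : Function.Surjective π)
    (b : B.W) (hb : B.IsVac e b) (n : ℂ) (hn : B.act N 0 b = n • b) :
    ∃ a, π a = b ∧ A.IsVac e a ∧ A.act N 0 a = n • a := by
  obtain ⟨a₀, h0⟩ := hs b
  -- correct the lift successively to the eigenspaces of `E₀` and `N₀`, and to the generalised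
  -- eigenspace of `T`, by polynomials in these operators
  obtain ⟨g, hg, hga⟩ := exists_poly_eigen _ hA.ssE a₀ e
  set a₁ := (g.eval e)⁻¹ • aeval (A.act E 0) g a₀ with ha₁
  have h1 : π a₁ = b := by
    rw [ha₁, map_smul, map_aeval_apply π _ (B.act E 0) (fun w => (hπ.act_even rfl 0 w).symm), h0,
      aeval_apply_of_eigen _ _ _ hb.1, smul_smul, inv_mul_cancel₀ hg, one_smul]
  have hE1 : A.act E 0 a₁ = e • a₁ := by rw [ha₁, map_smul, hga, smul_comm]
  obtain ⟨g', hg', hga'⟩ := exists_poly_eigen _ hA.ssN a₁ n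
  set a₂ := (g'.eval n)⁻¹ • aeval (A.act N 0) g' a₁ with ha₂
  have h2 : π a₂ = b := by
    rw [ha₂, map_smul, map_aeval_apply π _ (B.act N 0) (fun w => (hπ.act_even rfl 0 w).symm), h1,
      aeval_apply_of_eigen _ _ _ hn, smul_smul, inv_mul_cancel₀ hg', one_smul]
  have hN2 : A.act N 0 a₂ = n • a₂ := by rw [ha₂, map_smul, hga', smul_comm]
  have hE2 : A.act E 0 a₂ = e • a₂ := by
    rw [ha₂, map_smul, aeval_comm_apply _ _ (fun w => A.E0_act N 0 w), hE1, map_smul, smul_comm]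
  obtain ⟨h, m, hm, s, hs⟩ := exists_poly_genEigen _ (vacVal k e) a₂
    (hA.algebraic hk (e / k) a₂)
  refine ⟨aeval (A.numOp hA.smooth (e / k)) h a₂, ?_, ?_, ?_⟩
  · rw [map_aeval_apply π _ _ (hπ.numOp hA.smooth hB.smooth (e / k)), h2,
      aeval_proj_apply _ _ h s _ hs (hb.numOp hk hB.smooth)]
  · refine hA.isVac_of_numOp hk hφ _ ?_ m hm
    rw [aeval_comm_apply _ _ (A.numOp_E0 hk _ _), hE2, map_smul]
  · rw [aeval_comm_apply _ _ (A.numOp_N0 hk _ _), hN2, map_smul]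

/-- Graded submodules are determined by their vacuum vectors. -/
theorem Nice.exists_vac_notMem (hM : M.Nice) (hk : k ≠ 0) {e : ℂ} {φ : ℂ →ₗ[ℝ] ℝ}
    (hφ : Strip k e φ) (hE : ∀ w, M.act E 0 w = e • w) (Y Z : Submodule ℂ M.W)
    (hY : M.IsGraded Y) (hZ : M.IsGraded Z) (h : ¬ Z ≤ Y) :
    ∃ w ∈ Z, M.IsVac e w ∧ w ∉ Y := by
  obtain ⟨z, hz, hzY⟩ := SetLike.not_le_iff_exists.1 h
  have hQ := hM.quot ⟨Y, hY⟩
  have hmk := M.isHomogHom_mkQ ⟨Y, hY⟩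
  -- a vacuum vector in the image of `Z` in the quotient by `Y`, lifted back by projecting in `Z`
  obtain ⟨v, hv0, ⟨x, hx, rfl⟩, hv⟩ := hQ.exists_vac e (fun v => ∃ x ∈ Z, Y.mkQ x = v)
    (by
      rintro a r _ - ⟨x, hx, rfl⟩
      exact ⟨M.act a r x, hZ.1 a r hx, rfl⟩)
    (by
      rintro _ ⟨x, hx, rfl⟩
      exact congrArg Y.mkQ (hE x))
    (Y.mkQ z) (by rw [Submodule.mkQ_apply]; exact fun h => hzY ((Submodule.Quotient.mk_eq_zero Y).1 h))
    ⟨z, hz, rfl⟩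
  obtain ⟨h, m, hm, s, hs⟩ := exists_poly_genEigen _ (vacVal k e) x (hM.algebraic hk (e / k) x)
  refine ⟨aeval (M.numOp hM.smooth (e / k)) h x,
    aeval_mem _ Z (M.numOp_mem _ _ Z hZ) h x hx, hM.isVac_of_numOp hk hφ _ (hE _) m hm, ?_⟩
  intro hmem
  apply hv0
  have e1 := map_aeval_apply Y.mkQ _ ((M.quot ⟨Y, hY⟩).numOp hQ.smooth (e / k))
    (hmk.isHom_zero.numOp hM.smooth hQ.smooth (e / k)) h x
  have e2 : aeval ((M.quot ⟨Y, hY⟩).numOp hQ.smooth (e / k)) h (Y.mkQ x) = Y.mkQ x :=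
    aeval_proj_apply _ _ h s _ hs (hv.numOp hk hQ.smooth)
  have e3 : Y.mkQ (aeval (M.numOp hM.smooth (e / k)) h x) = Y.mkQ x := e1.trans e2
  rw [← e3]
  exact (Submodule.Quotient.mk_eq_zero Y).2 hmem

/-- If a space `Y` of vacuum vectors is stable under the modes of degree zero, then the submodule
generated by `Y` has no other vacuum vectors: creation modes change the eigenvalue
of `L₀ - (e/k) N₀`. -/
theorem Nice.vac_generated (hM : M.Nice) (hk : k ≠ 0) {e : ℂ} {φ : ℂ →ₗ[ℝ] ℝ}
    (hφ : Strip k e φ) (Y : Submodule ℂ M.W) (hY : ∀ y ∈ Y, M.IsVac e y)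
    (hN : ∀ y ∈ Y, M.act N 0 y ∈ Y) (hθ : ∀ y ∈ Y, M.θ y ∈ Y)
    (hP : e = 0 → ∀ y ∈ Y, M.act psiP 0 y ∈ Y ∧ M.act psiM 0 y ∈ Y) (w : M.W)
    (hw : w ∈ (M.generated Y).1) (hv : M.IsVac e w) : w ∈ Y := by
  set T := M.numOp hM.smooth (e / k) with hT
  set Ct : Gen → ℤ → Prop := fun a r => r < 0 ∨ (e ≠ 0 ∧ a = psiM ∧ r = 0) with hC
  have h1 := M.generated_le_span_words Ct Y (by
    intro a r ha y hy
    rw [hC] at ha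
    push Not at ha
    rcases ha.1.lt_or_eq with hr | rfl
    · rw [(hY y hy).2.1 a r hr]; exact Y.zero_mem
    · cases a
      · exact hN y hy
      · rw [(hY y hy).1]; exact Y.smul_mem _ hy
      · by_cases he : e = 0
        · exact (hP he y hy).1
        · rw [(hY y hy).2.2 he]; exact Y.zero_mem
      · by_cases he : e = 0
        · exact (hP he y hy).2
        · exact absurd rfl (ha.2 he rfl)) hθ hw
  let G : Submodule ℂ M.W :=
    { carrier := {w | ∃ p : ℂ[X], p.eval (vacVal k e) ≠ 0 ∧ aeval T p w = 0}
      zero_mem' := ⟨1, by simp, by simp⟩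
      add_mem' := by
        rintro v v' ⟨p, hp, h⟩ ⟨q, hq, h'⟩
        refine ⟨p * q, by simp [hp, hq], ?_⟩
        rw [map_add]
        conv_lhs => enter [1]; rw [mul_comm]
        rw [map_mul, map_mul, Module.End.mul_apply, Module.End.mul_apply, h, h']
        simp
      smul_mem' := by
        rintro c v ⟨p, hp, h⟩
        exact ⟨p, hp, by rw [map_smul, h, smul_zero]⟩ }
  have hword : ∀ w, Words M Ct Y w → ∃ D : ℂ, (w ∈ Y ∧ D = 0 ∨ 0 < φ D) ∧
      aeval T ((X - C (vacVal k e + D)) ^ 2) w = 0 := by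
    intro w hw
    induction hw with
    | base y hy => exact ⟨0, Or.inl ⟨hy, rfl⟩, by simpa using (hY y hy).numOp hk hM.smooth⟩
    | step a r w ha hw ih =>
      obtain ⟨D, hD, h⟩ := ih
      refine ⟨D - deg (e / k) a r, Or.inr ?_, ?_⟩
      · have h2 := hφ.neg ha
        rw [sub_eq_add_neg, map_add]
        rcases hD with ⟨-, rfl⟩ | hD
        · simpa using h2
        · exact add_pos hD h2
      · rw [← add_sub_assoc]
        exact M.aeval_numOp_act_eigen hk _ _ _ _ _ _ _ h
  have h2 : Submodule.span ℂ {w | Words M Ct Y w} ≤ Y ⊔ G := by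
    rw [Submodule.span_le]
    intro w hw
    obtain ⟨D, hD, h⟩ := hword w hw
    rcases hD with ⟨hD, -⟩ | hD
    · exact Submodule.mem_sup_left hD
    · refine Submodule.mem_sup_right ⟨_, ?_, h⟩
      have hD0 : D ≠ 0 := by
        rintro rfl
        simp at hD
      simp [hD0]
  obtain ⟨y, hy, g, ⟨p, hp, hg⟩, rfl⟩ := Submodule.mem_sup.1 (h2 h1)
  have h3 : M.IsVac e g := by
    have := hv.sub (hY y hy)
    rwa [add_sub_cancel_left] at this
  rw [eq_zero_of_isCoprime T (isCoprime_X_sub_C_pow hp 2) (h3.numOp hk hM.smooth) hg, add_zero]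
  exact hy

end AffMod

end

end AffGL
namespace AffGL

open Gen Polynomial

noncomputable section

namespace AffMod

variable {k : ℂ} {M M' A B : AffMod k}

/-! ### The categories and the class of nice modules -/

theorem mem_maxGen_iff {V : Type*} [AddCommGroup V] [Module ℂ V] (T : Module.End ℂ V) (μ : ℂ)
    (w : V) : w ∈ T.maxGenEigenspace μ ↔ ∃ j : ℕ, aeval T ((X - C μ) ^ j) w = 0 := by
  rw [Module.End.mem_maxGenEigenspace]
  simp [Algebra.algebraMap_eq_smul_one]

theorem numOp_zero (M : AffMod k) (h : M.IsSmooth) : M.numOp h 0 = M.L0 h := by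
  simp [numOp]

theorem act_maxGen (M : AffMod k) (hk : k ≠ 0) (h : M.IsSmooth) (a : Gen) (r : ℤ) (μ : ℂ) (w : M.W)
    (hw : w ∈ (M.L0 h).maxGenEigenspace μ) :
    M.act a r w ∈ (M.L0 h).maxGenEigenspace (μ - r) := by
  rw [mem_maxGen_iff, ← numOp_zero] at hw ⊢
  obtain ⟨j, hj⟩ := hw
  have := M.aeval_numOp_act_eigen hk h 0 a r μ j w hj
  exact ⟨j, by simpa [deg] using this⟩

theorem pow_act_maxGen (M : AffMod k) (hk : k ≠ 0) (h : M.IsSmooth) (a : Gen) (r : ℤ) (μ : ℂ)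
    (w : M.W) (hw : w ∈ (M.L0 h).maxGenEigenspace μ) (j : ℕ) :
    (M.act a r ^ j) w ∈ (M.L0 h).maxGenEigenspace (μ - j * r) := by
  induction j with
  | zero => simpa using hw
  | succ j ih =>
    rw [pow_succ', Module.End.mul_apply]
    have := M.act_maxGen hk h a r _ _ ih
    convert this using 2
    push_cast
    ring

/-- On a grading-restricted module, the positive modes are locally nilpotent. -/
theorem IsGradingRestricted.nil (hM : M.IsGradingRestricted) (hk : k ≠ 0) (a : Gen) (r : ℤ)
    (hr : 0 < r) (w : M.W) : ∃ j : ℕ, (M.act a r ^ j) w = 0 := by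
  obtain ⟨h, htop, -, hbd⟩ := hM
  have hw : w ∈ ⨆ μ : ℂ, (M.L0 h).maxGenEigenspace μ := htop ▸ Submodule.mem_top
  induction hw using Submodule.iSup_induction' with
  | mem μ v hv =>
    obtain ⟨m, hm⟩ := hbd μ
    refine ⟨m, ?_⟩
    have h1 := M.pow_act_maxGen hk h a r μ v hv m
    have h2 : μ - m * r = μ - ((m * r.toNat : ℕ) : ℂ) := by
      have : ((r.toNat : ℕ) : ℂ) = r := by
        have : ((r.toNat : ℕ) : ℤ) = r := Int.toNat_of_nonneg hr.le
        exact_mod_cast this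
      rw [Nat.cast_mul, this]
    rw [h2, hm _ (Nat.le_mul_of_pos_right _ (by omega))] at h1
    simpa using h1
  | zero => exact ⟨0, by simp⟩
  | add v v' _ _ h1 h2 =>
    obtain ⟨i, hi⟩ := h1
    obtain ⟨j, hj⟩ := h2
    refine ⟨i + j, ?_⟩
    rw [map_add]
    conv_lhs => enter [1]; rw [add_comm]
    rw [pow_add, pow_add, Module.End.mul_apply, Module.End.mul_apply, hi, hj]
    simp

theorem IsOfin.nice (hM : M.IsOfin) (hk : k ≠ 0) : M.Nice where
  smooth := hM.1.1.1
  nilE r hr w := hM.1.1.nil hk E r hr w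
  nilN r hr w := hM.1.1.nil hk N r hr w
  ssN := hM.2.1
  ssE := hM.2.2

theorem isGraded_bot (M : AffMod k) : M.IsGraded ⊥ := ⟨fun a r => by simp, by simp⟩

theorem isGraded_top (M : AffMod k) : M.IsGraded ⊤ := ⟨fun a r => by simp, by simp⟩

theorem IsIrreducible.hasLength (h : M.IsIrreducible) : M.HasLength 1 := by
  refine ⟨fun i => if i = 0 then ⟨⊥, M.isGraded_bot⟩ else ⟨⊤, M.isGraded_top⟩, by simp, by simp, ?_⟩
  intro i hi
  obtain rfl : i = 0 := by omega
  simp only [if_true, zero_add, one_ne_zero, if_false]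
  have := h.1
  refine ⟨?_, ?_⟩
  · rw [Subtype.mk_lt_mk]
    exact bot_lt_top
  · rintro ⟨X, hX⟩ h1 h2
    rw [Subtype.mk_lt_mk] at h1 h2
    rcases h.2 X hX with rfl | rfl
    · exact lt_irrefl _ h1
    · exact lt_irrefl _ h2

/-- Schur's lemma for the central operator `E₀`, and semisimplicity of `N₀`. -/
theorem IsIrreducible.scalar (h : M.IsIrreducible) (hk : k ≠ 0) (hM : M.IsGradingRestricted) :
    (∃ e : ℂ, ∀ w, M.act E 0 w = e • w) ∧ (⨆ μ : ℂ, (M.act N 0).eigenspace μ) = ⊤ := by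
  obtain ⟨hs, htop, hfd, -⟩ := hM
  have := h.1
  -- the zero modes preserve a non-zero finite-dimensional generalised eigenspace of `L₀`
  obtain ⟨μ, hμ⟩ : ∃ μ, (M.L0 hs).maxGenEigenspace μ ≠ ⊥ := by
    by_contra! h0
    rw [iSup_eq_bot.2 h0] at htop
    exact bot_ne_top htop
  have hV := hfd μ
  have hnt : Nontrivial ((M.L0 hs).maxGenEigenspace μ) := Submodule.nontrivial_iff_ne_bot.2 hμ
  have key : ∀ a, ∃ (c : ℂ) (v : M.W), v ≠ 0 ∧ M.act a 0 v = c • v := by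
    intro a
    obtain ⟨c, hc⟩ := Module.End.exists_eigenvalue (K := ℂ)
      ((M.act a 0).restrict (p := (M.L0 hs).maxGenEigenspace μ) (q := (M.L0 hs).maxGenEigenspace μ)
      fun w hw => by
        have := M.act_maxGen hk hs a 0 μ w hw
        simpa using this)
    obtain ⟨⟨v, hv⟩, h1, h2⟩ := hc.exists_hasEigenvector
    refine ⟨c, v, fun h0 => h2 (Subtype.ext h0), ?_⟩
    rw [Module.End.mem_eigenspace_iff] at h1
    exact congrArg Subtype.val h1
  constructor
  · obtain ⟨e, v, hv, hev⟩ := key E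
    refine ⟨e, fun w => ?_⟩
    have hg : M.IsGraded ((M.act E 0).eigenspace e) := by
      refine ⟨fun a r w hw => ?_, fun w hw => ?_⟩
      · rw [Submodule.mem_comap]
        rw [Module.End.mem_eigenspace_iff] at hw ⊢
        rw [E0_act, hw, map_smul]
      · rw [Submodule.mem_comap]
        rw [Module.End.mem_eigenspace_iff] at hw ⊢
        have : M.act E 0 (M.θ w) = M.θ (M.act E 0 w) := by simp [θ_act_apply, par]
        rw [this, hw, map_smul]
    rcases h.2 _ hg with h0 | h0
    · exact absurd ((Submodule.eq_bot_iff _).1 h0 v (Module.End.mem_eigenspace_iff.2 hev)) hv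
    · exact Module.End.mem_eigenspace_iff.1 (h0 ▸ Submodule.mem_top)
  · obtain ⟨n, v, hv, hnv⟩ := key N
    have hg : M.IsGraded (⨆ μ : ℂ, (M.act N 0).eigenspace μ) := by
      refine ⟨fun a r => iSup_le fun μ w hw => ?_, iSup_le fun μ w hw => ?_⟩
      · refine Submodule.mem_iSup_of_mem (μ + chg a) ?_
        rw [Module.End.mem_eigenspace_iff] at hw ⊢
        rw [N0_act, hw, map_smul, add_smul]
      · refine Submodule.mem_iSup_of_mem μ ?_
        rw [Module.End.mem_eigenspace_iff] at hw ⊢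
        have : M.act N 0 (M.θ w) = M.θ (M.act N 0 w) := by simp [θ_act_apply, par]
        rw [this, hw, map_smul]
    rcases h.2 _ hg with h0 | h0
    · exact absurd ((Submodule.eq_bot_iff _).1 h0 v
        (Submodule.mem_iSup_of_mem n (Module.End.mem_eigenspace_iff.2 hnv))) hv
    · exact h0

theorem iSup_eigenspace_of_scalar {V : Type*} [AddCommGroup V] [Module ℂ V] (T : Module.End ℂ V)
    (e : ℂ) (h : ∀ w, T w = e • w) : (⨆ μ : ℂ, T.eigenspace μ) = ⊤ := by
  rw [eq_top_iff]
  intro w _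
  exact Submodule.mem_iSup_of_mem e (Module.End.mem_eigenspace_iff.2 (h w))

theorem IsIrreducible.isOfin (h : M.IsIrreducible) (hk : k ≠ 0) (hM : M.IsGradingRestricted) :
    M.IsOfin := by
  obtain ⟨⟨e, he⟩, hN⟩ := h.scalar hk hM
  exact ⟨⟨hM, 1, h.hasLength⟩, hN, iSup_eigenspace_of_scalar _ e he⟩

/-! ### Modules with a generating vector -/

/-- A homogeneous generator that is an eigenvector of `N₀` and `E₀`, annihilated by the positive
Heisenberg modes and by all modes of sufficiently large index. -/
structure IsGen (M : AffMod k) (n e c : ℂ) (u : M.W) : Prop where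
  gen : (M.generated {u}).1 = ⊤
  θ : M.θ u = c • u
  N0 : M.act N 0 u = n • u
  E0 : M.act E 0 u = e • u
  Nr : ∀ r : ℤ, 0 < r → M.act N r u = 0
  Er : ∀ r : ℤ, 0 < r → M.act E r u = 0
  bd : ∃ R : ℤ, ∀ a r, R ≤ r → M.act a r u = 0

theorem IsGen.top_le {n e c : ℂ} {u : M.W} (hu : M.IsGen n e c u) (X : Submodule ℂ M.W)
    (hX : M.IsGraded X) (h : u ∈ X) (w : M.W) : w ∈ X := by
  have := M.generated_le {u} X hX (by simpa using h)
  rw [hu.gen] at this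
  exact this Submodule.mem_top

theorem IsGen.E0_apply {n e c : ℂ} {u : M.W} (hu : M.IsGen n e c u) (w : M.W) :
    M.act E 0 w = e • w := by
  have hg : M.IsGraded ((M.act E 0).eigenspace e) := by
    refine ⟨fun a r w hw => ?_, fun w hw => ?_⟩
    · rw [Submodule.mem_comap]
      rw [Module.End.mem_eigenspace_iff] at hw ⊢
      rw [E0_act, hw, map_smul]
    · rw [Submodule.mem_comap]
      rw [Module.End.mem_eigenspace_iff] at hw ⊢
      have : M.act E 0 (M.θ w) = M.θ (M.act E 0 w) := by simp [θ_act_apply, par]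
      rw [this, hw, map_smul]
  exact Module.End.mem_eigenspace_iff.1 (hu.top_le _ hg (Module.End.mem_eigenspace_iff.2 hu.E0) w)

theorem IsGen.iSup_N0 {n e c : ℂ} {u : M.W} (hu : M.IsGen n e c u) :
    (⨆ μ : ℂ, (M.act N 0).eigenspace μ) = ⊤ := by
  have hg : M.IsGraded (⨆ μ : ℂ, (M.act N 0).eigenspace μ) := by
    refine ⟨fun a r => iSup_le fun μ w hw => ?_, iSup_le fun μ w hw => ?_⟩
    · refine Submodule.mem_iSup_of_mem (μ + chg a) ?_
      rw [Module.End.mem_eigenspace_iff] at hw ⊢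
      rw [N0_act, hw, map_smul, add_smul]
    · refine Submodule.mem_iSup_of_mem μ ?_
      rw [Module.End.mem_eigenspace_iff] at hw ⊢
      have : M.act N 0 (M.θ w) = M.θ (M.act N 0 w) := by simp [θ_act_apply, par]
      rw [this, hw, map_smul]
  rw [eq_top_iff]
  intro w _
  exact hu.top_le _ hg
    (Submodule.mem_iSup_of_mem n (Module.End.mem_eigenspace_iff.2 hu.N0)) w

theorem IsGen.smooth {n e c : ℂ} {u : M.W} (hu : M.IsGen n e c u) : M.IsSmooth := by
  let S : Submodule ℂ M.W :=
    { carrier := {w | ∃ R : ℤ, ∀ a r, R ≤ r → M.act a r w = 0}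
      zero_mem' := ⟨0, by simp⟩
      add_mem' := by
        rintro v w ⟨R, hR⟩ ⟨R', hR'⟩
        refine ⟨max R R', fun a r hr => ?_⟩
        rw [map_add, hR a r (le_trans (le_max_left _ _) hr),
          hR' a r (le_trans (le_max_right _ _) hr), add_zero]
      smul_mem' := by
        rintro c v ⟨R, hR⟩
        exact ⟨R, fun a r hr => by rw [map_smul, hR a r hr, smul_zero]⟩ }
  have hS : M.IsGraded S := by
    refine ⟨?_, ?_⟩
    · rintro b s w ⟨R, hR⟩
      refine ⟨max R (max (R - s) (1 - s)), fun a r hr => ?_⟩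
      have h1 : R ≤ r := le_trans (le_max_left _ _) hr
      have h2 : max (R - s) (1 - s) ≤ r := le_trans (le_max_right _ _) hr
      have h3 : R - s ≤ r := le_trans (le_max_left _ _) h2
      have h4 : 1 - s ≤ r := le_trans (le_max_right _ _) h2
      rw [rel_apply, hR a r h1,
        Finset.sum_eq_zero fun c _ => by rw [hR c _ (by omega), smul_zero]]
      simp [central, show r + s ≠ 0 by omega]
    · rintro w ⟨R, hR⟩
      refine ⟨R, fun a r hr => ?_⟩
      have h1 := M.θ_act_apply a r w
      rw [hR a r hr, map_zero] at h1
      exact (smul_eq_zero.1 h1.symm).resolve_left (pow_ne_zero _ (by norm_num))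
  exact fun w => hu.top_le S hS hu.bd w

theorem nilE_act (M : AffMod k) (r : ℤ) (a : Gen) (s : ℤ) (w : M.W)
    (h : ∃ j : ℕ, (M.act E r ^ j) w = 0) : ∃ j : ℕ, (M.act E r ^ j) (M.act a s w) = 0 := by
  obtain ⟨j, hj⟩ := h
  have hcomm : ∃ c : ℂ, ∀ w, M.act E r (M.act a s w) = M.act a s (M.act E r w) + c • w := by
    cases a
    · exact ⟨_, fun w => M.EN r s w⟩
    · exact ⟨0, fun w => by rw [EE]; simp⟩
    · exact ⟨0, fun w => by rw [EP]; simp⟩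
    · exact ⟨0, fun w => by rw [EM]; simp⟩
  obtain ⟨c, hc⟩ := hcomm
  have key : ∀ i : ℕ, ∀ w, (M.act E r ^ (i + 1)) (M.act a s w) =
      M.act a s ((M.act E r ^ (i + 1)) w) + ((i + 1 : ℂ) * c) • (M.act E r ^ i) w := by
    intro i
    induction i with
    | zero => intro w; simp [hc]
    | succ i ih =>
      intro w
      have e1 : ∀ i : ℕ, (M.act E r ^ i) (M.act E r w) = (M.act E r ^ (i + 1)) w := fun i => by
        rw [pow_succ, Module.End.mul_apply]
      rw [pow_succ, Module.End.mul_apply, hc, map_add, ih, map_smul, Module.End.mul_apply, e1, e1]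
      push_cast
      module
  refine ⟨j + 1, ?_⟩
  rw [key, pow_succ', Module.End.mul_apply, hj]
  simp

/-- `N_r`, `r > 0`, remains nilpotent on `a_s w`: `[N_r, a_s]` is a multiple of `a_{r+s}`, and `a_s w`
vanishes for large `s`. -/
theorem nilN_act (M : AffMod k) (hs : M.IsSmooth) (r : ℤ) (hr : 0 < r) (j : ℕ) (a : Gen) (s : ℤ)
    (w : M.W) (h : (M.act N r ^ j) w = 0) : ∃ i : ℕ, (M.act N r ^ i) (M.act a s w) = 0 := by
  induction j generalizing w s with
  | zero => exact ⟨0, by simp_all⟩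
  | succ j ih =>
    have hcomm : ∃ c : ℂ, ∃ d : ℂ, ∀ s w, M.act N r (M.act a s w) =
        M.act a s (M.act N r w) + c • M.act a (r + s) w + (if r + s = 0 then d else 0) • w := by
      cases a
      · exact ⟨0, 0, fun s w => by rw [NN]; simp⟩
      · exact ⟨0, (r : ℂ) * k, fun s w => by rw [NE]; simp⟩
      · exact ⟨1, 0, fun s w => by rw [NP]; simp⟩
      · exact ⟨-1, 0, fun s w => by rw [NM]; simp [sub_eq_add_neg]⟩
    obtain ⟨c, d, hc⟩ := hcomm
    have hup : ∀ i i' : ℕ, ∀ v, (M.act N r ^ i) v = 0 → (M.act N r ^ (i' + i)) v = 0 := by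
      intro i i' v hv
      rw [pow_add, Module.End.mul_apply, hv, map_zero]
    obtain ⟨R, hR⟩ := hs w
    -- downward induction on `s`, starting from the indices that annihilate `w`
    have main : ∀ (m : ℕ) (s : ℤ), R ≤ s + m → ∃ i : ℕ, (M.act N r ^ i) (M.act a s w) = 0 := by
      intro m
      induction m with
      | zero => exact fun s hs => ⟨0, by rw [hR a s (by simpa using hs)]; simp⟩
      | succ m ihm =>
        intro s hs
        obtain ⟨i₁, h1⟩ := ih s (M.act N r w) (by rwa [pow_succ, Module.End.mul_apply] at h)
        obtain ⟨i₂, h2⟩ := ihm (r + s) (by push_cast at hs; omega)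
        refine ⟨(i₁ + i₂ + (j + 1)) + 1, ?_⟩
        rw [pow_succ, Module.End.mul_apply, hc, map_add, map_add, map_smul, map_smul,
          hup (j + 1) (i₁ + i₂) w h, show i₁ + i₂ + (j + 1) = (i₂ + (j + 1)) + i₁ by ring,
          hup _ _ _ h1, show i₂ + (j + 1) + i₁ = (j + 1 + i₁) + i₂ by ring, hup _ _ _ h2]
        simp
    exact main (R - s).toNat s (by omega)

theorem IsGen.nice {n e c : ℂ} {u : M.W} (hu : M.IsGen n e c u) : M.Nice := by
  have nilSub : ∀ (T : Module.End ℂ M.W) (hT : ∀ w, T (M.θ w) = M.θ (T w))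
      (h : ∀ a s w, (∃ j : ℕ, (T ^ j) w = 0) → ∃ j : ℕ, (T ^ j) (M.act a s w) = 0)
      (h0 : T u = 0) (w : M.W), ∃ j : ℕ, (T ^ j) w = 0 := by
    intro T hT h h0 w
    let S : Submodule ℂ M.W :=
      { carrier := {w | ∃ j : ℕ, (T ^ j) w = 0}
        zero_mem' := ⟨0, by simp⟩
        add_mem' := by
          rintro v v' ⟨i, hi⟩ ⟨j, hj⟩
          refine ⟨i + j, ?_⟩
          rw [map_add]
          conv_lhs => enter [1]; rw [add_comm]
          rw [pow_add, pow_add, Module.End.mul_apply, Module.End.mul_apply, hi, hj]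
          simp
        smul_mem' := by
          rintro c v ⟨i, hi⟩
          exact ⟨i, by rw [map_smul, hi, smul_zero]⟩ }
    refine hu.top_le S ⟨fun a r w hw => h a r w hw, ?_⟩ ⟨1, by simpa using h0⟩ w
    rintro w ⟨j, hj⟩
    exact ⟨j, by rw [← map_pow_apply M.θ T T fun w => (hT w).symm, hj, map_zero]⟩
  refine ⟨hu.smooth, fun r hr => nilSub _ (fun w => ?_) (fun a s w h => M.nilE_act r a s w h)
    (hu.Er r hr), fun r hr => nilSub _ (fun w => ?_)
    (fun a s w ⟨j, hj⟩ => M.nilN_act hu.smooth r hr j a s w hj) (hu.Nr r hr), hu.iSup_N0,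
    iSup_eigenspace_of_scalar _ e hu.E0_apply⟩ <;>
  simp [θ_act_apply, par]

end AffMod

end

end AffGL
namespace AffGL

open Gen Polynomial

noncomputable section

/-- If homogeneous vectors span, then each generalised eigenspace is spanned by the
ones that lie in it. -/
theorem maxGen_le_span {V ι : Type*} [AddCommGroup V] [Module ℂ V] (T : Module.End ℂ V) (x : ι → V)
    (h : ι → ℂ) (hx : ∀ i, x i ∈ T.maxGenEigenspace (h i))
    (htop : Submodule.span ℂ (Set.range x) = ⊤) (μ : ℂ) :
    T.maxGenEigenspace μ ≤ Submodule.span ℂ (x '' {i | h i = μ}) := by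
  intro w hw
  have h1 : (⊤ : Submodule ℂ V) ≤ Submodule.span ℂ (x '' {i | h i = μ}) ⊔
      ⨆ ν, ⨆ (_ : ν ≠ μ), T.maxGenEigenspace ν := by
    rw [← htop, Submodule.span_le]
    rintro _ ⟨i, rfl⟩
    by_cases hi : h i = μ
    · exact Submodule.mem_sup_left (Submodule.subset_span ⟨i, hi, rfl⟩)
    · exact Submodule.mem_sup_right
        (Submodule.mem_iSup_of_mem (h i) (Submodule.mem_iSup_of_mem hi (hx i)))
  obtain ⟨s, hs, t, ht, rfl⟩ := Submodule.mem_sup.1 (h1 (Submodule.mem_top (x := w)))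
  have hs' : s ∈ T.maxGenEigenspace μ := by
    refine (Submodule.span_le.2 ?_ : Submodule.span ℂ (x '' {i | h i = μ}) ≤ _) hs
    rintro _ ⟨i, hi, rfl⟩
    exact (show h i = μ from hi) ▸ hx i
  have ht' : t ∈ T.maxGenEigenspace μ := by
    have := Submodule.sub_mem _ hw hs'
    rwa [add_sub_cancel_left] at this
  have := (Submodule.disjoint_def.1 (T.independent_maxGenEigenspace μ)) t ht' ht
  rw [this, add_zero]
  exact hs

theorem exists_finite_span {V : Type*} [AddCommGroup V] [Module ℂ V] (S : Set V)
    (Y : Submodule ℂ V) (hY : Y.FG) (h : Y ≤ Submodule.span ℂ S) :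
    ∃ B : Finset V, (B : Set V) ⊆ S ∧ Y ≤ Submodule.span ℂ (B : Set V) := by
  classical
  obtain ⟨t, rfl⟩ := hY
  have h1 : ∀ x : t, ∃ B : Finset V, (B : Set V) ⊆ S ∧ (x : V) ∈ Submodule.span ℂ (B : Set V) :=
    fun x => Submodule.mem_span_finite_of_mem_span (h (Submodule.subset_span x.2))
  choose B hB hx using h1
  refine ⟨Finset.univ.biUnion B, ?_, ?_⟩
  · intro v hv
    simp only [Finset.coe_biUnion, Set.mem_iUnion] at hv
    obtain ⟨x, -, hv⟩ := hv
    exact hB x hv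
  · rw [Submodule.span_le]
    intro x hxt
    refine Submodule.span_mono ?_ (hx ⟨x, hxt⟩)
    intro v hv
    simp only [Finset.coe_biUnion, Set.mem_iUnion]
    exact ⟨⟨x, hxt⟩, by simp, hv⟩

/-- The degree of a word in the negative modes, a letter `(a, r)` standing for `a_{-(r+1)}`. -/
def wordDeg (l : List (Gen × ℕ)) : ℕ := (l.map fun x => x.2 + 1).sum

theorem wordDeg_cons (x : Gen × ℕ) (l : List (Gen × ℕ)) :
    wordDeg (x :: l) = x.2 + 1 + wordDeg l := by
  simp only [wordDeg, List.map_cons, List.sum_cons]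

theorem finite_wordDeg (m : ℕ) : {l | wordDeg l = m}.Finite := by
  induction m using Nat.strong_induction_on with
  | _ m ih =>
    have h1 : {l | wordDeg l = m} ⊆ {[]} ∪
        ⋃ (a : Gen), ⋃ (r : Fin m), List.cons (a, (r : ℕ)) '' {l | wordDeg l = m - (r + 1)} := by
      rintro l hl
      cases l with
      | nil => exact Or.inl rfl
      | cons x l =>
        have h2 : x.2 + 1 + wordDeg l = m := by rw [← wordDeg_cons]; exact hl
        refine Or.inr (Set.mem_iUnion.2 ⟨x.1, Set.mem_iUnion.2 ⟨⟨x.2, by omega⟩, l, ?_, rfl⟩⟩)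
        change wordDeg l = m - (x.2 + 1)
        omega
    refine Set.Finite.subset ((Set.finite_singleton _).union (Set.finite_iUnion fun a =>
      Set.finite_iUnion fun r => (ih _ ?_).image _)) h1
    have := r.2
    omega

namespace AffMod

variable {k : ℂ} {M : AffMod k}

/-- A word in the negative modes applied to a vector. -/
def word (M : AffMod k) (l : List (Gen × ℕ)) (w : M.W) : M.W :=
  l.foldr (fun x v => M.act x.1 (-((x.2 : ℤ) + 1)) v) w

theorem word_cons (M : AffMod k) (x : Gen × ℕ) (l : List (Gen × ℕ)) (w : M.W) :
    M.word (x :: l) w = M.act x.1 (-((x.2 : ℤ) + 1)) (M.word l w) := rfl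

theorem word_maxGen (M : AffMod k) (hk : k ≠ 0) (h : M.IsSmooth) (l : List (Gen × ℕ)) (μ : ℂ)
    (w : M.W) (hw : w ∈ (M.L0 h).maxGenEigenspace μ) :
    M.word l w ∈ (M.L0 h).maxGenEigenspace (μ + wordDeg l) := by
  induction l with
  | nil => simpa [word, wordDeg] using hw
  | cons x l ih =>
    have := M.act_maxGen hk h x.1 (-((x.2 : ℤ) + 1)) _ _ ih
    rw [word_cons]
    convert this using 2
    rw [wordDeg_cons]
    push_cast
    ring

theorem word_linear (M : AffMod k) (l : List (Gen × ℕ)) :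
    ∃ f : M.W →ₗ[ℂ] M.W, ∀ w, f w = M.word l w := by
  induction l with
  | nil => exact ⟨LinearMap.id, fun w => rfl⟩
  | cons x l ih =>
    obtain ⟨f, hf⟩ := ih
    exact ⟨M.act x.1 (-((x.2 : ℤ) + 1)) ∘ₗ f, fun w => by simp [hf, word]⟩

theorem Words.exists_word {Y : Submodule ℂ M.W} {w : M.W} (hw : Words M (fun _ r => r < 0) Y w) :
    ∃ (l : List (Gen × ℕ)), ∃ y ∈ Y, w = M.word l y := by
  induction hw with
  | base y hy => exact ⟨[], y, hy, rfl⟩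
  | step a r w ha _ ih =>
    obtain ⟨l, y, hy, rfl⟩ := ih
    refine ⟨(a, (-r - 1).toNat) :: l, y, hy, ?_⟩
    have : -(((-r - 1).toNat : ℤ) + 1) = r := by omega
    rw [word_cons, this]

/-- Enlarging a finite-dimensional stable subspace by one more odd mode. -/
theorem stable_step (M : AffMod k) (a : Gen) (n : ℤ) (St : Gen → ℤ → Prop)
    (hsq : ∀ w, M.act a n (M.act a n w) = 0)
    (hcl : ∀ b s, St b s → ∀ c, bracket b a c ≠ 0 → St c (s + n) ∨ (c = a ∧ s = 0))
    (Y : Submodule ℂ M.W) (hfg : Y.FG) (hθ : ∀ y ∈ Y, M.θ y ∈ Y)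
    (hY : ∀ b s, St b s → ∀ y ∈ Y, M.act b s y ∈ Y) :
    ∃ Y' : Submodule ℂ M.W, Y ≤ Y' ∧ Y'.FG ∧ (∀ y ∈ Y', M.θ y ∈ Y') ∧
      ∀ b s, (St b s ∨ (b = a ∧ s = n)) → ∀ y ∈ Y', M.act b s y ∈ Y' := by
  have hin : ∀ y ∈ Y, M.act a n y ∈ Y ⊔ Y.map (M.act a n) := fun y hy =>
    Submodule.mem_sup_right ⟨y, hy, rfl⟩
  refine ⟨Y ⊔ Y.map (M.act a n), le_sup_left, hfg.sup (hfg.map _), ?_, ?_⟩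
  · intro y hy
    obtain ⟨y₁, h1, _, ⟨y₂, h2, rfl⟩, rfl⟩ := Submodule.mem_sup.1 hy
    rw [map_add, θ_act_apply]
    exact Submodule.add_mem _ (Submodule.mem_sup_left (hθ _ h1))
      (Submodule.smul_mem _ _ (hin _ (hθ _ h2)))
  · intro b s hb y hy
    obtain ⟨y₁, h1, _, ⟨y₂, h2, rfl⟩, rfl⟩ := Submodule.mem_sup.1 hy
    rw [map_add]
    rcases hb with hb | ⟨rfl, rfl⟩
    · refine Submodule.add_mem _ (Submodule.mem_sup_left (hY b s hb _ h1)) ?_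
      rw [rel_apply]
      refine Submodule.add_mem _ (Submodule.smul_mem _ _ (hin _ (hY b s hb _ h2)))
        (Submodule.add_mem _ (Submodule.sum_mem _ fun c _ => ?_)
          (Submodule.smul_mem _ _ (Submodule.mem_sup_left h2)))
      by_cases hc : bracket b a c = 0
      · rw [hc, zero_smul]; exact Submodule.zero_mem _
      · refine Submodule.smul_mem _ _ ?_
        rcases hcl b s hb c hc with h | ⟨rfl, rfl⟩
        · exact Submodule.mem_sup_left (hY _ _ h _ h2)
        · rw [zero_add]
          exact hin _ h2
    · rw [hsq, add_zero]
      exact hin _ h1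

/-- The non-negative modes generate a finite-dimensional space from a generator. -/
theorem IsGen.exists_stable {n e c : ℂ} {u : M.W} (hu : M.IsGen n e c u) :
    ∃ Y : Submodule ℂ M.W, u ∈ Y ∧ Y.FG ∧ (∀ y ∈ Y, M.θ y ∈ Y) ∧
      ∀ b s, 0 ≤ s → ∀ y ∈ Y, M.act b s y ∈ Y := by
  obtain ⟨R, hR⟩ := hu.bd
  -- the non-negative modes, of which the odd ones only from index `m` on; they preserve the line of
  -- the generator for `m` large, and `m` is lowered one odd mode at a time
  let St : ℤ → Gen → ℤ → Prop := fun m b s => 0 ≤ s ∧ ((b = psiP ∨ b = psiM) → m ≤ s)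
  have base : ∃ Y : Submodule ℂ M.W, u ∈ Y ∧ Y.FG ∧ (∀ y ∈ Y, M.θ y ∈ Y) ∧
      ∀ b s, St (R.toNat : ℤ) b s → ∀ y ∈ Y, M.act b s y ∈ Y := by
    refine ⟨Submodule.span ℂ {u}, Submodule.mem_span_singleton_self u,
      Submodule.fg_span (Set.finite_singleton u), ?_, ?_⟩
    · intro y hy
      obtain ⟨t, rfl⟩ := Submodule.mem_span_singleton.1 hy
      rw [map_smul, hu.θ]
      exact Submodule.smul_mem _ _ (Submodule.smul_mem _ _ (Submodule.mem_span_singleton_self u))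
    · rintro b s ⟨h0, hs⟩ y hy
      obtain ⟨t, rfl⟩ := Submodule.mem_span_singleton.1 hy
      rw [map_smul]
      refine Submodule.smul_mem _ _ ?_
      rcases h0.lt_or_eq with h0 | rfl
      · have : M.act b s u = 0 := by
          cases b
          · exact hu.Nr s h0
          · exact hu.Er s h0
          · exact hR _ _ (by have := hs (Or.inl rfl); omega)
          · exact hR _ _ (by have := hs (Or.inr rfl); omega)
        rw [this]; exact Submodule.zero_mem _
      · cases b
        · rw [hu.N0]; exact Submodule.smul_mem _ _ (Submodule.mem_span_singleton_self u)
        · rw [hu.E0]; exact Submodule.smul_mem _ _ (Submodule.mem_span_singleton_self u)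
        · rw [hR _ _ (by have := hs (Or.inl rfl); omega)]; exact Submodule.zero_mem _
        · rw [hR _ _ (by have := hs (Or.inr rfl); omega)]; exact Submodule.zero_mem _
  have down : ∀ m : ℕ, (∃ Y : Submodule ℂ M.W, u ∈ Y ∧ Y.FG ∧ (∀ y ∈ Y, M.θ y ∈ Y) ∧
      ∀ b s, St (m : ℤ) b s → ∀ y ∈ Y, M.act b s y ∈ Y) →
      ∃ Y : Submodule ℂ M.W, u ∈ Y ∧ Y.FG ∧ (∀ y ∈ Y, M.θ y ∈ Y) ∧
        ∀ b s, St 0 b s → ∀ y ∈ Y, M.act b s y ∈ Y := by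
    intro m
    induction m with
    | zero => exact fun h => by simpa using h
    | succ m ih =>
      rintro ⟨Y, h1, h2, h3, h4⟩
      obtain ⟨Y₁, g0, g2, g3, g4⟩ := M.stable_step psiP m (St (m + 1 : ℕ)) (M.PP_self m) (by
        rintro b s ⟨hs0, hs⟩ c hc
        cases b <;> cases c <;> simp [bracket, St] at hc hs ⊢ <;> omega) Y h2 h3 h4
      obtain ⟨Y₂, f0, f2, f3, f4⟩ := M.stable_step psiM m
        (fun b s => St (m + 1 : ℕ) b s ∨ (b = psiP ∧ s = m)) (M.MM_self m) (by
        rintro b s hb c hc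
        cases b <;> cases c <;> simp [bracket, St] at hc hb ⊢ <;> omega) Y₁ g2 g3 g4
      refine ih ⟨Y₂, f0 (g0 h1), f2, f3, ?_⟩
      rintro b s ⟨hs0, hs⟩
      refine f4 b s ?_
      cases b <;> simp [St] at hs ⊢ <;> omega
  obtain ⟨Y, h1, h2, h3, h4⟩ := down _ base
  exact ⟨Y, h1, h2, h3, fun b s hs => h4 b s ⟨hs, fun _ => hs⟩⟩

/-- Modules with a generating vector are grading-restricted: words in the negative modes applied to
finitely many generalised eigenvectors of `L₀` span. -/
theorem IsGen.isGradingRestricted {n e c : ℂ} {u : M.W} (hu : M.IsGen n e c u) (hk : k ≠ 0) :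
    M.IsGradingRestricted := by
  have hM := hu.nice
  have hs := hM.smooth
  have htop : (⨆ μ : ℂ, (M.L0 hs).maxGenEigenspace μ) = ⊤ := by
    rw [eq_top_iff]
    intro w _
    obtain ⟨p, hp, hw⟩ := hM.algebraic hk 0 w
    rw [numOp_zero] at hw
    -- induction on the number of roots of an annihilating polynomial
    suffices H : ∀ (m : ℕ) (p : ℂ[X]) (w : M.W), p.natDegree = m → p ≠ 0 →
        aeval (M.L0 hs) p w = 0 → w ∈ ⨆ μ : ℂ, (M.L0 hs).maxGenEigenspace μ from H _ p w rfl hp hw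
    intro m
    induction m using Nat.strong_induction_on with
    | _ m ih =>
      intro p w hm hp hw
      rcases Nat.eq_zero_or_pos m with h0 | hpos
      · rw [h0] at hm
        rw [eq_C_of_natDegree_eq_zero hm] at hw hp
        have : p.coeff 0 ≠ 0 := fun h => hp (by rw [h, C_0])
        simp only [aeval_C, Module.algebraMap_end_apply] at hw
        rw [(smul_eq_zero.1 hw).resolve_left this]
        exact Submodule.zero_mem _
      · obtain ⟨μ, hμ⟩ := IsAlgClosed.exists_root p (by
          intro h
          have : p.natDegree = 0 := natDegree_eq_of_degree_eq_some h
          omega)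
        obtain ⟨q, hq, hd⟩ := exists_eq_pow_rootMultiplicity_mul_and_not_dvd p hp μ
        have hqc : q.eval μ ≠ 0 := fun h => hd (dvd_iff_isRoot.2 h)
        have hq0 : q ≠ 0 := by rintro rfl; simp at hqc
        set j := p.rootMultiplicity μ with hj
        have hj0 : 0 < j := (rootMultiplicity_pos hp).2 hμ
        obtain ⟨s, t, hst⟩ := isCoprime_X_sub_C_pow hqc j
        have e1 : w = aeval (M.L0 hs) (s * (X - C μ) ^ j) w + aeval (M.L0 hs) (t * q) w := by
          rw [← LinearMap.add_apply, ← map_add, hst]; simp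
        rw [e1]
        refine Submodule.add_mem _ ?_ (Submodule.mem_iSup_of_mem μ ?_)
        · refine ih q.natDegree ?_ q _ rfl hq0 ?_
          · rw [← hm]
            conv_rhs => rw [hq]
            rw [natDegree_mul (pow_ne_zero _ (X_sub_C_ne_zero μ)) hq0, natDegree_pow,
              natDegree_X_sub_C]
            omega
          · rw [← Module.End.mul_apply, ← map_mul]
            have : q * (s * (X - C μ) ^ j) = s * p := by
              conv_rhs => rw [hq]
              ring
            rw [this, map_mul, Module.End.mul_apply, hw, map_zero]
        · rw [mem_maxGen_iff]
          refine ⟨j, ?_⟩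
          rw [← Module.End.mul_apply, ← map_mul]
          have : (X - C μ) ^ j * (t * q) = t * p := by
            conv_rhs => rw [hq]
            ring
          rw [this, map_mul, Module.End.mul_apply, hw, map_zero]
  -- words in the negative modes, applied to finitely many generalised eigenvectors, span
  obtain ⟨Y, huY, hfg, hθ, hY⟩ := hu.exists_stable
  have hspan : Submodule.span ℂ {w : M.W | ∃ μ : ℂ, w ∈ (M.L0 hs).maxGenEigenspace μ} = ⊤ := by
    rw [eq_top_iff, ← htop]
    exact iSup_le fun μ w hw => Submodule.subset_span ⟨μ, hw⟩
  obtain ⟨B, hB, hYB⟩ := exists_finite_span _ Y hfg (hspan ▸ le_top)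
  choose h hh using fun b : B => hB b.2
  let x : B × List (Gen × ℕ) → M.W := fun i => M.word i.2 i.1
  let d : B × List (Gen × ℕ) → ℂ := fun i => h i.1 + wordDeg i.2
  have hx : ∀ i, x i ∈ (M.L0 hs).maxGenEigenspace (d i) := fun i =>
    M.word_maxGen hk hs i.2 _ _ (hh i.1)
  have hxtop : Submodule.span ℂ (Set.range x) = ⊤ := by
    have h1 := M.generated_le_span_words (fun _ r => r < 0) Y
      (fun a r hr y hy => hY a r (not_lt.1 hr) y hy) hθ
    have h2 : (M.generated Y).1 = ⊤ := by
      rw [eq_top_iff]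
      intro w _
      exact hu.top_le _ (M.generated Y).2 (M.subset_generated _ huY) w
    rw [h2] at h1
    rw [eq_top_iff]
    refine h1.trans (Submodule.span_le.2 ?_)
    rintro w hw
    obtain ⟨l, y, hy, rfl⟩ := hw.exists_word
    obtain ⟨f, hf⟩ := M.word_linear l
    have h3 : Submodule.span ℂ (B : Set M.W) ≤ (Submodule.span ℂ (Set.range x)).comap f := by
      rw [Submodule.span_le]
      intro b hb
      rw [SetLike.mem_coe, Submodule.mem_comap, hf]
      exact Submodule.subset_span ⟨(⟨b, hb⟩, l), rfl⟩
    rw [← hf]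
    exact h3 (hYB hy)
  have hle := maxGen_le_span (M.L0 hs) x d hx hxtop
  refine ⟨hs, htop, fun μ => ?_, fun μ => ?_⟩
  · have hfin : {i | d i = μ}.Finite := by
      have : {i | d i = μ} ⊆ ⋃ b : B, Prod.mk b '' {l | h b + wordDeg l = μ} := by
        rintro ⟨b, l⟩ hi
        exact Set.mem_iUnion.2 ⟨b, l, hi, rfl⟩
      refine Set.Finite.subset (Set.finite_iUnion fun b => Set.Finite.image _ ?_) this
      by_cases hm : ∃ m : ℕ, h b + m = μ
      · obtain ⟨m, hm⟩ := hm
        refine (finite_wordDeg m).subset fun l hl => ?_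
        have : h b + wordDeg l = h b + m := by rw [hm]; exact hl
        exact_mod_cast add_left_cancel this
      · refine Set.finite_empty.subset fun l hl => hm ⟨_, hl⟩
    have := FiniteDimensional.span_of_finite ℂ (hfin.image x)
    exact Submodule.finiteDimensional_of_le (hle μ)
  · -- a word of degree `d` on the vector `b` has eigenvalue `μ - m` only if `d + m = ‖μ - h b‖`
    refine ⟨∑ b : B, (⌈‖μ - h b‖⌉₊ + 1), fun m hm => ?_⟩
    rw [eq_bot_iff]
    have : {i | d i = μ - m} = ∅ := by
      rw [Set.eq_empty_iff_forall_notMem]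
      rintro ⟨b, l⟩ hi
      have h1 : μ - h b = ((wordDeg l + m : ℕ) : ℂ) := by
        have : h b + wordDeg l = μ - m := hi
        push_cast
        linear_combination -this
      have h2 : ‖μ - h b‖ = ((wordDeg l + m : ℕ) : ℝ) := by rw [h1, Complex.norm_natCast]
      have h3 : ⌈‖μ - h b‖⌉₊ = wordDeg l + m := by rw [h2, Nat.ceil_natCast]
      have h4 : ⌈‖μ - h b‖⌉₊ + 1 ≤ m := (Finset.single_le_sum
        (f := fun b : B => ⌈‖μ - h b‖⌉₊ + 1) (fun _ _ => Nat.zero_le _) (Finset.mem_univ b)).trans hm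
      omega
    have h5 := hle (μ - m)
    rw [this, Set.image_empty, Submodule.span_empty] at h5
    exact h5

theorem IsGen.isOfin {n e c : ℂ} {u : M.W} (hu : M.IsGen n e c u) (hk : k ≠ 0) {l : ℕ}
    (hl : M.HasLength l) : M.IsOfin :=
  ⟨⟨hu.isGradingRestricted hk, l, hl⟩, hu.nice.ssN, hu.nice.ssE⟩

end AffMod

end

end AffGL
namespace AffGL

open Gen

noncomputable section

/-! ### The universal property of cyclic modules -/

namespace AffMod

variable {k : ℂ} {M M' A B : AffMod k}

/-- The action of the enveloping algebra on a module. -/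
def toEnd (A : AffMod k) : Ulev k →ₐ[ℂ] Module.End ℂ A.W :=
  RingCon.liftₐ _ (FreeAlgebra.lift ℂ fun x : Gen × ℤ => A.act x.1 x.2) <| by
    apply RingCon.ringConGen_le.2
    rintro _ _ ⟨a, b, r, s⟩
    simpa using A.rel a b r s

theorem toEnd_mode (A : AffMod k) (a : Gen) (r : ℤ) : A.toEnd (mode k a r) = A.act a r :=
  (FreeAlgebra.lift_ι_apply (R := ℂ) (fun x : Gen × ℤ => A.act x.1 x.2) (a, r) :)

end AffMod

open AffMod

variable {k : ℂ}

/-- The enveloping algebra is generated by `1`. -/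
theorem regular_top (X : Submodule ℂ (Ulev k)) (hX : ∀ a r, ∀ x ∈ X, mode k a r * x ∈ X)
    (h1 : (1 : Ulev k) ∈ X) (x : Ulev k) : x ∈ X := by
  have key : ∀ f : Free, ∀ y ∈ X, quotMap k f * y ∈ X := by
    intro f
    induction f using FreeAlgebra.induction with
    | grade0 c =>
      intro y hy
      rw [AlgHom.commutes, ← Algebra.smul_def]
      exact X.smul_mem _ hy
    | grade1 x => exact fun y hy => hX x.1 x.2 y hy
    | mul f g hf hg =>
      intro y hy
      rw [map_mul, mul_assoc]
      exact hf _ (hg y hy)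
    | add f g hf hg =>
      intro y hy
      rw [map_add, add_mul]
      exact X.add_mem (hf y hy) (hg y hy)
  obtain ⟨f, rfl⟩ := Quotient.exists_rep x
  have := key f 1 h1
  rw [mul_one] at this
  exact this

theorem θ_toEnd (A : AffMod k) (x : Ulev k) (w : A.W) :
    A.θ (A.toEnd x w) = A.toEnd (parityAut k x) (A.θ w) := by
  let X : Submodule ℂ (Ulev k) :=
    { carrier := {x | ∀ w, A.θ (A.toEnd x w) = A.toEnd (parityAut k x) (A.θ w)}
      zero_mem' := by simp
      add_mem' := by
        intro x y hx hy w
        have h1 := hx w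
        have h2 := hy w
        simp only [map_add, LinearMap.add_apply, h1, h2]
      smul_mem' := by
        intro c x hx w
        have h1 := hx w
        simp only [map_smul, LinearMap.smul_apply, h1] }
  refine regular_top X (fun a r x hx w => ?_) (fun w => by simp) x w
  have h1 := hx w
  simp only [map_mul, Module.End.mul_apply, toEnd_mode, θ_act_apply, parityAut_mode, map_smul,
    LinearMap.smul_apply, h1]

/-- The generator of a cyclic module. -/
def cyc (k : ℂ) (s : Set (Ulev k)) : (cyclic k s).W := ((regular k).generated s).1.mkQ (1 : Ulev k)

theorem cyc_generated (s : Set (Ulev k)) :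
    ((cyclic k s).generated {cyc k s}).1 = ⊤ := by
  rw [eq_top_iff]
  intro w _
  set X := (cyclic k s).generated {cyc k s}
  obtain ⟨x, rfl⟩ := ((regular k).generated s).1.mkQ_surjective w
  have h := regular_top (X.1.comap ((regular k).generated s).1.mkQ)
    (fun a r x hx => X.2.1 a r hx) ((cyclic k s).mem_generated_self _) x
  exact h

theorem cyc_θ (s : Set (Ulev k)) : (cyclic k s).θ (cyc k s) = cyc k s :=
  congrArg ((regular k).generated s).1.mkQ (map_one (parityAut k))

theorem cyc_mode (s : Set (Ulev k)) (a : Gen) (r : ℤ) (c : ℂ) (h : mode k a r - c • 1 ∈ s) :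
    (cyclic k s).act a r (cyc k s) = c • cyc k s := by
  let q : Ulev k →ₗ[ℂ] (cyclic k s).W := ((regular k).generated s).1.mkQ
  have h1 : q (mode k a r - c • 1) = 0 :=
    (Submodule.Quotient.mk_eq_zero _).2 ((regular k).subset_generated s h)
  have h2 : (cyclic k s).act a r (cyc k s) = q (mode k a r * 1) := rfl
  have h3 : cyc k s = q 1 := rfl
  rw [mul_one] at h2
  rw [h2, h3, ← map_smul, ← sub_eq_zero, ← map_sub, h1]

theorem cyc_mode_zero (s : Set (Ulev k)) (a : Gen) (r : ℤ) (h : mode k a r ∈ s) :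
    (cyclic k s).act a r (cyc k s) = 0 := by
  have := cyc_mode s a r 0 (by simpa using h)
  simpa using this

/-- The universal property of a cyclic module, for homogeneous homomorphisms. -/
theorem cyclic_homog (s : Set (Ulev k)) (hs : ∀ x ∈ s, ∃ c : ℂ, parityAut k x = c • x)
    (A : AffMod k) (p : ℕ) (a : A.W) (hθ : A.θ a = ((-1 : ℂ) ^ p) • a)
    (ha : ∀ x ∈ s, A.toEnd x a = 0) :
    ∃ f : (cyclic k s).W →ₗ[ℂ] A.W, IsHomogHom (cyclic k s) A p f ∧ f (cyc k s) = a := by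
  let τ : Ulev k →ₗ[ℂ] Ulev k := (parityAut k).toLinearMap ^ p
  have hτ1 : τ 1 = 1 := by
    have : ∀ p : ℕ, ((parityAut k).toLinearMap ^ p) 1 = 1 := by
      intro p
      induction p with
      | zero => rfl
      | succ p ih => rw [pow_succ', Module.End.mul_apply, ih]; exact map_one (parityAut k)
    exact this p
  have hττ : ∀ x, τ (parityAut k x) = parityAut k (τ x) := by
    intro x
    exact LinearMap.congr_fun (Commute.self_pow (parityAut k).toLinearMap p).eq.symm x
  have hτm : ∀ a r x, τ (mode k a r * x) = ((-1 : ℂ) ^ (par a * p)) • (mode k a r * τ x) := by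
    intro a r x
    have : ∀ p : ℕ, ((parityAut k).toLinearMap ^ p) (mode k a r * x) =
        ((-1 : ℂ) ^ (par a * p)) • (mode k a r * ((parityAut k).toLinearMap ^ p) x) := by
      intro p
      induction p with
      | zero => simp
      | succ p ih =>
        rw [pow_succ', Module.End.mul_apply, ih, map_smul]
        simp only [AlgHom.toLinearMap_apply, map_mul, parityAut_mode, smul_mul_assoc, smul_smul,
          Module.End.mul_apply]
        congr 1
        ring
    exact this p
  have hτs : ∀ x ∈ s, ∃ c : ℂ, τ x = c • x := by
    intro x hx
    obtain ⟨c, hc⟩ := hs x hx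
    have : ∀ p : ℕ, ((parityAut k).toLinearMap ^ p) x = c ^ p • x := by
      intro p
      induction p with
      | zero => simp
      | succ p ih =>
        rw [pow_succ', Module.End.mul_apply, ih, map_smul, AlgHom.toLinearMap_apply, hc, smul_smul,
          pow_succ]
    exact ⟨_, this p⟩
  let F : Ulev k →ₗ[ℂ] A.W := (LinearMap.applyₗ a) ∘ₗ A.toEnd.toLinearMap ∘ₗ τ
  have hF : ∀ x, F x = A.toEnd (τ x) a := fun x => rfl
  have hFact : ∀ b r x, A.act b r (F x) = ((-1 : ℂ) ^ (par b * p)) • F (mode k b r * x) := by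
    intro b r x
    rw [hF, hF, hτm, map_smul, map_mul, LinearMap.smul_apply, Module.End.mul_apply, toEnd_mode,
      smul_smul, ← mul_pow]
    simp
  have hFθ : ∀ x, A.θ (F x) = ((-1 : ℂ) ^ p) • F (parityAut k x) := by
    intro x
    rw [hF, hF, θ_toEnd, hθ, map_smul, hττ]
  have hneg : ∀ n : ℕ, ((-1 : ℂ) ^ n) ≠ 0 := fun n => pow_ne_zero _ (by norm_num)
  have hk1 : ∀ b r x, F x = 0 → F (mode k b r * x) = 0 := by
    intro b r x hx
    have h1 := hFact b r x
    rw [hx, map_zero] at h1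
    exact (smul_eq_zero.1 h1.symm).resolve_left (hneg _)
  have hk2 : ∀ x, F x = 0 → F (parityAut k x) = 0 := by
    intro x hx
    have h1 := hFθ x
    rw [hx, map_zero] at h1
    exact (smul_eq_zero.1 h1.symm).resolve_left (hneg _)
  have hk3 : ∀ x ∈ s, F x = 0 := by
    intro x hx
    obtain ⟨c, hc⟩ := hτs x hx
    rw [hF, hc, map_smul, LinearMap.smul_apply, ha x hx, smul_zero]
  have hker : ((regular k).generated s).1 ≤ LinearMap.ker F := by
    refine generated_le (regular k) s _ ⟨fun b r x hx => ?_, fun x hx => ?_⟩ fun x hx => ?_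
    · exact hk1 b r x hx
    · exact hk2 x hx
    · exact hk3 x hx
  refine ⟨((regular k).generated s).1.liftQ F hker, ⟨fun w => ?_, fun b r w => ?_⟩, ?_⟩
  · obtain ⟨x, rfl⟩ := ((regular k).generated s).1.mkQ_surjective w
    exact hFθ x
  · obtain ⟨x, rfl⟩ := ((regular k).generated s).1.mkQ_surjective w
    exact hFact b r x
  · change F 1 = a
    rw [hF, hτ1, map_one]
    rfl

/-- The universal property of a cyclic module. -/
theorem cyclic_hom (s : Set (Ulev k)) (hs : ∀ x ∈ s, ∃ c : ℂ, parityAut k x = c • x)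
    (A : AffMod k) (a : A.W) (ha : ∀ x ∈ s, A.toEnd x a = 0) :
    ∃ f : (cyclic k s).W →ₗ[ℂ] A.W, IsHom (cyclic k s) A f ∧ f (cyc k s) = a := by
  have hθa : ∀ x ∈ s, A.toEnd x (A.θ a) = 0 := by
    intro x hx
    obtain ⟨c, hc⟩ := hs x hx
    have h1 : parityAut k (parityAut k x) = x := AlgHom.congr_fun (parityAut_sq k) x
    have h2 := θ_toEnd A (parityAut k x) a
    rw [h1, hc, map_smul, LinearMap.smul_apply, ha x hx, smul_zero, map_zero] at h2
    exact h2.symm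
  obtain ⟨f₀, h0, e0⟩ := cyclic_homog s hs A 0 ((1 / 2 : ℂ) • (a + A.θ a))
    (by rw [map_smul, map_add, θ_θ]; module)
    (fun x hx => by rw [map_smul, map_add, ha x hx, hθa x hx]; simp)
  obtain ⟨f₁, h1, e1⟩ := cyclic_homog s hs A 1 ((1 / 2 : ℂ) • (a - A.θ a))
    (by rw [map_smul, map_sub, θ_θ]; module)
    (fun x hx => by rw [map_smul, map_sub, ha x hx, hθa x hx]; simp)
  refine ⟨f₀ + f₁, ⟨f₀, f₁, h0, h1, rfl⟩, ?_⟩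
  rw [LinearMap.add_apply, e0, e1]
  module

theorem homog_mode (a : Gen) (r : ℤ) : ∃ c : ℂ, parityAut k (mode k a r) = c • mode k a r :=
  ⟨_, parityAut_mode k a r⟩

theorem homog_mode_sub (a : Gen) (ha : par a = 0) (r : ℤ) (c : ℂ) :
    ∃ d : ℂ, parityAut k (mode k a r - c • 1) = d • (mode k a r - c • 1) :=
  ⟨1, by simp [parityAut_mode, ha]⟩

/-! ### The universal properties of the standard modules -/

/-- Even and odd vectors. -/
theorem exists_parity {M : AffMod k} {w : M.W} (hw : w ≠ 0) {c : ℂ} (h : M.θ w = c • w) :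
    ∃ p : ℕ, M.θ w = ((-1 : ℂ) ^ p) • w := by
  have h1 : (c * c - 1) • w = 0 := by
    rw [sub_smul, mul_smul, ← h, ← map_smul, ← h, θ_θ, one_smul, sub_self]
  have h2 := (smul_eq_zero.1 h1).resolve_right hw
  have h3 : (c - 1) * (c + 1) = 0 := by linear_combination h2
  rcases mul_eq_zero.1 h3 with h3 | h3
  · exact ⟨0, by rw [h, sub_eq_zero.1 h3]; simp⟩
  · exact ⟨1, by rw [h, eq_neg_of_add_eq_zero_left h3]; simp⟩

/-- The highest-weight vector of `V_{n,e}^`. -/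
def vtop (k n e : ℂ) : (Vhat k n e).W := cyc k _

theorem vtop_pos (n e : ℂ) (a : Gen) (r : ℤ) (hr : 0 < r) :
    (Vhat k n e).act a r (vtop k n e) = 0 := cyc_mode_zero _ a r (Or.inl ⟨a, r, hr, rfl⟩)

theorem vtop_psiP (n e : ℂ) : (Vhat k n e).act psiP 0 (vtop k n e) = 0 :=
  cyc_mode_zero _ psiP 0 (Or.inr (by simp))

theorem vtop_N (n e : ℂ) : (Vhat k n e).act N 0 (vtop k n e) = (n + 1 / 2) • vtop k n e :=
  cyc_mode _ N 0 _ (Or.inr (by simp))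

theorem vtop_isGen (n e : ℂ) : (Vhat k n e).IsGen (n + 1 / 2) e 1 (vtop k n e) where
  gen := cyc_generated _
  θ := by rw [one_smul]; exact cyc_θ _
  N0 := vtop_N n e
  E0 := cyc_mode _ E 0 _ (Or.inr (by simp))
  Nr r hr := vtop_pos n e N r hr
  Er r hr := vtop_pos n e E r hr
  bd := ⟨1, fun a r hr => vtop_pos n e a r (by omega)⟩

theorem toEnd_pos {A : AffMod k} {a : A.W} (hpos : ∀ b (r : ℤ), 0 < r → A.act b r a = 0)
    (x : Ulev k) (hx : x ∈ posModes k) : A.toEnd x a = 0 := by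
  obtain ⟨b, r, hr, rfl⟩ := hx
  rw [toEnd_mode, hpos b r hr]

theorem toEnd_sub {A : AffMod k} {a : A.W} {b : Gen} {r : ℤ} {c : ℂ} (h : A.act b r a = c • a) :
    A.toEnd (mode k b r - c • 1) a = 0 := by
  rw [map_sub, toEnd_mode, map_smul, map_one, LinearMap.sub_apply, h]
  simp

theorem homog_pos (x : Ulev k) (hx : x ∈ posModes k) : ∃ c : ℂ, parityAut k x = c • x := by
  obtain ⟨b, r, -, rfl⟩ := hx
  exact homog_mode b r

theorem vtop_homog (n e : ℂ) (A : AffMod k) (p : ℕ) (a : A.W) (hθ : A.θ a = ((-1 : ℂ) ^ p) • a)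
    (hpos : ∀ b (r : ℤ), 0 < r → A.act b r a = 0) (hP : A.act psiP 0 a = 0)
    (hN : A.act N 0 a = (n + 1 / 2) • a) (hE : A.act E 0 a = e • a) :
    ∃ f : (Vhat k n e).W →ₗ[ℂ] A.W, IsHomogHom (Vhat k n e) A p f ∧ f (vtop k n e) = a := by
  refine cyclic_homog _ ?_ A p a hθ ?_
  · rintro x (hx | rfl | rfl | rfl)
    · exact homog_pos x hx
    · exact homog_mode psiP 0
    · exact homog_mode_sub N rfl 0 _
    · exact homog_mode_sub E rfl 0 _
  · rintro x (hx | rfl | rfl | rfl)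
    · exact toEnd_pos hpos x hx
    · rw [toEnd_mode, hP]
    · exact toEnd_sub hN
    · exact toEnd_sub hE

theorem vtop_hom (n e : ℂ) (A : AffMod k) (a : A.W)
    (hpos : ∀ b (r : ℤ), 0 < r → A.act b r a = 0) (hP : A.act psiP 0 a = 0)
    (hN : A.act N 0 a = (n + 1 / 2) • a) (hE : A.act E 0 a = e • a) :
    ∃ f : (Vhat k n e).W →ₗ[ℂ] A.W, IsHom (Vhat k n e) A f ∧ f (vtop k n e) = a := by
  refine cyclic_hom _ ?_ A a ?_
  · rintro x (hx | rfl | rfl | rfl)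
    · exact homog_pos x hx
    · exact homog_mode psiP 0
    · exact homog_mode_sub N rfl 0 _
    · exact homog_mode_sub E rfl 0 _
  · rintro x (hx | rfl | rfl | rfl)
    · exact toEnd_pos hpos x hx
    · rw [toEnd_mode, hP]
    · exact toEnd_sub hN
    · exact toEnd_sub hE

/-- The generator of the module induced from `A_n`. -/
def atop (k n : ℂ) : (AhatZero k n).W := cyc k _

theorem atop_pos (n : ℂ) (a : Gen) (r : ℤ) (hr : 0 < r) :
    (AhatZero k n).act a r (atop k n) = 0 := cyc_mode_zero _ a r (Or.inl ⟨a, r, hr, rfl⟩)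

theorem atop_psiP (n : ℂ) : (AhatZero k n).act psiP 0 (atop k n) = 0 :=
  cyc_mode_zero _ psiP 0 (Or.inr (by simp))

theorem atop_psiM (n : ℂ) : (AhatZero k n).act psiM 0 (atop k n) = 0 :=
  cyc_mode_zero _ psiM 0 (Or.inr (by simp))

theorem atop_isGen (n : ℂ) : (AhatZero k n).IsGen n 0 1 (atop k n) where
  gen := cyc_generated _
  θ := by rw [one_smul]; exact cyc_θ _
  N0 := cyc_mode _ N 0 _ (Or.inr (by simp))
  E0 := by rw [zero_smul]; exact cyc_mode_zero _ E 0 (Or.inr (by simp))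
  Nr r hr := atop_pos n N r hr
  Er r hr := atop_pos n E r hr
  bd := ⟨1, fun a r hr => atop_pos n a r (by omega)⟩

theorem atop_hom (n : ℂ) (A : AffMod k) (a : A.W)
    (hpos : ∀ b (r : ℤ), 0 < r → A.act b r a = 0) (hP : A.act psiP 0 a = 0)
    (hM : A.act psiM 0 a = 0) (hN : A.act N 0 a = n • a) (hE : A.act E 0 a = 0) :
    ∃ f : (AhatZero k n).W →ₗ[ℂ] A.W, IsHom (AhatZero k n) A f ∧ f (atop k n) = a := by
  refine cyclic_hom _ ?_ A a ?_
  · rintro x (hx | rfl | rfl | rfl | rfl)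
    · exact homog_pos x hx
    · exact homog_mode psiP 0
    · exact homog_mode psiM 0
    · exact homog_mode_sub N rfl 0 _
    · exact homog_mode E 0
  · rintro x (hx | rfl | rfl | rfl | rfl)
    · exact toEnd_pos hpos x hx
    · rw [toEnd_mode, hP]
    · rw [toEnd_mode, hM]
    · exact toEnd_sub hN
    · rw [toEnd_mode, hE]

/-- The generator of the module induced from `P_n`. -/
def ptop (k n : ℂ) : (PhatZero k n).W := cyc k _

theorem ptop_pos (n : ℂ) (a : Gen) (r : ℤ) (hr : 0 < r) :
    (PhatZero k n).act a r (ptop k n) = 0 := cyc_mode_zero _ a r (Or.inl ⟨a, r, hr, rfl⟩)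

theorem ptop_isGen (n : ℂ) : (PhatZero k n).IsGen n 0 1 (ptop k n) where
  gen := cyc_generated _
  θ := by rw [one_smul]; exact cyc_θ _
  N0 := cyc_mode _ N 0 _ (Or.inr (by simp))
  E0 := by rw [zero_smul]; exact cyc_mode_zero _ E 0 (Or.inr (by simp))
  Nr r hr := ptop_pos n N r hr
  Er r hr := ptop_pos n E r hr
  bd := ⟨1, fun a r hr => ptop_pos n a r (by omega)⟩

theorem ptop_hom (n : ℂ) (A : AffMod k) (a : A.W)
    (hpos : ∀ b (r : ℤ), 0 < r → A.act b r a = 0)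
    (hN : A.act N 0 a = n • a) (hE : A.act E 0 a = 0) :
    ∃ f : (PhatZero k n).W →ₗ[ℂ] A.W, IsHom (PhatZero k n) A f ∧ f (ptop k n) = a := by
  refine cyclic_hom _ ?_ A a ?_
  · rintro x (hx | rfl | rfl)
    · exact homog_pos x hx
    · exact homog_mode_sub N rfl 0 _
    · exact homog_mode E 0
  · rintro x (hx | rfl | rfl)
    · exact toEnd_pos hpos x hx
    · exact toEnd_sub hN
    · rw [toEnd_mode, hE]

namespace AffMod

variable {M M' A B : AffMod k}

/-! ### Spectral flow and conjugation of homomorphisms -/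

theorem IsGraded.flow {X : Submodule ℂ M.W} (h : M.IsGraded X) (l : ℤ) : (M.flow l).IsGraded X := by
  refine ⟨fun a r w hw => ?_, h.2⟩
  cases a
  · exact h.1 N r hw
  · exact X.add_mem (h.1 E r hw) (X.smul_mem _ hw)
  · exact h.1 psiP _ hw
  · exact h.1 psiM _ hw

theorem IsGraded.of_flow {X : Submodule ℂ M.W} {l : ℤ} (h : (M.flow l).IsGraded X) :
    M.IsGraded X := by
  refine ⟨fun a r (w : M.W) hw => ?_, h.2⟩
  cases a
  · exact h.1 N r hw
  · have h1 : ∀ w : M.W, w ∈ X →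
        M.act E r w + (if r = 0 then (l : ℂ) * k else 0) • w ∈ X := fun w hw => h.1 E r hw
    exact (X.add_mem_iff_left (X.smul_mem _ hw)).1 (h1 w hw)
  · have h1 : (M.flow l).act psiP (r - l) w ∈ X := h.1 psiP (r - l) hw
    have h2 : (M.flow l).act psiP (r - l) w = M.act psiP (r - l + l) w := rfl
    rw [h2, sub_add_cancel] at h1
    exact h1
  · have h1 : (M.flow l).act psiM (r + l) w ∈ X := h.1 psiM (r + l) hw
    have h2 : (M.flow l).act psiM (r + l) w = M.act psiM (r + l - l) w := rfl
    rw [h2, add_sub_cancel_right] at h1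
    exact h1

theorem generated_flow (M : AffMod k) (l : ℤ) (s : Set M.W) :
    ((M.flow l).generated s).1 = (M.generated s).1 :=
  le_antisymm (generated_le (M.flow l) s _ ((M.generated s).2.flow l) (M.subset_generated s))
    (generated_le M s _ ((M.flow l).generated s).2.of_flow ((M.flow l).subset_generated s))

theorem IsHomogHom.flow {p : ℕ} {f : M.W →ₗ[ℂ] M'.W} (hf : IsHomogHom M M' p f) (l : ℤ) :
    IsHomogHom (M.flow l) (M'.flow l) p f := by
  refine ⟨hf.1, fun a r (w : M.W) => ?_⟩
  cases a
  · exact hf.2 N r w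
  · have h1 := hf.2 E r w
    change M'.act E r (f w) + (if r = 0 then (l : ℂ) * k else 0) • f w =
      ((-1 : ℂ) ^ (par E * p)) • f (M.act E r w + (if r = 0 then (l : ℂ) * k else 0) • w)
    rw [h1, map_add, map_smul]
    simp [par]
  · exact hf.2 psiP _ w
  · exact hf.2 psiM _ w

theorem IsHom.flow {f : M.W →ₗ[ℂ] M'.W} (hf : IsHom M M' f) (l : ℤ) :
    IsHom (M.flow l) (M'.flow l) f := by
  obtain ⟨f₀, f₁, h0, h1, rfl⟩ := hf
  exact ⟨f₀, f₁, h0.flow l, h1.flow l, rfl⟩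

/-- Extensionality for modules on types that are only propositionally equal. -/
theorem ext_act {M M' : AffMod k} (hW : M.W = M'.W) (h1 : HEq M.acg M'.acg) (h2 : HEq M.mod M'.mod)
    (h3 : HEq M.act M'.act) (h4 : HEq M.θ M'.θ) : M = M' := by
  obtain ⟨W, act, θ, _, _, _⟩ := M
  obtain ⟨W', act', θ', _, _, _⟩ := M'
  dsimp only at hW h1 h2 h3 h4
  subst hW
  cases h1
  cases h2
  cases h3
  cases h4
  rfl

theorem flow_zero (M : AffMod k) : M.flow 0 = M := by
  refine ext_act rfl HEq.rfl HEq.rfl (heq_of_eq ?_) HEq.rfl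
  funext a r
  cases a
  · rfl
  · change M.act E r + (if r = 0 then ((0 : ℤ) : ℂ) * k else 0) • (1 : Module.End ℂ M.W) = M.act E r
    simp
  · change M.act psiP (r + 0) = _
    rw [add_zero]
  · change M.act psiM (r - 0) = _
    rw [sub_zero]

theorem IsGraded.of_conj {X : Submodule ℂ M.W} (h : M.conj.IsGraded X) : M.IsGraded X := by
  refine ⟨fun a r w hw => ?_, h.2⟩
  cases a
  · have h1 : M.conj.act N r w ∈ X := h.1 N r hw
    exact X.neg_mem_iff.1 h1
  · have h1 : M.conj.act E r w ∈ X := h.1 E r hw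
    exact X.neg_mem_iff.1 h1
  · exact h.1 psiM r hw
  · have h1 : M.conj.act psiP r w ∈ X := h.1 psiP r hw
    exact X.neg_mem_iff.1 h1

theorem IsIrreducible.flow (h : M.IsIrreducible) (l : ℤ) : (M.flow l).IsIrreducible :=
  ⟨h.1, fun X hX => h.2 X hX.of_flow⟩

theorem HasLength.flow {n : ℕ} (h : M.HasLength n) (l : ℤ) : (M.flow l).HasLength n := by
  obtain ⟨F, h0, h1, h2⟩ := h
  refine ⟨fun i => ⟨(F i).1, (F i).2.flow l⟩, h0, h1, fun i hi => ⟨(h2 i hi).1, ?_⟩⟩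
  rintro ⟨X, hX⟩ a b
  exact (h2 i hi).2 (c := ⟨X, hX.of_flow⟩) a b

theorem IsGen.flow {n e c : ℂ} {u : M.W} (hu : M.IsGen n e c u) (l : ℤ) :
    (M.flow l).IsGen n (e + l * k) c u where
  gen := (generated_flow M l {u}).trans hu.gen
  θ := hu.θ
  N0 := hu.N0
  E0 := by
    have h : (M.flow l).act E 0 u = M.act E 0 u + ((l : ℂ) * k) • u := flow_E_zero M l u
    refine h.trans ?_
    rw [hu.E0]
    exact (add_smul _ _ _).symm
  Nr := hu.Nr
  Er r hr := by rw [flow_E _ _ _ hr.ne']; exact hu.Er r hr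
  bd := hu.nice.flow l |>.smooth u

end AffMod

end

end AffGL
namespace AffGL

open Gen AffMod

noncomputable section

/-! ### Defects of the affine relations -/

section Defect

variable {k : ℂ} {V V' : Type} [AddCommGroup V] [Module ℂ V] [AddCommGroup V'] [Module ℂ V']

/-- The failure of the affine relation between `a_r` and `b_s` for a family of operators. -/
def defect (k : ℂ) (X : Gen → ℤ → Module.End ℂ V) (a b : Gen) (r s : ℤ) : Module.End ℂ V :=
  X a r * X b s - sgn a b • (X b s * X a r) -
    ((∑ c, bracket a b c • X c (r + s)) + central k a b r s • (1 : Module.End ℂ V))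

theorem defect_apply (X : Gen → ℤ → Module.End ℂ V) (a b : Gen) (r s : ℤ) (w : V) :
    defect k X a b r s w = X a r (X b s w) - sgn a b • X b s (X a r w) -
      (bracket a b N • X N (r + s) w + (bracket a b E • X E (r + s) w +
        (bracket a b psiP • X psiP (r + s) w + bracket a b psiM • X psiM (r + s) w)) +
      central k a b r s • w) := by
  simp only [defect, LinearMap.sub_apply, LinearMap.add_apply, LinearMap.smul_apply,
    Module.End.mul_apply, Module.End.one_apply, LinearMap.sum_apply]
  rw [sum_gen]

theorem defect_swap (X : Gen → ℤ → Module.End ℂ V) (a b : Gen) (r s : ℤ) (w : V) :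
    defect k X a b r s w = -sgn a b • defect k X b a s r w := by
  have e : r + s = 0 → s + r = 0 := fun h => by omega
  have e' : r + s ≠ 0 → s + r ≠ 0 := fun h => by omega
  have e2 : r + s = 0 → (s : ℂ) = -r := fun h => by
    rw [show s = -r by omega]; push_cast; ring
  by_cases h : r + s = 0 <;> cases a <;> cases b <;>
    simp [defect_apply, bracket, sgn, par, central, kappa, h, add_comm s r, e2] <;> abel

/-- The commutation relations with `N_q`. -/
theorem N_comm {X : Gen → ℤ → Module.End ℂ V} {q : ℤ}
    (hN : ∀ b s w, defect k X N b q s w = 0) (b : Gen) (s : ℤ) (w : V) :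
    X N q (X b s w) = X b s (X N q w) + (chg b : ℂ) • X b (s + q) w
      + central k N b q s • w := by
  have h := hN b s w
  rw [defect_apply] at h
  have h2 := sub_eq_zero.1 h
  rw [sub_eq_iff_eq_add] at h2
  rw [h2]
  cases b <;> simp [bracket, sgn, par, chg, central, kappa, add_comm s q, add_comm]

/-- `N_q` acts on defects as a derivation.  Hence the relations among the modes other than `N_q`
propagate from generating vectors along the action of the `N_q`. -/
theorem N_defect {X : Gen → ℤ → Module.End ℂ V} {q : ℤ}
    (hN : ∀ b s w, defect k X N b q s w = 0) {a b : Gen} (ha : a ≠ N) (hb : b ≠ N) (r s : ℤ)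
    (w : V) :
    X N q (defect k X a b r s w) = defect k X a b r s (X N q w) +
      (chg a : ℂ) • defect k X a b (r + q) s w + (chg b : ℂ) • defect k X a b r (s + q) w := by
  have h := N_comm hN
  have e1 : r + q + s = r + s + q := by ring
  have e2 : r + (s + q) = r + s + q := by ring
  have e3 : q + (r + s) = r + s + q := by ring
  have e4 : q + r = r + q := by ring
  have e5 : q + s = s + q := by ring
  cases a <;> cases b <;> first | exact absurd rfl ha | exact absurd rfl hb | skip
  all_goals
    simp only [defect_apply, bracket, sgn, par, chg, h, map_zero, map_neg, map_add, map_sub, map_smul, zero_smul,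
      one_smul, central, kappa, e1, e2, e3, e4, e5, zero_add, add_zero, Int.cast_zero,
      Int.cast_one, Int.cast_neg, neg_smul, zero_mul, one_mul, mul_zero, pow_zero, pow_one, mul_one,
      ite_self, Int.cast_add]
  all_goals by_cases h0 : r + s + q = 0
  all_goals try simp only [h0, ↓reduceIte]
  all_goals module

/-- Defects are natural under maps that commute with the operators other than `N_r`. -/
theorem map_defect {X : Gen → ℤ → Module.End ℂ V} {X' : Gen → ℤ → Module.End ℂ V'} (T : V →ₗ[ℂ] V')
    (hT : ∀ a r w, a ≠ N → T (X a r w) = X' a r (T w)) {a b : Gen} (ha : a ≠ N) (hb : b ≠ N)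
    (r s : ℤ) (w : V) : T (defect k X a b r s w) = defect k X' a b r s (T w) := by
  have h1 : bracket a b N = 0 := by cases a <;> cases b <;> rfl
  have hE := fun r w => hT E r w (by decide)
  have hP := fun r w => hT psiP r w (by decide)
  have hM := fun r w => hT psiM r w (by decide)
  simp only [defect_apply, map_sub, map_add, map_smul, hT a _ _ ha, hT b _ _ hb, h1, zero_smul,
    hE, hP, hM, map_zero]

/-- A level-`k` module from its operators; the relations between `a_r` and `b_s` are only needed for
`a = N` and for `a, b ≠ N`. -/
def AffMod.mk' {W : Type} [AddCommGroup W] [Module ℂ W] (X : Gen → ℤ → Module.End ℂ W)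
    (θ : Module.End ℂ W) (h1 : ∀ w, θ (θ w) = w)
    (h2 : ∀ a r w, θ (X a r w) = ((-1 : ℂ) ^ par a) • X a r (θ w))
    (hN : ∀ b q s w, defect k X N b q s w = 0)
    (h : ∀ a b, a ≠ N → b ≠ N → ∀ r s w, defect k X a b r s w = 0) : AffMod k where
  W := W
  act := X
  θ := θ
  θ_sq := LinearMap.ext h1
  θ_act a r := LinearMap.ext fun w => by simpa using h2 a r w
  rel a b r s := by
    have key : defect k X a b r s = 0 := by
      ext w
      by_cases ha : a = N
      · subst ha
        exact hN b r s w
      by_cases hb : b = N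
      · subst hb
        rw [defect_swap, hN a s r w, smul_zero]
        rfl
      · exact h a b ha hb r s w
    exact sub_eq_zero.1 key

theorem AffMod.defect_eq_zero (M : AffMod k) (a b : Gen) (r s : ℤ) (w : M.W) :
    defect k M.act a b r s w = 0 :=
  LinearMap.congr_fun (sub_eq_zero.2 (M.rel a b r s) : defect k M.act a b r s = 0) w

end Defect

/-! ### Shifts of polynomials by powers of a formal variable -/

section Shift

open MvPolynomial

variable {σ : Type} {V V' : Type} [AddCommGroup V] [Module ℂ V] [AddCommGroup V'] [Module ℂ V']

/-- The linear map on Laurent polynomials that applies `g j` to the coefficient of `t^j`. -/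
def laurentSum (g : ℤ → (MvPolynomial σ ℂ →ₗ[ℂ] V)) :
    LaurentPolynomial (MvPolynomial σ ℂ) →ₗ[ℂ] V :=
  Finsupp.lsum ℂ g ∘ₗ (AddMonoidAlgebra.coeffLinearEquiv ℂ).toLinearMap

theorem laurentSum_C_mul_T (g : ℤ → (MvPolynomial σ ℂ →ₗ[ℂ] V)) (p : MvPolynomial σ ℂ) (n : ℤ) :
    laurentSum g (LaurentPolynomial.C p * LaurentPolynomial.T n) = g n p := by
  rw [← LaurentPolynomial.single_eq_C_mul_T]
  exact Finsupp.lsum_single ℂ g n p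

/-- The substitution `x_i ↦ x_i + c t^{d i}`. -/
def shiftHom (d : σ → ℤ) (c : ℂ) :
    MvPolynomial σ ℂ →ₐ[ℂ] LaurentPolynomial (MvPolynomial σ ℂ) :=
  aeval fun i => LaurentPolynomial.C (X i) + c • LaurentPolynomial.T (d i)

/-- The linear map `p ↦ ∑ j, g j p_j`, where `p_j` is the coefficient of `t^j` in
`p(x_i + c t^{d i})`. -/
def shiftSum (d : σ → ℤ) (c : ℂ) (g : ℤ → (MvPolynomial σ ℂ →ₗ[ℂ] V)) : MvPolynomial σ ℂ →ₗ[ℂ] V :=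
  laurentSum g ∘ₗ (shiftHom d c).toLinearMap

theorem shiftSum_one (d : σ → ℤ) (c : ℂ) (g : ℤ → (MvPolynomial σ ℂ →ₗ[ℂ] V)) :
    shiftSum d c g 1 = g 0 1 := by
  have h := laurentSum_C_mul_T g 1 0
  rw [LaurentPolynomial.T_zero, map_one, one_mul] at h
  rw [← h]
  exact congrArg (laurentSum g) (map_one (shiftHom d c))

theorem laurentSum_C_mul (g : ℤ → (MvPolynomial σ ℂ →ₗ[ℂ] V)) (p : MvPolynomial σ ℂ)
    (u : LaurentPolynomial (MvPolynomial σ ℂ)) :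
    laurentSum g (LaurentPolynomial.C p * u) =
      laurentSum (fun j => g j ∘ₗ LinearMap.mulLeft ℂ p) u := by
  induction u using LaurentPolynomial.induction_on' with
  | add u v hu hv => rw [mul_add, map_add, map_add, hu, hv]
  | C_mul_T n a =>
    rw [← mul_assoc, ← map_mul, laurentSum_C_mul_T, laurentSum_C_mul_T]
    rfl

theorem laurentSum_T_mul (g : ℤ → (MvPolynomial σ ℂ →ₗ[ℂ] V)) (m : ℤ)
    (u : LaurentPolynomial (MvPolynomial σ ℂ)) :
    laurentSum g (LaurentPolynomial.T m * u) = laurentSum (fun j => g (j + m)) u := by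
  induction u using LaurentPolynomial.induction_on' with
  | add u v hu hv => rw [mul_add, map_add, map_add, hu, hv]
  | C_mul_T n a =>
    rw [mul_left_comm, ← LaurentPolynomial.T_add, laurentSum_C_mul_T, laurentSum_C_mul_T,
      add_comm m n]

/-- Multiplication by `x_i` intertwines shifts with the relation `[N_q, ψ^±_s] = ± ψ^±_{s+q}`. -/
theorem shiftSum_X_mul (d : σ → ℤ) (c : ℂ) (g : ℤ → (MvPolynomial σ ℂ →ₗ[ℂ] V)) (i : σ)
    (p : MvPolynomial σ ℂ) :
    shiftSum d c g (X i * p) = shiftSum d c (fun j => g j ∘ₗ LinearMap.mulLeft ℂ (X i)) p +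
      c • shiftSum d c (fun j => g (j + d i)) p := by
  have h : shiftHom d c (X i * p) = LaurentPolynomial.C (X i) * shiftHom d c p +
      c • (LaurentPolynomial.T (d i) * shiftHom d c p) := by
    rw [map_mul, shiftHom, aeval_X, add_mul, smul_mul_assoc]
  change laurentSum g (shiftHom d c (X i * p)) = _
  rw [h, map_add, map_smul, laurentSum_C_mul, laurentSum_T_mul]
  rfl

theorem map_shiftSum (T : V →ₗ[ℂ] V') (d : σ → ℤ) (c : ℂ) (g : ℤ → (MvPolynomial σ ℂ →ₗ[ℂ] V))
    (p : MvPolynomial σ ℂ) : T (shiftSum d c g p) = shiftSum d c (fun j => T ∘ₗ g j) p := by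
  have key : ∀ u, T (laurentSum g u) = laurentSum (fun j => T ∘ₗ g j) u := by
    intro u
    induction u using LaurentPolynomial.induction_on' with
    | add u v hu hv => simp only [map_add, hu, hv]
    | C_mul_T n a => rw [laurentSum_C_mul_T, laurentSum_C_mul_T]; rfl
  exact key _

theorem shiftSum_add (d : σ → ℤ) (c : ℂ) (g g' : ℤ → (MvPolynomial σ ℂ →ₗ[ℂ] V)) :
    shiftSum d c (fun j => g j + g' j) = shiftSum d c g + shiftSum d c g' := by
  have h : laurentSum (fun j => g j + g' j) = laurentSum g + laurentSum g' := by
    have := map_add (Finsupp.lsum ℂ (α := ℤ) (M := MvPolynomial σ ℂ) (N := V) (σ := RingHom.id ℂ)) g g'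
    rw [laurentSum, show (fun j => g j + g' j) = g + g' from rfl, this]
    rfl
  rw [shiftSum, h]
  rfl

theorem shiftSum_smul (d : σ → ℤ) (c b : ℂ) (g : ℤ → (MvPolynomial σ ℂ →ₗ[ℂ] V)) :
    shiftSum d c (fun j => b • g j) = b • shiftSum d c g := by
  ext p
  exact (map_shiftSum (b • LinearMap.id) d c g _).symm

end Shift

/-! ### The fermions -/

section Fermion

/-- Exterior algebra on the negative odd modes (the index `true` stands for `ψ⁺`). -/
abbrev Fermi : Type := ExteriorAlgebra ℂ (Bool × ℤ →₀ ℂ)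

/-- The sum of an exterior multiplication and a contraction. -/
def fermiOp (v : Bool × ℤ →₀ ℂ) (d : Module.Dual ℂ (Bool × ℤ →₀ ℂ)) : Module.End ℂ Fermi :=
  LinearMap.mulLeft ℂ (CliffordAlgebra.ι 0 v) + CliffordAlgebra.contractLeft d

theorem fermiOp_apply (v : Bool × ℤ →₀ ℂ) (d : Module.Dual ℂ (Bool × ℤ →₀ ℂ)) (x : Fermi) :
    fermiOp v d x = CliffordAlgebra.ι 0 v * x + CliffordAlgebra.contractLeft d x := rfl

theorem fermiOp_anticomm (v v' : Bool × ℤ →₀ ℂ) (d d' : Module.Dual ℂ (Bool × ℤ →₀ ℂ)) (x : Fermi) :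
    fermiOp v d (fermiOp v' d' x) = - fermiOp v' d' (fermiOp v d x) + (d v' + d' v) • x := by
  have h : CliffordAlgebra.ι (0 : QuadraticForm ℂ (Bool × ℤ →₀ ℂ)) v * CliffordAlgebra.ι 0 v' =
      - (CliffordAlgebra.ι 0 v' * CliffordAlgebra.ι 0 v) := by
    rw [eq_neg_iff_add_eq_zero, CliffordAlgebra.ι_mul_ι_add_swap]
    simp [QuadraticMap.polar]
  simp only [fermiOp_apply, map_add, CliffordAlgebra.contractLeft_ι_mul, ← mul_assoc, h,
    CliffordAlgebra.contractLeft_comm (d := d) (d' := d')]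
  rw [neg_mul]
  module

theorem involute_fermiOp (v : Bool × ℤ →₀ ℂ) (d : Module.Dual ℂ (Bool × ℤ →₀ ℂ)) (x : Fermi) :
    CliffordAlgebra.involute (fermiOp v d x) = - fermiOp v d (CliffordAlgebra.involute x) := by
  have h : CliffordAlgebra.involute (CliffordAlgebra.contractLeft d x) =
      - CliffordAlgebra.contractLeft d (CliffordAlgebra.involute x) := by
    induction x using CliffordAlgebra.left_induction with
    | algebraMap r => simp
    | add x y hx hy => rw [map_add, map_add, hx, hy, map_add, map_add, neg_add]
    | ι_mul x m hx =>
      simp only [CliffordAlgebra.contractLeft_ι_mul, map_sub, map_smul, map_mul, hx,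
        CliffordAlgebra.involute_ι, neg_mul, map_neg]
      simp [sub_eq_add_neg]
  rw [fermiOp_apply, fermiOp_apply, map_add, map_mul, h, CliffordAlgebra.involute_ι]
  rw [neg_mul, neg_add]

/-- The action of the modes other than `N_r` on the fermionic Fock space, where `E_r` acts by
`e δ_{r,0}`.  The creation operators are the `ψ^±_r` with `r ≤ 0`; for the zero modes, the contraction
that produces `{ψ⁺_0, ψ⁻_0} = e` is carried by `ψ⁺_0`. -/
def fermiAct (k e : ℂ) : Gen → ℤ → Module.End ℂ Fermi
  | N, _ => 0
  | E, r => (if r = 0 then e else 0) • (1 : Module.End ℂ Fermi)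
  | psiP, r => fermiOp (if r ≤ 0 then Finsupp.single (true, r) 1 else 0)
      (if 0 ≤ r then (r * k + e) • Finsupp.lapply (false, -r) else 0)
  | psiM, r => fermiOp (if r ≤ 0 then Finsupp.single (false, r) 1 else 0)
      (if 0 < r then (-r * k + e) • Finsupp.lapply (true, -r) else 0)

/-- The exterior algebra is a module for the modes other than `N_r`, with central term `k`. -/
theorem fermi_defect (k e : ℂ) {a b : Gen} (ha : a ≠ N) (hb : b ≠ N) (r s : ℤ) (x : Fermi) :
    defect k (fermiAct k e) a b r s x = 0 := by
  have hPM : ∀ (r s : ℤ) (x : Fermi), fermiAct k e psiP r (fermiAct k e psiM s x) =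
      - fermiAct k e psiM s (fermiAct k e psiP r x) +
        (if r + s = 0 then r * k + e else 0) • x := by
    intro r s x
    simp only [fermiAct]
    rw [fermiOp_anticomm]
    congr 2
    by_cases h0 : r + s = 0
    · obtain rfl : s = -r := by omega
      rcases lt_trichotomy r 0 with hr | rfl | hr
      · simp [hr.le, not_le.2 hr, hr]
      · simp
      · simp [hr.le, not_le.2 hr, not_lt.2 hr.le]
    · have h1 : ¬ (s = -r) := by omega
      have h2 : ¬ (r = -s) := by omega
      rw [if_neg h0]
      split_ifs <;> simp [h1, h2]
  have hPP : ∀ (r s : ℤ) (x : Fermi), fermiAct k e psiP r (fermiAct k e psiP s x) =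
      - fermiAct k e psiP s (fermiAct k e psiP r x) := by
    intro r s x
    simp only [fermiAct]
    rw [fermiOp_anticomm]
    split_ifs <;> simp
  have hMM : ∀ (r s : ℤ) (x : Fermi), fermiAct k e psiM r (fermiAct k e psiM s x) =
      - fermiAct k e psiM s (fermiAct k e psiM r x) := by
    intro r s x
    simp only [fermiAct]
    rw [fermiOp_anticomm]
    split_ifs <;> simp
  have hE : ∀ (r : ℤ) (x : Fermi), fermiAct k e E r x = (if r = 0 then e else 0) • x :=
    fun r x => rfl
  have hMP : defect k (fermiAct k e) psiP psiM r s x = 0 := by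
    rw [defect_apply, hPM, hE]
    by_cases h0 : r + s = 0
    · simp [bracket, sgn, par, central, kappa, h0]
      module
    · simp [bracket, sgn, par, central, h0]
  cases a <;> cases b <;> first | exact absurd rfl ha | exact absurd rfl hb | skip
  · rw [defect_apply, hE, hE, hE, hE, smul_comm]
    simp [bracket, sgn, par, central, kappa]
  · rw [defect_apply, hE, hE, map_smul]
    simp [bracket, sgn, par, central, kappa]
  · rw [defect_apply, hE, hE, map_smul]
    simp [bracket, sgn, par, central, kappa]
  · rw [defect_apply, hE, hE, map_smul]
    simp [bracket, sgn, par, central, kappa]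
  · simp [defect_apply, hPP r s, bracket, sgn, par, central, kappa]
  · exact hMP
  · rw [defect_apply, hE, hE, map_smul]
    simp [bracket, sgn, par, central, kappa]
  · have h := defect_swap (k := k) (fermiAct k e) psiM psiP r s x
    rw [h, defect_apply, hPM, hE]
    by_cases h0 : s + r = 0
    · simp [bracket, sgn, par, central, kappa, h0]
      module
    · simp [bracket, sgn, par, central, h0]
  · simp [defect_apply, hMM r s, bracket, sgn, par, central, kappa]

end Fermion

end

end AffGL
namespace AffGL

open Gen AffMod

noncomputable section

/-! ### The free-field realization -/

section FreeField

open MvPolynomial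
open scoped TensorProduct

variable {k : ℂ}

/-- The defect of a relation with `N_q`, written out. -/
theorem defect_N {V : Type} [AddCommGroup V] [Module ℂ V] (X : Gen → ℤ → Module.End ℂ V) (b : Gen)
    (q s : ℤ) (w : V) : defect k X N b q s w = X N q (X b s w) -
      (X b s (X N q w) + (chg b : ℂ) • X b (s + q) w + central k N b q s • w) := by
  rw [defect_apply]
  cases b <;> simp [bracket, sgn, par, chg, add_comm s q] <;> abel

theorem involute_fermiAct (k e : ℂ) {a : Gen} (r : ℤ) (z : Fermi) :
    CliffordAlgebra.involute (fermiAct k e a r z) =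
      ((-1 : ℂ) ^ par a) • fermiAct k e a r (CliffordAlgebra.involute z) := by
  cases a
  · simp [fermiAct]
  · simp only [fermiAct, par, LinearMap.smul_apply, Module.End.one_apply, map_smul, pow_zero,
      one_smul]
  · simp [fermiAct, par, involute_fermiOp]
  · simp [fermiAct, par, involute_fermiOp]

/-- The odd modes on `ℂ[x_q : q ∈ ℤ] ⊗ Fermi`: a shift of the polynomial variables, coupled to the
index of a fermionic mode. -/
def indOdd (k e : ℂ) (a : Gen) (s : ℤ) : Module.End ℂ (MvPolynomial ℤ ℂ ⊗[ℂ] Fermi) :=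
  TensorProduct.lift (shiftSum (V := Fermi →ₗ[ℂ] MvPolynomial ℤ ℂ ⊗[ℂ] Fermi) id (-chg a) fun j =>
    (TensorProduct.mk ℂ (MvPolynomial ℤ ℂ) Fermi).compl₂ (fermiAct k e a (s + j)))

theorem indOdd_tmul (k e : ℂ) (a : Gen) (s : ℤ) (p : MvPolynomial ℤ ℂ) (z : Fermi) :
    indOdd k e a s (p ⊗ₜ z) = shiftSum id (-chg a) (fun j =>
      (TensorProduct.mk ℂ (MvPolynomial ℤ ℂ) Fermi).flip (fermiAct k e a (s + j) z)) p := by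
  rw [indOdd, TensorProduct.lift.tmul]
  exact map_shiftSum (LinearMap.applyₗ z) _ _ _ p

/-- The operators of the module induced from `Fermi`: `N_q` multiplies by `x_q`. -/
def indAct (k e : ℂ) : Gen → ℤ → Module.End ℂ (MvPolynomial ℤ ℂ ⊗[ℂ] Fermi)
  | N, q => (LinearMap.mulLeft ℂ (X q)).rTensor Fermi
  | E, m => (fermiAct k e E m).lTensor (MvPolynomial ℤ ℂ) +
      ((m : ℂ) * k) • ((pderiv (-m)).toLinearMap : Module.End ℂ (MvPolynomial ℤ ℂ)).rTensor Fermi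
  | psiP, s => indOdd k e psiP s
  | psiM, s => indOdd k e psiM s

theorem indAct_N_tmul (k e : ℂ) (q : ℤ) (p : MvPolynomial ℤ ℂ) (z : Fermi) :
    indAct k e N q (p ⊗ₜ z) = (X q * p) ⊗ₜ z := rfl

theorem indAct_E_tmul (k e : ℂ) (m : ℤ) (p : MvPolynomial ℤ ℂ) (z : Fermi) :
    indAct k e E m (p ⊗ₜ z) = p ⊗ₜ fermiAct k e E m z +
      ((m : ℂ) * k) • (pderiv (-m) p ⊗ₜ z) := rfl

theorem indOdd_N (k e : ℂ) (a : Gen) (q s : ℤ) (w : MvPolynomial ℤ ℂ ⊗[ℂ] Fermi) :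
    indAct k e N q (indOdd k e a s w) = indOdd k e a s (indAct k e N q w) +
      (chg a : ℂ) • indOdd k e a (s + q) w := by
  induction w with
  | zero => simp
  | add x y hx hy => simp only [map_add, hx, hy, smul_add]; abel
  | tmul p z =>
    rw [indAct_N_tmul, indOdd_tmul, indOdd_tmul, indOdd_tmul, shiftSum_X_mul, map_shiftSum]
    have h1 : ∀ j, indAct k e N q ∘ₗ (TensorProduct.mk ℂ (MvPolynomial ℤ ℂ) Fermi).flip
        (fermiAct k e a (s + j) z) = (TensorProduct.mk ℂ (MvPolynomial ℤ ℂ) Fermi).flip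
        (fermiAct k e a (s + j) z) ∘ₗ LinearMap.mulLeft ℂ (X q) := fun j => rfl
    have h2 : ∀ j, s + q + j = s + (j + id q) := fun j => by simp only [id]; ring
    simp only [h1, h2]
    module

theorem ind_defect_N (k e : ℂ) (b : Gen) (q s : ℤ) (w : MvPolynomial ℤ ℂ ⊗[ℂ] Fermi) :
    defect k (indAct k e) N b q s w = 0 := by
  rw [defect_N, sub_eq_zero]
  cases b
  · induction w with
    | zero => simp
    | add x y hx hy => simp only [map_add, hx, hy, smul_add]; abel
    | tmul p z =>
      simp only [indAct_N_tmul, chg, central, kappa, mul_left_comm (X q : MvPolynomial ℤ ℂ)]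
      simp
  · induction w with
    | zero => simp
    | add x y hx hy => simp only [map_add, hx, hy, smul_add]; abel
    | tmul p z =>
      simp only [indAct_N_tmul, indAct_E_tmul, map_add, map_smul, chg, central, kappa]
      by_cases h : q + s = 0
      · obtain rfl : s = -q := by omega
        simp [TensorProduct.add_tmul]
        module
      · rw [Derivation.leibniz, pderiv_X_of_ne (by omega)]
        simp [h]
  · rw [show central k N psiP q s = 0 by simp [central, kappa], zero_smul, add_zero]
    exact indOdd_N k e psiP q s w
  · rw [show central k N psiM q s = 0 by simp [central, kappa], zero_smul, add_zero]
    exact indOdd_N k e psiM q s w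

/-- The relations among the `E_r` and `ψ^±_r` hold on `1 ⊗ Fermi`, and propagate along
multiplication by the variables. -/
theorem ind_defect (k e : ℂ) {a b : Gen} (ha : a ≠ N) (hb : b ≠ N) (r s : ℤ)
    (w : MvPolynomial ℤ ℂ ⊗[ℂ] Fermi) : defect k (indAct k e) a b r s w = 0 := by
  induction w with
  | zero => simp
  | add x y hx hy => rw [map_add, hx, hy, add_zero]
  | tmul p z =>
    induction p using MvPolynomial.induction_on generalizing r s with
    | C c =>
      have h := map_defect (k := k) (X := fermiAct k e) (X' := indAct k e)
        (TensorProduct.mk ℂ (MvPolynomial ℤ ℂ) Fermi 1) (fun a r w ha => ?_) ha hb r s z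
      · rw [fermi_defect k e ha hb, map_zero] at h
        rw [show (C c : MvPolynomial ℤ ℂ) = c • 1 by rw [smul_eq_C_mul, mul_one],
          ← TensorProduct.smul_tmul', map_smul]
        exact smul_eq_zero_of_right _ h.symm
      · cases a
        · exact absurd rfl ha
        · rw [TensorProduct.mk_apply, TensorProduct.mk_apply, indAct_E_tmul, pderiv_one]
          simp
        · refine ((indOdd_tmul k e psiP r 1 w).trans ?_).symm
          rw [shiftSum_one, add_zero]
          rfl
        · refine ((indOdd_tmul k e psiM r 1 w).trans ?_).symm
          rw [shiftSum_one, add_zero]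
          rfl
    | add p q hp hq => rw [TensorProduct.add_tmul, map_add, hp, hq, add_zero]
    | mul_X p q hp =>
      rw [mul_comm, ← indAct_N_tmul k e]
      have h := N_defect (k := k) (X := indAct k e) (q := q) (fun b => ind_defect_N k e b q) ha hb
        r s (p ⊗ₜ z)
      rw [hp, hp, hp, map_zero, smul_zero, smul_zero, add_zero, add_zero] at h
      exact h.symm

/-- The module induced from `Fermi`, with all modes `N_q` acting freely. -/
def ind (k e : ℂ) : AffMod k :=
  AffMod.mk' (indAct k e) (CliffordAlgebra.involute.toLinearMap.lTensor (MvPolynomial ℤ ℂ))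
    (fun w => by
      induction w with
      | zero => simp
      | add x y hx hy => rw [map_add, map_add, hx, hy]
      | tmul p z => simp)
    (fun a r w => by
      induction w with
      | zero => simp
      | add x y hx hy => simp only [map_add, hx, hy, smul_add]
      | tmul p z =>
        have key : ∀ a, (CliffordAlgebra.involute.toLinearMap.lTensor (MvPolynomial ℤ ℂ))
            (indOdd k e a r (p ⊗ₜ z)) = ((-1 : ℂ) ^ par a) • indOdd k e a r
              ((CliffordAlgebra.involute.toLinearMap.lTensor (MvPolynomial ℤ ℂ)) (p ⊗ₜ z)) := by
          intro a
          rw [LinearMap.lTensor_tmul, indOdd_tmul, indOdd_tmul, map_shiftSum]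
          rw [← LinearMap.smul_apply, ← shiftSum_smul]
          congr 2
          ext j p
          simp [involute_fermiAct]
        cases a
        · simp [par, indAct_N_tmul]
        · simp [par, indAct_E_tmul, involute_fermiAct]
        · exact key psiP
        · exact key psiM)
    (ind_defect_N k e) (fun a b ha hb r s w => ind_defect k e ha hb r s w)

/-- The generator of the induced module. -/
def indVec (k e : ℂ) : (ind k e).W := (1 : MvPolynomial ℤ ℂ) ⊗ₜ[ℂ] (1 : Fermi)

theorem ind_pos (e : ℂ) {a : Gen} (ha : a ≠ N) (r : ℤ) (hr : 0 < r) :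
    (ind k e).act a r (indVec k e) = 0 := by
  have key : ∀ a, fermiAct k e a r 1 = 0 → indOdd k e a r (1 ⊗ₜ 1) = 0 := by
    intro a h
    rw [indOdd_tmul, shiftSum_one, add_zero, h, map_zero, LinearMap.zero_apply]
  cases a
  · exact absurd rfl ha
  · refine (indAct_E_tmul k e r 1 1).trans ?_
    rw [pderiv_one]
    simp only [fermiAct, if_neg hr.ne', zero_smul, LinearMap.zero_apply, TensorProduct.tmul_zero,
      TensorProduct.zero_tmul, smul_zero, add_zero]
    rfl
  · exact key psiP (by simp [fermiAct, fermiOp_apply, hr.le, not_le.2 hr])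
  · exact key psiM (by simp [fermiAct, fermiOp_apply, hr, not_le.2 hr])

theorem ind_E0 (e : ℂ) : (ind k e).act E 0 (indVec k e) =
    e • indVec k e := by
  refine (indAct_E_tmul k e 0 1 1).trans ?_
  simp [fermiAct]
  rfl

/-- `ψ⁺_0 ψ⁻_0` creates `ψ⁺ ∧ ψ⁻` on the generator; two contractions recover the scalar `1`. -/
theorem ind_psiP_psiM (e : ℂ) : (ind k e).act psiP 0 ((ind k e).act psiM 0
    (indVec k e)) ≠ 0 := by
  have h : ∀ a z, indOdd k e a 0 (1 ⊗ₜ z) = 1 ⊗ₜ fermiAct k e a 0 z := by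
    intro a z
    rw [indOdd_tmul, shiftSum_one, add_zero]
    rfl
  have h2 : (ind k e).act psiP 0 ((ind k e).act psiM 0 (indVec k e)) =
      (1 : MvPolynomial ℤ ℂ) ⊗ₜ[ℂ] fermiAct k e psiP 0 (fermiAct k e psiM 0 1) :=
    (congrArg (indOdd k e psiP 0) (h psiM 1)).trans (h psiP _)
  rw [h2]
  intro h0
  obtain ⟨T, hT⟩ : ∃ T : MvPolynomial ℤ ℂ ⊗[ℂ] Fermi →ₗ[ℂ] Fermi, ∀ z, T (1 ⊗ₜ z) = z :=
    ⟨(TensorProduct.lid ℂ Fermi).toLinearMap ∘ₗ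
      ((aeval (R := ℂ) fun _ : ℤ => (0 : ℂ)).toLinearMap.rTensor Fermi), fun z => by simp⟩
  have h1 := congrArg T h0
  rw [hT] at h1
  replace h1 := h1.trans (map_zero T)
  simp [fermiAct, fermiOp_apply] at h1
  have h3 := congrArg (fun x => CliffordAlgebra.contractLeft
    (Finsupp.lapply (R := ℂ) ((false, 0) : Bool × ℤ)) (CliffordAlgebra.contractLeft
    (Finsupp.lapply (R := ℂ) ((true, 0) : Bool × ℤ)) x)) h1
  simp [CliffordAlgebra.contractLeft_ι_mul, Algebra.algebraMap_eq_smul_one] at h3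

/-- The derivation `∂ / ∂x_{-m}` of `ℂ[x_0, x_1, …]`, which is zero for `m > 0`. -/
def dneg (m : ℤ) : Module.End ℂ (MvPolynomial ℕ ℂ) :=
  if m ≤ 0 then (pderiv (-m).toNat).toLinearMap else 0

theorem dneg_one (m : ℤ) : dneg m 1 = 0 := by
  rw [dneg]
  split_ifs <;> simp

theorem dneg_X_mul (m : ℤ) (i : ℕ) (p : MvPolynomial ℕ ℂ) :
    dneg m (X i * p) = X i * dneg m p + if i + m = 0 then p else 0 := by
  rw [dneg]
  split_ifs with h1 h2 h2
  · obtain rfl : i = (-m).toNat := by omega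
    simp
  · simp [pderiv_X_of_ne (R := ℂ) (show i ≠ (-m).toNat by omega)]
  · omega
  · simp

/-- The odd modes on the coinduced module. -/
def coindOdd (M : AffMod k) (a : Gen) (s : ℤ) : Module.End ℂ (MvPolynomial ℕ ℂ →ₗ[ℂ] M.W) where
  toFun f := shiftSum (fun i : ℕ => (i : ℤ)) (chg a) fun j => M.act a (s + j) ∘ₗ f
  map_add' f g := by
    rw [← shiftSum_add]
    simp only [LinearMap.comp_add]
  map_smul' c f := by
    rw [RingHom.id_apply, ← shiftSum_smul]
    simp only [LinearMap.comp_smul]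

theorem coindOdd_apply (M : AffMod k) (a : Gen) (s : ℤ) (f : MvPolynomial ℕ ℂ →ₗ[ℂ] M.W) :
    coindOdd M a s f = shiftSum (fun i : ℕ => (i : ℤ)) (chg a) fun j => M.act a (s + j) ∘ₗ f := rfl

/-- The operators of the module coinduced from the restriction of `M` to the modes other than
`N_q`, `q ≥ 0`: these act on functionals by precomposition with the multiplication by `x_q`. -/
def coindAct (M : AffMod k) : Gen → ℤ → Module.End ℂ (MvPolynomial ℕ ℂ →ₗ[ℂ] M.W)
  | N, q => if 0 ≤ q then LinearMap.lcomp ℂ M.W (LinearMap.mulLeft ℂ (X q.toNat))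
      else LinearMap.llcomp ℂ _ _ _ (M.act N q)
  | E, m => LinearMap.llcomp ℂ _ _ _ (M.act E m) - ((m : ℂ) * k) • LinearMap.lcomp ℂ M.W (dneg m)
  | psiP, s => coindOdd M psiP s
  | psiM, s => coindOdd M psiM s

variable (M : AffMod k)

theorem coindAct_N_nat (i : ℕ) (f : MvPolynomial ℕ ℂ →ₗ[ℂ] M.W) (p : MvPolynomial ℕ ℂ) :
    coindAct M N i f p = f (X i * p) := by
  simp [coindAct]

theorem coindAct_N_neg {q : ℤ} (hq : q < 0) (f : MvPolynomial ℕ ℂ →ₗ[ℂ] M.W) :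
    coindAct M N q f = M.act N q ∘ₗ f := by
  rw [coindAct, if_neg (not_le.2 hq)]
  rfl

theorem coindAct_E (m : ℤ) (f : MvPolynomial ℕ ℂ →ₗ[ℂ] M.W) (p : MvPolynomial ℕ ℂ) :
    coindAct M E m f p = M.act E m (f p) - ((m : ℂ) * k) • f (dneg m p) := rfl

theorem coindOdd_N (a : Gen) (ha : par a = 1) (q s : ℤ) (f : MvPolynomial ℕ ℂ →ₗ[ℂ] M.W) :
    coindAct M N q (coindOdd M a s f) = coindOdd M a s (coindAct M N q f) +
      (chg a : ℂ) • coindOdd M a (s + q) f := by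
  have h2 : ∀ j, s + q + j = s + (j + q) := fun j => by ring
  rcases le_or_gt 0 q with hq | hq
  · lift q to ℕ using hq
    refine LinearMap.ext fun p => ?_
    rw [coindAct_N_nat, coindOdd_apply, coindOdd_apply, coindOdd_apply, shiftSum_X_mul]
    simp only [h2]
    congr 3
  · rw [coindAct_N_neg M hq, coindAct_N_neg M hq, coindOdd_apply, coindOdd_apply, coindOdd_apply,
      ← shiftSum_smul, ← shiftSum_add]
    refine LinearMap.ext fun p => ?_
    rw [LinearMap.comp_apply, map_shiftSum]
    congr 2
    funext j
    refine LinearMap.ext fun p => ?_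
    have h := N_comm (fun b => M.defect_eq_zero N b q) a (s + j) (f p)
    have h0 : central k N a q (s + j) = 0 := by
      cases a <;> simp [par, central, kappa] at ha ⊢
    rw [h0, zero_smul, add_zero, add_assoc, add_comm j q, ← add_assoc] at h
    exact h

theorem coind_defect_N (b : Gen) (q s : ℤ) (f : MvPolynomial ℕ ℂ →ₗ[ℂ] M.W) :
    defect k (coindAct M) N b q s f = 0 := by
  rw [defect_N, sub_eq_zero]
  cases b
  · simp only [central, kappa, zero_mul, ite_self, chg, Int.cast_zero, zero_smul, add_zero]
    refine LinearMap.ext fun p => ?_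
    rcases le_or_gt 0 q with hq | hq <;> rcases le_or_gt 0 s with hs | hs
    · lift q to ℕ using hq
      lift s to ℕ using hs
      simp only [coindAct_N_nat, mul_left_comm (X q)]
    · lift q to ℕ using hq
      simp only [coindAct_N_nat, coindAct_N_neg M hs, LinearMap.comp_apply]
    · lift s to ℕ using hs
      simp only [coindAct_N_nat, coindAct_N_neg M hq, LinearMap.comp_apply]
    · simp only [coindAct_N_neg M hq, coindAct_N_neg M hs, LinearMap.comp_apply]
      exact M.NN _ _ _
  · simp only [central, kappa, one_mul, chg, Int.cast_zero, zero_smul, add_zero]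
    refine LinearMap.ext fun p => ?_
    rcases le_or_gt 0 q with hq | hq
    · lift q to ℕ using hq
      rw [LinearMap.add_apply]
      simp only [coindAct_N_nat, coindAct_E, dneg_X_mul, map_add, LinearMap.smul_apply]
      by_cases h : (q : ℤ) + s = 0
      · obtain rfl : s = -q := by omega
        simp only [add_neg_cancel, if_true]
        push_cast
        module
      · simp [h]
    · simp only [coindAct_N_neg M hq, coindAct_E, LinearMap.comp_apply, LinearMap.add_apply,
        map_sub, map_smul, NE, LinearMap.smul_apply]
      abel
  · rw [show central k N psiP q s = 0 by simp [central, kappa], zero_smul, add_zero]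
    exact coindOdd_N M psiP rfl q s f
  · rw [show central k N psiM q s = 0 by simp [central, kappa], zero_smul, add_zero]
    exact coindOdd_N M psiM rfl q s f

theorem coindAct_one {a : Gen} (ha : a ≠ N) (r : ℤ) (f : MvPolynomial ℕ ℂ →ₗ[ℂ] M.W) :
    coindAct M a r f 1 = M.act a r (f 1) := by
  have key : ∀ a, coindOdd M a r f 1 = M.act a r (f 1) := by
    intro a
    rw [coindOdd_apply, shiftSum_one, add_zero]
    rfl
  cases a
  · exact absurd rfl ha
  · rw [coindAct_E, dneg_one, map_zero, smul_zero, sub_zero]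
  · exact key psiP
  · exact key psiM

/-- The relations among the `E_r` and `ψ^±_r` hold on values at `1`, and propagate to the values at
all polynomials. -/
theorem coind_defect {a b : Gen} (ha : a ≠ N) (hb : b ≠ N) (r s : ℤ)
    (f : MvPolynomial ℕ ℂ →ₗ[ℂ] M.W) : defect k (coindAct M) a b r s f = 0 := by
  refine LinearMap.ext fun p => ?_
  rw [LinearMap.zero_apply]
  induction p using MvPolynomial.induction_on generalizing r s f with
  | C c =>
    have h := map_defect (k := k) (X := coindAct M) (X' := M.act) (LinearMap.applyₗ 1)
      (fun a r f ha => coindAct_one M ha r f) ha hb r s f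
    rw [show (C c : MvPolynomial ℕ ℂ) = c • 1 by rw [smul_eq_C_mul, mul_one], map_smul]
    exact smul_eq_zero_of_right _ (h.trans (M.defect_eq_zero a b r s _))
  | add p q hp hq => rw [map_add, hp, hq, add_zero]
  | mul_X p i hp =>
    have h := N_defect (k := k) (X := coindAct M) (q := i) (fun b => coind_defect_N M b i) ha hb r s f
    have h' := LinearMap.congr_fun h p
    simp only [LinearMap.add_apply, LinearMap.smul_apply, hp, smul_zero, add_zero] at h'
    rw [mul_comm, ← coindAct_N_nat, h']

/-- The module coinduced from the restriction of `M` to the modes other than `N_q`, `q ≥ 0`. -/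
def coind : AffMod k :=
  AffMod.mk' (coindAct M) (LinearMap.llcomp ℂ _ _ _ M.θ)
    (fun f => LinearMap.ext fun p => M.θ_θ (f p))
    (fun a r f => by
      have key : ∀ a, LinearMap.llcomp ℂ _ _ _ M.θ (coindOdd M a r f) =
          ((-1 : ℂ) ^ par a) • coindOdd M a r (LinearMap.llcomp ℂ _ _ _ M.θ f) := by
        intro a
        refine LinearMap.ext fun p => ?_
        rw [coindOdd_apply, coindOdd_apply, ← shiftSum_smul]
        refine (map_shiftSum M.θ _ _ _ p).trans ?_
        congr 2
        funext j
        refine LinearMap.ext fun p => ?_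
        exact M.θ_act_apply a _ (f p)
      cases a
      · refine LinearMap.ext fun p => ?_
        rcases le_or_gt 0 r with hr | hr
        · lift r to ℕ using hr
          simp [coindAct_N_nat, par]
        · simp [coindAct_N_neg M hr, θ_act_apply, par]
      · refine LinearMap.ext fun p => ?_
        simp [coindAct_E, θ_act_apply, par]
      · exact key psiP
      · exact key psiM)
    (coind_defect_N M) (fun a b ha hb r s f => coind_defect M ha hb r s f)

/-- The functional on `ℂ[x_0, x_1, …]` that evaluates at `x_0 = n`, `x_i = 0` for `i > 0`, times a
vector. -/
def coindVec (n : ℂ) (w : M.W) : MvPolynomial ℕ ℂ →ₗ[ℂ] M.W :=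
  (aeval fun i => if i = 0 then n else 0 : MvPolynomial ℕ ℂ →ₐ[ℂ] ℂ).toLinearMap.smulRight w

theorem coindVec_one (n : ℂ) (w : M.W) : coindVec M n w 1 = w := by
  simp [coindVec]

theorem coindAct_N_coindVec (n : ℂ) (w : M.W) (i : ℕ) :
    coindAct M N i (coindVec M n w) = (if i = 0 then n else 0) • coindVec M n w := by
  refine LinearMap.ext fun p => ?_
  rw [coindAct_N_nat, LinearMap.smul_apply]
  simp [coindVec, mul_smul]

/-- In the coinduced module, the vector `coindVec` is annihilated by all positive modes: by those of
`N` since they evaluate to zero, and by the others by induction on polynomials. -/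
theorem coindVec_pos (n : ℂ) {w : M.W} (hw : ∀ a ≠ N, ∀ r, 0 < r → M.act a r w = 0) (a : Gen) (r : ℤ)
    (hr : 0 < r) : coindAct M a r (coindVec M n w) = 0 := by
  by_cases ha : a = N
  · subst ha
    lift r to ℕ using hr.le
    rw [coindAct_N_coindVec, if_neg (by omega), zero_smul]
  · refine LinearMap.ext fun p => ?_
    rw [LinearMap.zero_apply]
    induction p using MvPolynomial.induction_on generalizing r with
    | C c =>
      rw [show (C c : MvPolynomial ℕ ℂ) = c • 1 by rw [smul_eq_C_mul, mul_one], map_smul,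
        coindAct_one M ha, coindVec_one, hw a ha r hr, smul_zero]
    | add p q hp hq => rw [map_add, hp r hr, hq r hr, add_zero]
    | mul_X p i hp =>
      have h := N_comm (k := k) (X := coindAct M) (q := i) (fun b => coind_defect_N M b i) a r
        (coindVec M n w)
      have h0 : central k N a i r = 0 := by rw [central, if_neg (by omega)]
      rw [coindAct_N_coindVec, h0, zero_smul, add_zero, map_smul] at h
      rw [mul_comm, ← coindAct_N_nat, h, LinearMap.add_apply, LinearMap.smul_apply,
        LinearMap.smul_apply, hp r hr, hp (r + i) (by omega), smul_zero, smul_zero, add_zero]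

/-- There is a level-`k` module with a vector killed by the positive modes, of given weights, on
which `ψ⁺_0 ψ⁻_0` does not vanish. -/
theorem exists_vec (k n e : ℂ) : ∃ (A : AffMod k) (u : A.W), (∀ a (r : ℤ), 0 < r → A.act a r u = 0) ∧
    A.act N 0 u = n • u ∧ A.act E 0 u = e • u ∧ A.act psiP 0 (A.act psiM 0 u) ≠ 0 := by
  refine ⟨coind (ind k e), coindVec (ind k e) n (indVec k e),
    coindVec_pos _ n fun a ha r hr => ind_pos e ha r hr, ?_, ?_, fun h => ind_psiP_psiM (k := k) e ?_⟩
  · refine (coindAct_N_coindVec (ind k e) n (indVec k e) 0).trans ?_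
    rw [if_pos rfl]
    rfl
  · refine LinearMap.ext fun p => (coindAct_E _ 0 _ p).trans ?_
    rw [Int.cast_zero, zero_mul, zero_smul, sub_zero]
    exact (congrArg _ rfl).trans ((map_smul _ _ _).trans
      ((congrArg _ (ind_E0 e)).trans (smul_comm _ _ _)))
  · have h' := LinearMap.congr_fun h 1
    have h1 := (coindAct_one (ind k e) (a := psiP) (by decide) 0 _).symm.trans h'
    refine Eq.trans (congrArg _ ?_) h1
    refine Eq.trans ?_ (coindAct_one (ind k e) (a := psiM) (by decide) 0 _).symm
    exact congrArg _ (coindVec_one _ n _).symm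

end FreeField

/-! ### Non-vanishing of the generators -/

section NeZero

variable {k : ℂ} {A : AffMod k} {n e : ℂ} {u : A.W}

theorem act_zero_pos (hpos : ∀ a (r : ℤ), 0 < r → A.act a r u = 0) (b a : Gen) (r : ℤ)
    (hr : 0 < r) : A.act a r (A.act b 0 u) = 0 := by
  rw [rel_apply, hpos a r hr, map_zero, smul_zero, zero_add, central, if_neg (by omega),
    zero_smul, add_zero]
  refine Finset.sum_eq_zero fun c _ => ?_
  rw [hpos c _ (by omega), smul_zero]

theorem N0_psi_psi (hN : A.act N 0 u = n • u) :
    A.act N 0 (A.act psiP 0 (A.act psiM 0 u)) = n • A.act psiP 0 (A.act psiM 0 u) := by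
  simp only [N0_act, hN, map_add, map_smul, chg]
  module

theorem ptop_ne_zero (n : ℂ) :
    (PhatZero k n).act psiP 0 ((PhatZero k n).act psiM 0 (ptop k n)) ≠ 0 := by
  intro h
  obtain ⟨A, u, hpos, hN, hE, hne⟩ := exists_vec k n 0
  obtain ⟨f, ⟨f₀, f₁, h0, h1, rfl⟩, rfl⟩ := ptop_hom n A u hpos hN (by rw [hE, zero_smul])
  exact hne (by simp [h0.2, h1.2, h, par])

theorem vtop_ne_zero (n e : ℂ) : vtop k n e ≠ 0 := by
  intro h
  obtain ⟨A, u, hpos, hN, hE, hne⟩ := exists_vec k (n + 1 / 2) e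
  obtain ⟨f, -, hf⟩ := vtop_hom n e A (A.act psiP 0 (A.act psiM 0 u))
    (fun b r hr => act_zero_pos (fun a r hr => act_zero_pos hpos _ a r hr) _ b r hr)
    (A.PP_self 0 _) (N0_psi_psi hN) (by rw [E0_act, E0_act, hE, map_smul, map_smul])
  exact hne (by rw [← hf, h, map_zero])

theorem atop_ne_zero (n : ℂ) : atop k n ≠ 0 := by
  intro h
  obtain ⟨A, u, hpos, hN, hE, hne⟩ := exists_vec k n 0
  obtain ⟨f, -, hf⟩ := atop_hom n A (A.act psiP 0 (A.act psiM 0 u))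
    (fun b r hr => act_zero_pos (fun a r hr => act_zero_pos hpos _ a r hr) _ b r hr)
    (A.PP_self 0 _) (by simp [MP, MM_self, E0_act, hE]) (N0_psi_psi hN)
    (by rw [E0_act, E0_act, hE, zero_smul, map_zero, map_zero])
  exact hne (by rw [← hf, h, map_zero])

end NeZero

end

end AffGL
namespace AffGL

open Gen

noncomputable section

namespace AffMod

variable {k : ℂ} {M M' A B : AffMod k}

/-! ### Odd reflections -/

/-- Highest-weight vectors with respect to the Borel subalgebra in which the positive odd modes are
`ψ⁺_r`, `r ≥ a`, and `ψ⁻_r`, `r ≥ 1 - a`. -/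
structure VacV (M : AffMod k) (a : ℤ) (e ν : ℂ) (w : M.W) : Prop where
  E0 : M.act E 0 w = e • w
  N0 : M.act N 0 w = ν • w
  Er : ∀ r : ℤ, 0 < r → M.act E r w = 0
  Nr : ∀ r : ℤ, 0 < r → M.act N r w = 0
  P : ∀ r : ℤ, a ≤ r → M.act psiP r w = 0
  M : ∀ r : ℤ, 1 - a ≤ r → M.act psiM r w = 0

theorem VacV.smul {a : ℤ} {e ν : ℂ} {w : M.W} (h : M.VacV a e ν w) (c : ℂ) :
    M.VacV a e ν (c • w) where
  E0 := by rw [map_smul, h.E0, smul_comm]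
  N0 := by rw [map_smul, h.N0, smul_comm]
  Er r hr := by rw [map_smul, h.Er r hr, smul_zero]
  Nr r hr := by rw [map_smul, h.Nr r hr, smul_zero]
  P r hr := by rw [map_smul, h.P r hr, smul_zero]
  M r hr := by rw [map_smul, h.M r hr, smul_zero]

theorem VacV.map {a : ℤ} {e ν : ℂ} {w : M.W} (h : M.VacV a e ν w) {f : M.W →ₗ[ℂ] M'.W}
    (hf : IsHom M M' f) : M'.VacV a e ν (f w) where
  E0 := by rw [hf.act_even rfl, h.E0, map_smul]
  N0 := by rw [hf.act_even rfl, h.N0, map_smul]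
  Er r hr := hf.act_zero _ _ _ (h.Er r hr)
  Nr r hr := hf.act_zero _ _ _ (h.Nr r hr)
  P r hr := hf.act_zero _ _ _ (h.P r hr)
  M r hr := hf.act_zero _ _ _ (h.M r hr)

theorem VacV.down {a : ℤ} {e ν : ℂ} {w : M.W} (h : M.VacV a e ν w) :
    M.VacV (a - 1) e (ν + 1) (M.act psiP (a - 1) w) where
  E0 := by rw [E0_act, h.E0, map_smul]
  N0 := by rw [N0_act, h.N0, map_smul, add_smul]; simp [chg]
  Er r hr := by rw [EP, h.Er r hr, map_zero]
  Nr r hr := by rw [NP, h.Nr r hr, map_zero, h.P _ (by omega), add_zero]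
  P r hr := by
    rcases hr.eq_or_lt with rfl | hr
    · exact M.PP_self _ _
    · rw [PP, h.P r (by omega), map_zero, neg_zero]
  M r hr := by
    rw [MP, h.M r (by omega), h.Er _ (by omega), if_neg (by omega)]
    simp

theorem VacV.psiM_down {a : ℤ} {e ν : ℂ} {w : M.W} (h : M.VacV a e ν w) :
    M.act psiM (1 - a) (M.act psiP (a - 1) w) = (e + ((a - 1 : ℤ) : ℂ) * k) • w := by
  rw [MP, h.M _ le_rfl, show 1 - a + (a - 1) = 0 by ring, h.E0, if_pos rfl, map_zero, neg_zero,
    zero_add]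
  push_cast
  module

theorem VacV.up {a : ℤ} {e ν : ℂ} {w : M.W} (h : M.VacV a e ν w) :
    M.VacV (a + 1) e (ν - 1) (M.act psiM (-a) w) where
  E0 := by rw [E0_act, h.E0, map_smul]
  N0 := by rw [N0_act, h.N0, map_smul, sub_smul]; simp [chg, sub_eq_add_neg]
  Er r hr := by rw [EM, h.Er r hr, map_zero]
  Nr r hr := by rw [NM, h.Nr r hr, map_zero, h.M _ (by omega), sub_zero]
  P r hr := by
    rw [PM, h.P r (by omega), h.Er _ (by omega), if_neg (by omega)]
    simp
  M r hr := by
    by_cases h1 : r = -a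
    · subst h1
      exact M.MM_self _ _
    · rw [MM, h.M r (by omega), map_zero, neg_zero]

theorem VacV.psiP_up {a : ℤ} {e ν : ℂ} {w : M.W} (h : M.VacV a e ν w) :
    M.act psiP a (M.act psiM (-a) w) = (e + (a : ℂ) * k) • w := by
  rw [PM, h.P _ le_rfl, show a + -a = 0 by ring, h.E0, if_pos rfl, map_zero, neg_zero,
    zero_add]
  module

theorem VacV.flow {a : ℤ} {e ν : ℂ} {w : M.W} (h : M.VacV a e ν w) (l : ℤ) :
    (M.flow l).VacV (a - l) (e + l * k) ν w where
  E0 := by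
    refine (flow_E_zero M l w).trans ?_
    rw [h.E0]
    exact (add_smul _ _ _).symm
  N0 := h.N0
  Er r hr := by rw [flow_E _ _ _ hr.ne']; exact h.Er r hr
  Nr := h.Nr
  P r hr := h.P (r + l) (by omega)
  M r hr := h.M (r - l) (by omega)

theorem VacV.of_flow {a : ℤ} {e ν : ℂ} {l : ℤ} {w : M.W} (h : (M.flow l).VacV a e ν w) :
    M.VacV (a + l) (e - l * k) ν w where
  E0 := by
    have h1 : M.act E 0 w + ((l : ℂ) * k) • w = e • w := (flow_E_zero M l w).symm.trans h.E0
    rw [eq_sub_of_add_eq h1, sub_smul]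
  N0 := h.N0
  Er r hr := by
    have h1 := h.Er r hr
    rw [flow_E _ _ _ hr.ne'] at h1
    exact h1
  Nr := h.Nr
  P r hr := by
    have h1 : M.act psiP (r - l + l) w = 0 := h.P (r - l) (by omega)
    rwa [sub_add_cancel] at h1
  M r hr := by
    have h1 : M.act psiM (r + l - l) w = 0 := h.M (r + l) (by omega)
    rwa [add_sub_cancel_right] at h1

/-- Odd reflections: a highest-weight vector for one Borel subalgebra can be replaced by one for
another Borel subalgebra that generates at least as much, as long as none of the intermediate
roots is isotropic on it. -/
theorem VacV.reach (a b : ℤ) {e ν c : ℂ} {w : M.W} (h : M.VacV a e ν w) (hθ : M.θ w = c • w)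
    (hne : ∀ j : ℤ, min a b ≤ j → j < max a b → e + (j : ℂ) * k ≠ 0) :
    ∃ (w' : M.W) (c' : ℂ), M.VacV b e (ν + (a - b : ℤ)) w' ∧ M.θ w' = c' • w' ∧
      ∀ X, M.IsGraded X → w' ∈ X → w ∈ X := by
  have hdown : ∀ m : ℕ, (∀ j : ℤ, a - m ≤ j → j < a → e + (j : ℂ) * k ≠ 0) →
      ∃ (w' : M.W) (c' : ℂ), M.VacV (a - m) e (ν + m) w' ∧ M.θ w' = c' • w' ∧
      ∀ X, M.IsGraded X → w' ∈ X → w ∈ X := by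
    intro m
    induction m with
    | zero => exact fun _ => ⟨w, c, by simpa using h, hθ, fun X _ hX => hX⟩
    | succ m ih =>
      intro hj
      obtain ⟨v, d, hv, hd, hX⟩ := ih fun j h1 h2 => hj j (by push_cast; omega) h2
      refine ⟨M.act psiP (a - m - 1) v, (-1) * d, ?_, ?_, fun X hg hm => hX X hg ?_⟩
      · have := hv.down
        push_cast
        rwa [← sub_sub, ← add_assoc]
      · rw [θ_act_apply, hd]
        simp [par]
      · have h1 := hg.1 psiM (1 - (a - m)) hm
        rw [Submodule.mem_comap, hv.psiM_down] at h1
        exact (X.smul_mem_iff (hj _ (by push_cast; omega) (by omega))).1 h1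
  have hup : ∀ m : ℕ, (∀ j : ℤ, a ≤ j → j < a + m → e + (j : ℂ) * k ≠ 0) →
      ∃ (w' : M.W) (c' : ℂ), M.VacV (a + m) e (ν - m) w' ∧ M.θ w' = c' • w' ∧
      ∀ X, M.IsGraded X → w' ∈ X → w ∈ X := by
    intro m
    induction m with
    | zero => exact fun _ => ⟨w, c, by simpa using h, hθ, fun X _ hX => hX⟩
    | succ m ih =>
      intro hj
      obtain ⟨v, d, hv, hd, hX⟩ := ih fun j h1 h2 => hj j h1 (by push_cast; omega)
      refine ⟨M.act psiM (-(a + m)) v, (-1) * d, ?_, ?_, fun X hg hm => hX X hg ?_⟩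
      · have := hv.up
        push_cast
        rwa [← add_assoc, ← sub_sub]
      · rw [θ_act_apply, hd]
        simp [par]
      · have h1 := hg.1 psiP (a + m) hm
        rw [Submodule.mem_comap, hv.psiP_up] at h1
        exact (X.smul_mem_iff (hj _ (by omega) (by push_cast; omega))).1 h1
  rcases le_total b a with hab | hab
  · obtain ⟨w', c', h1, h2, h3⟩ := hdown (a - b).toNat fun j h1 h2 =>
      hne j (by rw [min_eq_right hab]; omega) (by rw [max_eq_left hab]; omega)
    have e1 : (((a - b).toNat : ℕ) : ℤ) = a - b := Int.toNat_of_nonneg (by omega)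
    have e2 : (((a - b).toNat : ℕ) : ℂ) = ((a - b : ℤ) : ℂ) := by
      rw [← Int.cast_natCast, e1]
    rw [e1, e2, sub_sub_cancel] at h1
    exact ⟨w', c', h1, h2, h3⟩
  · obtain ⟨w', c', h1, h2, h3⟩ := hup (b - a).toNat fun j h1 h2 =>
      hne j (by rw [min_eq_left hab]; omega) (by rw [max_eq_right hab]; omega)
    have e1 : (((b - a).toNat : ℕ) : ℤ) = b - a := Int.toNat_of_nonneg (by omega)
    have e2 : (((b - a).toNat : ℕ) : ℂ) = ((b - a : ℤ) : ℂ) := by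
      rw [← Int.cast_natCast, e1]
    rw [e1, e2, add_sub_cancel] at h1
    refine ⟨w', c', ?_, h2, h3⟩
    have e3 : ν + ((a - b : ℤ) : ℂ) = ν - ((b - a : ℤ) : ℂ) := by push_cast; ring
    rw [e3]
    exact h1

theorem VacV.isVac {e ν : ℂ} {w : M.W} (h : M.VacV 0 e ν w) : M.IsVac e w := by
  refine ⟨h.E0, fun a r hr => ?_, fun _ => h.P 0 le_rfl⟩
  cases a
  · exact h.Nr r hr
  · exact h.Er r hr
  · exact h.P r hr.le
  · exact h.M r (by omega)

theorem IsVac.vacV {e ν : ℂ} {w : M.W} (h : M.IsVac e w) (hP : M.act psiP 0 w = 0)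
    (hN : M.act N 0 w = ν • w) : M.VacV 0 e ν w where
  E0 := h.1
  N0 := hN
  Er := h.2.1 E
  Nr := h.2.1 N
  P r hr := by
    rcases hr.eq_or_lt with rfl | hr
    · exact hP
    · exact h.2.1 psiP r hr
  M r hr := h.2.1 psiM r (by omega)

/-! ### Typical modules -/

/-- Highest-weight vectors for any Borel subalgebra lift along surjections, in the typical case. -/
theorem lift_vacV (hk : k ≠ 0) {e : ℂ} {φ : ℂ →ₗ[ℝ] ℝ}
    (hφ : Strip k e φ) (hne : ∀ j : ℤ, e + (j : ℂ) * k ≠ 0) (b : ℤ) :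
    ∀ (A B : AffMod k), A.Nice → B.Nice → ∀ π : A.W →ₗ[ℂ] B.W, IsHom A B π →
      Function.Surjective π → ∀ (ν : ℂ) (y : B.W), B.VacV b e ν y →
      ∃ x, π x = y ∧ A.VacV b e ν x := by
  have he : e ≠ 0 := by simpa using hne 0
  induction b using Int.induction_on with
  | zero =>
    intro A B hA hB π hπ hs ν y hy
    obtain ⟨x, h1, h2, h3⟩ := lift_vac hk hA hB hφ π hπ hs y hy.isVac ν hy.N0
    exact ⟨x, h1, h2.vacV (h2.2.2 he) h3⟩
  | succ b ih =>
    intro A B hA hB π hπ hs ν y hy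
    have h1 := hy.down
    have h2 := hy.psiM_down
    rw [show (b : ℤ) + 1 - 1 = b by ring] at h1 h2
    rw [show 1 - ((b : ℤ) + 1) = -b by ring] at h2
    obtain ⟨x, hx, hv⟩ := ih A B hA hB (twist A B π) hπ.twist (twist_surjective hs) _ _ h1
    have h3 := hv.up
    rw [add_sub_cancel_right] at h3
    refine ⟨(e + (b : ℤ) * k)⁻¹ • A.act psiM (-b) x, ?_, h3.smul _⟩
    have h4 := hπ.twist.act_odd (a := psiM) rfl (-b) x
    rw [twist_twist, hx, h2] at h4
    rw [map_smul, ← h4, smul_smul, inv_mul_cancel₀ (hne b), one_smul]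
  | pred b ih =>
    intro A B hA hB π hπ hs ν y hy
    have h1 := hy.up
    have h2 := hy.psiP_up
    rw [show -(b : ℤ) - 1 + 1 = -b by ring] at h1
    obtain ⟨x, hx, hv⟩ := ih A B hA hB (twist A B π) hπ.twist (twist_surjective hs) _ _ h1
    have h3 := hv.down
    rw [sub_add_cancel] at h3
    refine ⟨(e + ((-b - 1 : ℤ) : ℂ) * k)⁻¹ • A.act psiP (-b - 1) x, ?_, h3.smul _⟩
    have h4 := hπ.twist.act_odd (a := psiP) rfl (-b - 1) x
    rw [twist_twist, hx, h2] at h4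
    rw [map_smul, ← h4, smul_smul, inv_mul_cancel₀ (hne _), one_smul]

/-- Spectral flow normalises a typical eigenvalue of `E₀`.  If the real part of `e / k` is an integer,
then its imaginary part is non-zero, and adding a multiple of it to the real part gives a functional
with a half-integral value. -/
theorem exists_strip (hk : k ≠ 0) {e : ℂ} (he : ∀ m : ℤ, e / k ≠ m) :
    ∃ (φ : ℂ →ₗ[ℝ] ℝ) (l : ℤ), Strip k (e + l * k) φ := by
  have key : ∃ φ : ℂ →ₗ[ℝ] ℝ, φ 1 = 1 ∧ ∀ m : ℤ, φ (e / k) ≠ m := by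
    by_cases h : ∀ m : ℤ, (e / k).re ≠ m
    · exact ⟨Complex.reLm, rfl, h⟩
    · push Not at h
      obtain ⟨m, hm⟩ := h
      have him : (e / k).im ≠ 0 := fun h0 => he m (Complex.ext (by simpa using hm) (by simpa using h0))
      refine ⟨Complex.reLm + (1 / (2 * (e / k).im)) • Complex.imLm, by simp, fun j hj => ?_⟩
      have h1 : (m : ℝ) + 1 / 2 = j := by
        rw [← hj, LinearMap.add_apply, LinearMap.smul_apply, Complex.reLm_coe, Complex.imLm_coe, hm,
          smul_eq_mul]
        field_simp
      have h2 : (2 * m + 1 : ℝ) = 2 * j := by linarith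
      have h3 : 2 * m + 1 = 2 * j := by exact_mod_cast h2
      omega
  obtain ⟨φ, h1, hj⟩ := key
  refine ⟨φ, -⌊φ (e / k)⌋, h1, Or.inr ?_⟩
  have e1 : (e + ((-⌊φ (e / k)⌋ : ℤ) : ℂ) * k) / k = e / k + ((-⌊φ (e / k)⌋ : ℤ) : ℂ) := by
    field_simp
  have e2 : φ ((-⌊φ (e / k)⌋ : ℤ) : ℂ) = -(⌊φ (e / k)⌋ : ℝ) := by
    have : ((-⌊φ (e / k)⌋ : ℤ) : ℂ) = ((-⌊φ (e / k)⌋ : ℤ) : ℝ) • (1 : ℂ) := by simp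
    rw [this, map_smul, h1]
    simp
  rw [e1, map_add, e2]
  have h2 := Int.floor_le (φ (e / k))
  have h3 := Int.lt_floor_add_one (φ (e / k))
  have h4 := hj ⌊φ (e / k)⌋
  constructor
  · have := lt_of_le_of_ne h2 (Ne.symm h4)
    linarith
  · linarith

theorem typical_ne (hk : k ≠ 0) {e : ℂ} (he : ∀ m : ℤ, e / k ≠ m) (l j : ℤ) :
    e + l * k + (j : ℂ) * k ≠ 0 := by
  intro h
  apply he (-l - j)
  rw [div_eq_iff hk]
  push_cast
  linear_combination h

theorem vtop_vacV (n e : ℂ) : (Vhat k n e).VacV 0 e (n + 1 / 2) (vtop k n e) :=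
  IsVac.vacV ⟨(vtop_isGen n e).E0, fun a r hr => vtop_pos n e a r hr, fun _ => vtop_psiP n e⟩
    (vtop_psiP n e) (vtop_isGen n e).N0

theorem Vhat_isIrreducible (hk : k ≠ 0) (n : ℂ) {e : ℂ} (he : ∀ m : ℤ, e / k ≠ m) :
    (Vhat k n e).IsIrreducible := by
  obtain ⟨φ, l, hφ⟩ := exists_strip hk he
  have hne := typical_ne hk he l
  have hgen := (vtop_isGen (k := k) n e).flow l
  obtain ⟨v, c, hv, hθ, hX⟩ := ((vtop_vacV (k := k) n e).flow l).reach _ 0 hgen.θ fun j _ _ => hne j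
  refine ⟨⟨vtop k n e, 0, vtop_ne_zero n e⟩, fun X hX' => ?_⟩
  by_cases h0 : X ≤ ⊥
  · exact Or.inl (le_bot_iff.1 h0)
  right
  have hE := hgen.E0_apply
  obtain ⟨w, hwX, hw, hw0⟩ := hgen.nice.exists_vac_notMem hk hφ hE ⊥ X (isGraded_bot _)
    (hX'.flow l) h0
  have e0 : e + l * k ≠ 0 := by simpa using hne 0
  -- every vacuum vector is a multiple of `v`
  have h1 : w ∈ Submodule.span ℂ {v} := by
    refine hgen.nice.vac_generated hk hφ _ ?_ ?_ ?_ (fun h => absurd h e0) w ?_ hw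
    · intro y hy
      obtain ⟨d, rfl⟩ := Submodule.mem_span_singleton.1 hy
      exact hv.isVac.smul d
    · intro y hy
      obtain ⟨d, rfl⟩ := Submodule.mem_span_singleton.1 hy
      rw [map_smul, hv.N0]
      exact Submodule.smul_mem _ _ (Submodule.smul_mem _ _ (Submodule.mem_span_singleton_self v))
    · intro y hy
      obtain ⟨d, rfl⟩ := Submodule.mem_span_singleton.1 hy
      rw [map_smul, hθ]
      exact Submodule.smul_mem _ _ (Submodule.smul_mem _ _ (Submodule.mem_span_singleton_self v))
    · exact hgen.top_le _ (AffMod.generated _ _).2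
        (hX _ (AffMod.generated _ _).2 (AffMod.subset_generated _ _
          (Submodule.mem_span_singleton_self v))) w
  obtain ⟨d, rfl⟩ := Submodule.mem_span_singleton.1 h1
  have hd : d ≠ 0 := by
    rintro rfl
    exact hw0 (by simp)
  have hvX : v ∈ X := (X.smul_mem_iff hd).1 hwX
  rw [eq_top_iff]
  exact fun y _ => hgen.top_le X (hX'.flow l) (hX X (hX'.flow l) hvX) y

theorem Vhat_isOfin (hk : k ≠ 0) (n : ℂ) {e : ℂ} (he : ∀ m : ℤ, e / k ≠ m) :
    (Vhat k n e).IsOfin :=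
  (vtop_isGen n e).isOfin hk (Vhat_isIrreducible hk n he).hasLength

/-- Typical Verma modules are projective: the image of the highest-weight vector lifts, after
spectral flow, as a highest-weight vector for a shifted Borel subalgebra. -/
theorem Vhat_isProjective (hk : k ≠ 0) (n : ℂ) {e : ℂ} (he : ∀ m : ℤ, e / k ≠ m) :
    (Vhat k n e).IsProjective := by
  refine ⟨Vhat_isOfin hk n he, fun A B hA hB π q hπ hs hq => ?_⟩
  obtain ⟨φ, l, hφ⟩ := exists_strip hk he
  have hy := ((vtop_vacV (k := k) n e).map hq).flow l
  obtain ⟨x, hx, hv⟩ := lift_vacV hk hφ (typical_ne hk he l) _ (A.flow l) (B.flow l)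
    ((hA.nice hk).flow l) ((hB.nice hk).flow l) π (hπ.flow l) hs _ _ hy
  have hv := VacV.of_flow (M := A) hv
  rw [sub_add_cancel, add_sub_cancel_right] at hv
  obtain ⟨f, hf, hfx⟩ := vtop_hom n e A x hv.isVac.2.1 (hv.P 0 le_rfl) hv.N0 hv.E0
  refine ⟨f, hf, ?_⟩
  have h1 := ((hπ.comp hf).sub hq).eq_zero (vtop_isGen n e).gen (cyc_θ _) (v := vtop k n e) (by
    rw [LinearMap.sub_apply, LinearMap.comp_apply, hfx]
    exact sub_eq_zero.2 hx)
  exact sub_eq_zero.1 h1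

theorem Vhat_cover (hk : k ≠ 0) (n : ℂ) {e : ℂ} (he : ∀ m : ℤ, e / k ≠ m) :
    IsProjectiveCover (Vhat k n e) (Vhat k n e) LinearMap.id :=
  ⟨Vhat_isOfin hk n he, Vhat_isProjective hk n he, (isHomogHom_id _).isHom_zero,
    Function.surjective_id, fun _ _ _ _ h => h⟩

theorem Vhat_split (hk : k ≠ 0) (n : ℂ) {e : ℂ} (he : ∀ m : ℤ, e / k ≠ m) {A : AffMod k}
    (hA : A.IsOfin) (π : A.W →ₗ[ℂ] (Vhat k n e).W) (hπ : IsHom A (Vhat k n e) π)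
    (hs : Function.Surjective π) :
    ∃ s : (Vhat k n e).W →ₗ[ℂ] A.W, IsHom (Vhat k n e) A s ∧ π ∘ₗ s = LinearMap.id :=
  (Vhat_isProjective hk n he).2 A _ hA (Vhat_isOfin hk n he) π _ hπ hs
    (isHomogHom_id _).isHom_zero

/-- In a non-zero nice module with `E₀ = e` there is a homogeneous vacuum vector. -/
theorem Nice.exists_joint_vac (hM : M.Nice) [Nontrivial M.W] {e : ℂ}
    (hE : ∀ w, M.act E 0 w = e • w) :
    ∃ (w : M.W) (ν c : ℂ), w ≠ 0 ∧ M.IsVac e w ∧ M.act N 0 w = ν • w ∧ M.θ w = c • w := by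
  have h1 : ∃ w, M.Joint w ∧ w ≠ 0 := by
    by_contra! h
    obtain ⟨v, hv⟩ := exists_ne (0 : M.W)
    have h2 : v ∈ Submodule.span ℂ {w | M.Joint w} := hM.span_joint ▸ Submodule.mem_top
    have h3 : Submodule.span ℂ {w | M.Joint w} ≤ ⊥ := Submodule.span_le.2 fun w hw => h w hw
    exact hv (h3 h2)
  obtain ⟨w, hw, hw0⟩ := h1
  obtain ⟨w', h1, h2, h3⟩ := hM.exists_vac e M.Joint (fun a r w _ h => h.act a r)
    (fun w _ => hE w) w hw0 hw
  obtain ⟨⟨ν, hν⟩, -, c, hc⟩ := h2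
  exact ⟨w', ν, c, h1, h3, hν, hc⟩

theorem IsHomogHom.isGraded_ker {p : ℕ} {f : M.W →ₗ[ℂ] M'.W} (hf : IsHomogHom M M' p f) :
    M.IsGraded (LinearMap.ker f) := by
  have hneg : ∀ n : ℕ, ((-1 : ℂ) ^ n) ≠ 0 := fun n => pow_ne_zero _ (by norm_num)
  refine ⟨fun a r w hw => ?_, fun w hw => ?_⟩
  · have h := hf.2 a r w
    rw [LinearMap.mem_ker.1 hw, map_zero] at h
    exact (smul_eq_zero.1 h.symm).resolve_left (hneg _)
  · have h := hf.1 w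
    rw [LinearMap.mem_ker.1 hw, map_zero] at h
    exact (smul_eq_zero.1 h.symm).resolve_left (hneg _)

theorem IsIrreducible.surjective (h : M'.IsIrreducible) {p : ℕ} {f : M.W →ₗ[ℂ] M'.W}
    (hf : IsHomogHom M M' p f) {v : M.W} (hv : f v ≠ 0) : Function.Surjective f := by
  rw [← LinearMap.range_eq_top]
  refine (h.2 _ hf.isGraded_range).resolve_left fun h0 => hv ?_
  have : f v ∈ LinearMap.range f := ⟨v, rfl⟩
  rw [h0] at this
  exact this

theorem IsHomogHom.isHom {p : ℕ} {f : M.W →ₗ[ℂ] M'.W} (hf : IsHomogHom M M' p f) :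
    IsHom M M' f := by
  rcases Nat.even_or_odd p with hp | hp
  · refine IsHomogHom.isHom_zero ⟨fun w => ?_, fun a r w => ?_⟩
    · rw [hf.1, hp.neg_one_pow, pow_zero]
    · rw [hf.2, (hp.mul_left _).neg_one_pow, mul_zero, pow_zero]
  · refine IsHomogHom.isHom_one ⟨fun w => ?_, fun a r w => ?_⟩
    · rw [hf.1, hp.neg_one_pow, pow_one]
    · rw [hf.2, mul_comm, pow_mul, hp.neg_one_pow, mul_one]

/-- A typical irreducible module is covered by a Verma module. -/
theorem exists_cover_typical (hk : k ≠ 0) {S : AffMod k} (hS : S.IsGradingRestricted)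
    (hi : S.IsIrreducible) {e : ℂ} (hE : ∀ w, S.act E 0 w = e • w) (he : ∀ m : ℤ, e / k ≠ m) :
    ∃ (P : AffMod k) (p : P.W →ₗ[ℂ] S.W), IsProjectiveCover P S p := by
  have hfin := hi.isOfin hk hS
  obtain ⟨φ, l, hφ⟩ := exists_strip hk he
  have hne := typical_ne hk he l
  have e0 : e + l * k ≠ 0 := by simpa using hne 0
  have : Nontrivial (S.flow l).W := hi.1
  have hE' : ∀ w, (S.flow l).act E 0 w = (e + l * k) • w := by
    intro w
    refine (flow_E_zero S l w).trans ?_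
    exact (congrArg (· + ((l : ℂ) * k) • (show S.W from w)) (hE w)).trans (add_smul _ _ _).symm
  obtain ⟨w, ν, c, hw0, hw, hν, hc⟩ := ((hfin.nice hk).flow l).exists_joint_vac hE'
  obtain ⟨v, c', hv, hθ, hX⟩ := (hw.vacV (hw.2.2 e0) hν).reach 0 (-l) hc fun j _ _ => hne j
  have hv0 : v ≠ 0 := by
    rintro rfl
    exact hw0 (hX ⊥ (isGraded_bot _) (Submodule.zero_mem _))
  have hv := VacV.of_flow (M := S) hv
  rw [neg_add_cancel, add_sub_cancel_right] at hv
  obtain ⟨p, hp⟩ := exists_parity (M := S) hv0 hθ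
  obtain ⟨f, hf, hfv⟩ := vtop_homog (ν + ((0 - -l : ℤ) : ℂ) - 1 / 2) e S p v hp hv.isVac.2.1
    (hv.P 0 le_rfl) (by rw [sub_add_cancel]; exact hv.N0) hv.E0
  have hs := hi.surjective hf (hfv.symm ▸ hv0)
  have hinj : LinearMap.ker f = ⊥ := by
    refine ((Vhat_isIrreducible hk _ he).2 _ hf.isGraded_ker).resolve_right fun h => hv0 ?_
    rw [← hfv]
    have : vtop k (ν + ((0 - -l : ℤ) : ℂ) - 1 / 2) e ∈ LinearMap.ker f := h ▸ Submodule.mem_top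
    exact this
  refine ⟨_, f, hfin, Vhat_isProjective hk _ he, hf.isHom, hs, fun X _ g _ hg y => ?_⟩
  obtain ⟨x, hx⟩ := hg (f y)
  exact ⟨x, LinearMap.ker_eq_bot.1 hinj hx⟩

end AffMod

end

end AffGL
namespace AffGL

open Gen

noncomputable section

namespace AffMod

variable {k : ℂ} {M M' A B : AffMod k}

/-! ### Spaces of vacuum vectors with `E₀ = 0` -/

theorem strip_zero (k : ℂ) : Strip k 0 Complex.reLm := ⟨rfl, Or.inl rfl⟩

/-- Spaces of vacuum vectors with `E₀ = 0` that are stable under the zero modes and the parity. -/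
structure VacStable (M : AffMod k) (Y : Submodule ℂ M.W) : Prop where
  vac : ∀ y ∈ Y, M.IsVac 0 y
  N0 : ∀ y ∈ Y, M.act N 0 y ∈ Y
  θ : ∀ y ∈ Y, M.θ y ∈ Y
  P : ∀ y ∈ Y, M.act psiP 0 y ∈ Y
  M : ∀ y ∈ Y, M.act psiM 0 y ∈ Y

theorem vacStable_bot (M : AffMod k) : M.VacStable ⊥ := by
  constructor <;> intro y hy <;> rw [(Submodule.mem_bot ℂ).1 hy]
  · exact .zero M 0
  all_goals simp

theorem VacStable.sup {Y : Submodule ℂ M.W} (hY : M.VacStable Y) {v : M.W} {ν c : ℂ}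
    (hv : M.IsVac 0 v) (hN : M.act N 0 v = ν • v) (hθ : M.θ v = c • v)
    (hP : M.act psiP 0 v ∈ Y) (hM : M.act psiM 0 v ∈ Y) :
    M.VacStable (Y ⊔ Submodule.span ℂ {v}) := by
  have hmem : ∀ c : ℂ, c • v ∈ Y ⊔ Submodule.span ℂ {v} := fun c =>
    Submodule.mem_sup_right (Submodule.smul_mem _ _ (Submodule.mem_span_singleton_self v))
  constructor <;> intro y hy <;> obtain ⟨x, hx, w, hw, rfl⟩ := Submodule.mem_sup.1 hy <;>
    obtain ⟨d, rfl⟩ := Submodule.mem_span_singleton.1 hw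
  · exact (hY.vac x hx).add (hv.smul d)
  · rw [map_add, map_smul, hN, smul_smul]
    exact Submodule.add_mem _ (Submodule.mem_sup_left (hY.N0 x hx)) (hmem _)
  · rw [map_add, map_smul, hθ, smul_smul]
    exact Submodule.add_mem _ (Submodule.mem_sup_left (hY.θ x hx)) (hmem _)
  · rw [map_add, map_smul]
    exact Submodule.mem_sup_left (Y.add_mem (hY.P x hx) (Y.smul_mem _ hP))
  · rw [map_add, map_smul]
    exact Submodule.mem_sup_left (Y.add_mem (hY.M x hx) (Y.smul_mem _ hM))

/-- `Nice.vac_generated` for `E₀ = 0`. -/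
theorem VacStable.mem (hM : M.Nice) (hk : k ≠ 0) {Y : Submodule ℂ M.W} (hY : M.VacStable Y)
    {w : M.W} (hw : w ∈ (M.generated (Y : Set M.W)).1) (hv : M.IsVac 0 w) : w ∈ Y :=
  hM.vac_generated hk (strip_zero k) Y hY.vac hY.N0 hY.θ (fun _ y hy => ⟨hY.P y hy, hY.M y hy⟩) w
    hw hv

theorem generated_mono (M : AffMod k) {s t : Set M.W} (h : s ⊆ t) :
    (M.generated s).1 ≤ (M.generated t).1 :=
  M.generated_le s _ (M.generated t).2 (h.trans (M.subset_generated t))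

/-- Adjoining one vacuum vector to a stable space of vacuum vectors gives a composition factor of
the generated submodules. -/
theorem VacStable.covBy (hM : M.Nice) (hk : k ≠ 0) (hE : ∀ w, M.act E 0 w = 0)
    {Y : Submodule ℂ M.W} {v : M.W} (hY : M.VacStable Y)
    (hY' : M.VacStable (Y ⊔ Submodule.span ℂ {v})) (hv : v ∉ Y) :
    M.generated (Y : Set M.W) ⋖
      M.generated ((Y ⊔ Submodule.span ℂ {v} : Submodule ℂ M.W) : Set M.W) := by
  set Y' := Y ⊔ Submodule.span ℂ {v} with hYdef
  have hvY' : v ∈ Y' := Submodule.mem_sup_right (Submodule.mem_span_singleton_self v)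
  have hle : (M.generated (Y : Set M.W)).1 ≤ (M.generated (Y' : Set M.W)).1 :=
    M.generated_mono (SetLike.coe_subset_coe.2 le_sup_left)
  refine ⟨lt_of_le_not_ge hle fun h => hv ?_, ?_⟩
  · exact hY.mem hM hk (h (M.subset_generated _ hvY')) (hY'.vac v hvY')
  · rintro ⟨C, hC⟩ h1 h2
    have h1' : ¬ C ≤ (M.generated (Y : Set M.W)).1 := fun h => absurd h1 (not_lt_of_ge h)
    have h3 : C ≤ (M.generated (Y' : Set M.W)).1 := h2.le
    have hYC : (M.generated (Y : Set M.W)).1 ≤ C := h1.le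
    obtain ⟨w, hwC, hw, hwY⟩ := hM.exists_vac_notMem hk (strip_zero k)
      (fun w => by rw [hE, zero_smul]) _ C (M.generated _).2 hC h1'
    obtain ⟨y, hy, x, hx, rfl⟩ := Submodule.mem_sup.1 (hY'.mem hM hk (h3 hwC) hw)
    obtain ⟨d, rfl⟩ := Submodule.mem_span_singleton.1 hx
    have hyC : y ∈ C := hYC (M.subset_generated _ hy)
    have hd : d ≠ 0 := by
      rintro rfl
      exact hwY (by simpa using M.subset_generated _ hy)
    have hvC : v ∈ C := (C.smul_mem_iff hd).1 ((C.add_mem_iff_right hyC).1 hwC)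
    refine absurd h2 (not_lt_of_ge (M.generated_le _ C hC ?_))
    refine SetLike.coe_subset_coe.2 (sup_le (fun y hy => hYC (M.subset_generated _ hy)) ?_)
    exact (Submodule.span_singleton_le_iff_mem v C).2 hvC

/-- In a module generated by a vacuum vector `v` with `ψ^±₀ v` in the line spanned by a singular
vector `z` of another charge, the submodule generated by `z` is the largest proper one. -/
theorem proper_le (hk : k ≠ 0) {n n₂ c c₂ : ℂ} {v z : M.W} (hv : M.IsGen n 0 c v)
    (hvac : M.IsVac 0 v) (hv0 : v ≠ 0) (hz : M.IsVac 0 z) (hzN : M.act N 0 z = n₂ • z) (hn : n ≠ n₂)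
    (hzθ : M.θ z = c₂ • z) (hzP : M.act psiP 0 z = 0) (hzM : M.act psiM 0 z = 0)
    (hP : M.act psiP 0 v ∈ Submodule.span ℂ {z}) (hM : M.act psiM 0 v ∈ Submodule.span ℂ {z}) :
    v ∉ (M.generated {z}).1 ∧ ∀ X, M.IsGraded X → X ≠ ⊤ → X ≤ (M.generated {z}).1 := by
  have hE : ∀ w, M.act E 0 w = 0 := fun w => by rw [hv.E0_apply, zero_smul]
  have h1 : M.VacStable (⊥ ⊔ Submodule.span ℂ {z}) :=
    M.vacStable_bot.sup hz hzN hzθ (by simp [hzP]) (by simp [hzM])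
  rw [bot_sup_eq] at h1
  have h2 := h1.sup hvac hv.N0 hv.θ hP hM
  have hgz : (M.generated ((Submodule.span ℂ {z} : Submodule ℂ M.W) : Set M.W)).1 =
      (M.generated {z}).1 :=
    le_antisymm (M.generated_le _ _ (M.generated _).2 (SetLike.coe_subset_coe.2
      ((Submodule.span_singleton_le_iff_mem _ _).2 (M.mem_generated_self z))))
      (M.generated_mono Submodule.subset_span)
  have hsub : ∀ w, M.IsVac 0 w → w ∈ Submodule.span ℂ {z} ⊔ Submodule.span ℂ {v} := by
    intro w hw
    refine h2.mem hv.nice hk (hv.top_le _ (M.generated _).2 (M.subset_generated _ ?_) w) hw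
    exact Submodule.mem_sup_right (Submodule.mem_span_singleton_self v)
  constructor
  · intro h
    rw [← hgz] at h
    obtain ⟨d, hd⟩ := Submodule.mem_span_singleton.1 (h1.mem hv.nice hk h hvac)
    have h3 : (n - n₂) • v = 0 := by
      rw [sub_smul, ← hv.N0, ← hd, map_smul, hzN, smul_comm, sub_self]
    exact hv0 ((smul_eq_zero.1 h3).resolve_left (sub_ne_zero.2 hn))
  · intro X hX hXt
    by_contra hXz
    obtain ⟨w, hwX, hw, hwz⟩ := hv.nice.exists_vac_notMem hk (strip_zero k)
      (fun w => by rw [hE, zero_smul]) _ X (M.generated {z}).2 hX hXz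
    obtain ⟨x, hx, y, hy, rfl⟩ := Submodule.mem_sup.1 (hsub w hw)
    obtain ⟨b, rfl⟩ := Submodule.mem_span_singleton.1 hx
    obtain ⟨a, rfl⟩ := Submodule.mem_span_singleton.1 hy
    have ha : a ≠ 0 := by
      rintro rfl
      refine hwz ?_
      rw [zero_smul, add_zero]
      exact Submodule.smul_mem _ _ (M.mem_generated_self z)
    have h3 : (a * (n - n₂)) • v ∈ X := by
      have h4 := X.sub_mem (hX.1 N 0 hwX) (X.smul_mem n₂ hwX)
      have e : (a * (n - n₂)) • v = M.act N 0 (b • z + a • v) - n₂ • (b • z + a • v) := by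
        rw [map_add, map_smul, map_smul, hv.N0, hzN]
        module
      rw [e]
      exact h4
    have h5 : v ∈ X := (X.smul_mem_iff (mul_ne_zero ha (sub_ne_zero.2 hn))).1 h3
    exact hXt (eq_top_iff.2 fun w _ => hv.top_le X hX h5 w)

/-! ### Projective covers of atypical modules -/

/-- The properties that the modules induced from `P_n` share with their twists by conjugation: a
generator `u` that is universal among vacuum vectors with `E₀ = 0`, `N₀ = n`, with
`ψ⁺₀ ψ⁻₀ u ≠ 0`. -/
structure StdP (M : AffMod k) (n : ℂ) (u : M.W) : Prop where
  gen : M.IsGen n 0 1 u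
  pos : ∀ a (r : ℤ), 0 < r → M.act a r u = 0
  univ : ∀ (A : AffMod k) (a : A.W), A.IsVac 0 a → A.act N 0 a = n • a →
    ∃ f : M.W →ₗ[ℂ] A.W, IsHom M A f ∧ f u = a
  ne : M.act psiP 0 (M.act psiM 0 u) ≠ 0

namespace StdP

variable {n : ℂ} {u : M.W}

theorem E0 (hu : M.StdP n u) (w : M.W) : M.act E 0 w = 0 := by rw [hu.gen.E0_apply, zero_smul]

theorem isVac (hu : M.StdP n u) : M.IsVac 0 u :=
  ⟨by rw [hu.E0, zero_smul], hu.pos, fun h => absurd rfl h⟩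

end StdP

theorem anti_zero (M : AffMod k) (hE : ∀ w, M.act E 0 w = 0) (w : M.W) :
    M.act psiM 0 (M.act psiP 0 w) = - M.act psiP 0 (M.act psiM 0 w) := by
  rw [MP, add_zero, hE]
  simp

theorem mem_sup_four {V : Type*} [AddCommGroup V] [Module ℂ V] {z p m u w : V}
    (h : w ∈ ⊥ ⊔ Submodule.span ℂ {z} ⊔ Submodule.span ℂ {p} ⊔ Submodule.span ℂ {m} ⊔
      Submodule.span ℂ {u}) :
    ∃ a b c d : ℂ, w = b • z + d • p + c • m + a • u := by
  rw [bot_sup_eq] at h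
  obtain ⟨y, h₁, x, hx, rfl⟩ := Submodule.mem_sup.1 h
  obtain ⟨a, rfl⟩ := Submodule.mem_span_singleton.1 hx
  obtain ⟨y, h₂, x, hx, rfl⟩ := Submodule.mem_sup.1 h₁
  obtain ⟨c, rfl⟩ := Submodule.mem_span_singleton.1 hx
  obtain ⟨y, h₃, x, hx, rfl⟩ := Submodule.mem_sup.1 h₂
  obtain ⟨d, rfl⟩ := Submodule.mem_span_singleton.1 hx
  obtain ⟨b, rfl⟩ := Submodule.mem_span_singleton.1 h₃
  exact ⟨a, b, c, d, rfl⟩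

theorem eigen_components {V : Type*} [AddCommGroup V] [Module ℂ V] (T : Module.End ℂ V)
    {n a b c d : ℂ} {z p m u : V} (hz : T z = n • z) (hp : T p = (n + 1) • p)
    (hm : T m = (n - 1) • m) (hu : T u = n • u)
    (h : T (b • z + d • p + c • m + a • u) = n • (b • z + d • p + c • m + a • u)) :
    d • p + c • m = 0 := by
  have e1 : d • p - c • m = 0 := by
    simp only [map_add, map_smul, hz, hp, hm, hu] at h
    rw [← sub_eq_zero] at h
    rw [← h]
    module
  have h1 := congrArg T e1
  simp only [map_sub, map_smul, hp, hm, map_zero] at h1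
  have h2 : n • (d • p - c • m) + (d • p + c • m) = 0 := by
    rw [← h1]
    module
  rwa [e1, smul_zero, zero_add] at h2

theorem IsHom.eigen {f : M.W →ₗ[ℂ] M'.W} (hf : IsHom M M' f) {a : Gen} (ha : par a = 0) {r : ℤ}
    {w : M.W} {c : ℂ} (h : M.act a r w = c • w) : M'.act a r (f w) = c • f w := by
  rw [hf.act_even ha, h, map_smul]

theorem hasLength_four {X₀ X₁ X₂ X₃ X₄ : M.GSub} (h0 : X₀.1 = ⊥) (h4 : X₄.1 = ⊤) (c0 : X₀ ⋖ X₁)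
    (c1 : X₁ ⋖ X₂) (c2 : X₂ ⋖ X₃) (c3 : X₃ ⋖ X₄) : M.HasLength 4 := by
  refine ⟨fun i => match i with
    | 0 => X₀
    | 1 => X₁
    | 2 => X₂
    | 3 => X₃
    | _ => X₄, h0, h4, fun i hi => ?_⟩
  interval_cases i
  · exact c0
  · exact c1
  · exact c2
  · exact c3

theorem IsVac.zero_mode {w : M.W} (h : M.IsVac 0 w) (a : Gen) : M.IsVac 0 (M.act a 0 w) := by
  refine ⟨by rw [E0_act, h.1, map_smul], fun b r hr => ?_, fun h => absurd rfl h⟩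
  rw [rel_apply, h.2.1 b r hr, map_zero, smul_zero, zero_add, central, if_neg (by omega),
    zero_smul, add_zero]
  refine Finset.sum_eq_zero fun c _ => ?_
  rw [h.2.1 c _ (by omega), smul_zero]

namespace StdP

variable {n : ℂ} {u : M.W}

/-- The composition series of a module of type `P`, through its spaces of vacuum vectors. -/
theorem chain (hu : M.StdP n u) :
    let p := M.act psiP 0 u
    let m := M.act psiM 0 u
    let z := M.act psiP 0 (M.act psiM 0 u)
    let Y1 : Submodule ℂ M.W := ⊥ ⊔ Submodule.span ℂ {z}
    let Y2 := Y1 ⊔ Submodule.span ℂ {p}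
    let Y3 := Y2 ⊔ Submodule.span ℂ {m}
    let Y4 := Y3 ⊔ Submodule.span ℂ {u}
    (M.VacStable Y1 ∧ M.VacStable Y2 ∧ M.VacStable Y3 ∧ M.VacStable Y4) ∧
      p ∉ Y1 ∧ m ∉ Y2 ∧ u ∉ Y3 := by
  intro p m z Y1 Y2 Y3 Y4
  have hanti := M.anti_zero hu.E0
  have hmp : M.act psiM 0 p = -z := hanti u
  have hpz : M.act psiP 0 z = 0 := M.PP_self 0 m
  have hmz : M.act psiM 0 z = 0 := by
    rw [hanti m, MM_self, map_zero, neg_zero]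
  have hpp : M.act psiP 0 p = 0 := M.PP_self 0 u
  have hmm : M.act psiM 0 m = 0 := M.MM_self 0 u
  have hθu : M.θ u = u := by rw [hu.gen.θ, one_smul]
  have hz1 : z ∈ Y1 := Submodule.mem_sup_right (Submodule.mem_span_singleton_self z)
  have hz2 : z ∈ Y2 := Submodule.mem_sup_left hz1
  have hp2 : p ∈ Y2 := Submodule.mem_sup_right (Submodule.mem_span_singleton_self p)
  have hm3 : m ∈ Y3 := Submodule.mem_sup_right (Submodule.mem_span_singleton_self m)
  have hNp : M.act N 0 p = (n + 1) • p := by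
    rw [N0_act, hu.gen.N0, map_smul, add_smul]; simp [chg, p]
  have hNm : M.act N 0 m = (n - 1) • m := by
    rw [N0_act, hu.gen.N0, map_smul, sub_smul]; simp [chg, m, sub_eq_add_neg]
  have hNz : M.act N 0 z = n • z := by
    rw [N0_act, hNm, map_smul, sub_smul]; simp [chg, z, m]
  have s1 : M.VacStable Y1 := M.vacStable_bot.sup (hu.isVac.zero_mode psiM |>.zero_mode psiP)
    hNz (c := 1) (by simp [z, θ_act_apply, par, hθu]) (by rw [hpz]; exact Submodule.zero_mem _)
    (by rw [hmz]; exact Submodule.zero_mem _)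
  have s2 : M.VacStable Y2 := s1.sup (hu.isVac.zero_mode psiP) hNp (c := -1)
    (by simp [p, θ_act_apply, par, hθu]) (by rw [hpp]; exact Submodule.zero_mem _)
    (by rw [hmp]; exact Submodule.neg_mem _ hz1)
  have s3 : M.VacStable Y3 := s2.sup (hu.isVac.zero_mode psiM) hNm (c := -1)
    (by simp [m, θ_act_apply, par, hθu]) hz2 (by rw [hmm]; exact Submodule.zero_mem _)
  have s4 : M.VacStable Y4 := s3.sup hu.isVac hu.gen.N0 hu.gen.θ (Submodule.mem_sup_left hp2) hm3
  refine ⟨⟨s1, s2, s3, s4⟩, fun h => ?_, fun h => ?_, fun h => ?_⟩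
  · have h1 : Y1 ≤ LinearMap.ker (M.act psiM 0) := by
      simp only [Y1, bot_sup_eq, Submodule.span_singleton_le_iff_mem, LinearMap.mem_ker, hmz]
    exact hu.ne (neg_eq_zero.1 (hmp.symm.trans (h1 h)))
  · have h1 : Y2 ≤ LinearMap.ker (M.act psiP 0) := by
      simp only [Y1, Y2, bot_sup_eq, sup_le_iff, Submodule.span_singleton_le_iff_mem,
        LinearMap.mem_ker, hpz, hpp, and_self]
    exact hu.ne (h1 h)
  · have h1 : Y3 ≤ LinearMap.ker (M.act psiP 0 ∘ₗ M.act psiM 0) := by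
      simp only [Y1, Y2, Y3, bot_sup_eq, sup_le_iff, Submodule.span_singleton_le_iff_mem,
        LinearMap.mem_ker, LinearMap.comp_apply, hmz, hmp, hmm, map_zero, map_neg, hpz, neg_zero,
        and_self]
    exact hu.ne (h1 h)

theorem hasLength (hk : k ≠ 0) (hu : M.StdP n u) : M.HasLength 4 := by
  obtain ⟨⟨s1, s2, s3, s4⟩, h1, h2, h3⟩ := hu.chain
  have hN := hu.gen.nice
  have c0 := M.vacStable_bot.covBy hN hk hu.E0 s1 (by simpa using hu.ne)
  have c1 := s1.covBy hN hk hu.E0 s2 h1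
  have c2 := s2.covBy hN hk hu.E0 s3 h2
  have c3 := s3.covBy hN hk hu.E0 s4 h3
  exact hasLength_four (le_bot_iff.1 (M.generated_le _ _ M.isGraded_bot (by simp)))
    (eq_top_iff.2 fun w _ => hu.gen.top_le _ (M.generated _).2 (M.subset_generated _
      (Submodule.mem_sup_right (Submodule.mem_span_singleton_self u))) w) c0 c1 c2 c3

/-- Vacuum vectors of the charge of the generator. -/
theorem vac_eq (hk : k ≠ 0) (hu : M.StdP n u) {w : M.W} (hw : M.IsVac 0 w)
    (hN : M.act N 0 w = n • w) :
    ∃ a b : ℂ, w = a • u + b • M.act psiP 0 (M.act psiM 0 u) := by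
  obtain ⟨⟨-, -, -, s4⟩, -⟩ := hu.chain
  have h1 := s4.mem hu.gen.nice hk (hu.gen.top_le _ (M.generated _).2 (M.subset_generated _
      (Submodule.mem_sup_right (Submodule.mem_span_singleton_self u))) w) hw
  obtain ⟨a, b, c, d, h2⟩ := mem_sup_four h1
  have hNp : M.act N 0 (M.act psiP 0 u) = (n + 1) • M.act psiP 0 u := by
    rw [N0_act, hu.gen.N0, map_smul, add_smul]; simp [chg]
  have hNm : M.act N 0 (M.act psiM 0 u) = (n - 1) • M.act psiM 0 u := by
    rw [N0_act, hu.gen.N0, map_smul, sub_smul]; simp [chg, sub_eq_add_neg]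
  have hNz : M.act N 0 (M.act psiP 0 (M.act psiM 0 u)) = n • M.act psiP 0 (M.act psiM 0 u) := by
    rw [N0_act, hNm, map_smul, sub_smul]; simp [chg]
  rw [h2] at hN
  have h3 := eigen_components (M.act N 0) hNz hNp hNm hu.gen.N0 hN
  refine ⟨a, b, ?_⟩
  rw [h2, add_assoc (b • _), h3, add_zero, add_comm]

end StdP

theorem IsHomogHom.flow_right {l : ℤ} {p : ℕ} {f : M.W →ₗ[ℂ] B.W}
    (hf : IsHomogHom (M.flow l) B p f) : IsHomogHom M (B.flow (-l)) p f := by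
  refine ⟨hf.1, fun a r (w : M.W) => ?_⟩
  cases a
  · exact hf.2 N r w
  · have h1 : B.act E r (f w) = ((-1 : ℂ) ^ (par E * p)) •
        f (M.act E r w + (if r = 0 then (l : ℂ) * k else 0) • w) := hf.2 E r w
    change B.act E r (f w) + (if r = 0 then ((-l : ℤ) : ℂ) * k else 0) • f w =
      ((-1 : ℂ) ^ (par E * p)) • f (M.act E r w)
    rw [h1, map_add, map_smul]
    by_cases h0 : r = 0 <;> simp [par, h0]
  · have h1 : B.act psiP (r - l) (f w) = ((-1 : ℂ) ^ (par psiP * p)) •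
        f (M.act psiP (r - l + l) w) := hf.2 psiP (r - l) w
    rw [sub_add_cancel] at h1
    exact h1
  · have h1 : B.act psiM (r + l) (f w) = ((-1 : ℂ) ^ (par psiM * p)) •
        f (M.act psiM (r + l - l) w) := hf.2 psiM (r + l) w
    rw [add_sub_cancel_right] at h1
    change B.act psiM (r - -l) (f w) = _
    rw [sub_neg_eq_add]
    exact h1

theorem IsHomogHom.flow_left {l : ℤ} {p : ℕ} {f : M.W →ₗ[ℂ] B.W}
    (hf : IsHomogHom M (B.flow (-l)) p f) : IsHomogHom (M.flow l) B p f := by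
  refine ⟨hf.1, fun a r (w : M.W) => ?_⟩
  cases a
  · exact hf.2 N r w
  · have h1 : B.act E r (f w) + (if r = 0 then ((-l : ℤ) : ℂ) * k else 0) • f w =
      ((-1 : ℂ) ^ (par E * p)) • f (M.act E r w) := hf.2 E r w
    change B.act E r (f w) = ((-1 : ℂ) ^ (par E * p)) •
        f (M.act E r w + (if r = 0 then (l : ℂ) * k else 0) • w)
    rw [map_add, map_smul, smul_add, ← h1]
    by_cases h0 : r = 0 <;> simp [par, h0]
  · have h1 : B.act psiP (r + l + -l) (f w) = ((-1 : ℂ) ^ (par psiP * p)) •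
        f (M.act psiP (r + l) w) := hf.2 psiP (r + l) w
    rw [add_neg_cancel_right] at h1
    exact h1
  · have h1 : B.act psiM (r - l - -l) (f w) = ((-1 : ℂ) ^ (par psiM * p)) •
        f (M.act psiM (r - l) w) := hf.2 psiM (r - l) w
    rw [sub_neg_eq_add, sub_add_cancel] at h1
    exact h1

theorem IsHom.flow_right {l : ℤ} {f : M.W →ₗ[ℂ] B.W} (hf : IsHom (M.flow l) B f) :
    IsHom M (B.flow (-l)) f := by
  obtain ⟨f₀, f₁, h0, h1, h⟩ := hf
  exact ⟨f₀, f₁, h0.flow_right, h1.flow_right, h⟩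

theorem IsHom.flow_left {l : ℤ} {f : M.W →ₗ[ℂ] B.W} (hf : IsHom M (B.flow (-l)) f) :
    IsHom (M.flow l) B f := by
  obtain ⟨f₀, f₁, h0, h1, h⟩ := hf
  exact ⟨f₀, f₁, h0.flow_left, h1.flow_left, h⟩

/-- The highest-weight vectors of the spectral flows of the modules `A_n^`. -/
structure AtypVec (S : AffMod k) (n : ℂ) (a : S.W) : Prop where
  ne : a ≠ 0
  vac : S.IsVac 0 a
  N0 : S.act N 0 a = n • a
  θ : ∃ c : ℂ, S.θ a = c • a
  P : S.act psiP 0 a = 0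
  M : S.act psiM 0 a = 0

namespace StdP

variable {n : ℂ} {u : M.W}

theorem isOfin_flow (hk : k ≠ 0) (hu : M.StdP n u) (l : ℤ) : (M.flow l).IsOfin :=
  (hu.gen.flow l).isOfin hk ((hu.hasLength hk).flow l)

theorem isProjective_flow (hk : k ≠ 0) (hu : M.StdP n u) (l : ℤ) : (M.flow l).IsProjective := by
  refine ⟨hu.isOfin_flow hk l, fun A B hA hB π q hπ hs hq => ?_⟩
  have hq' := hq.flow_right
  have hb := hu.isVac.map hq'
  obtain ⟨x, hx, hv, hN⟩ := lift_vac hk ((hA.nice hk).flow (-l)) ((hB.nice hk).flow (-l))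
    (strip_zero k) π (hπ.flow (-l)) hs _ hb n (hq'.eigen rfl hu.gen.N0)
  obtain ⟨f, hf, hfx⟩ := hu.univ (A.flow (-l)) x hv hN
  refine ⟨f, hf.flow_left, ?_⟩
  have h1 := ((hπ.comp hf.flow_left).sub hq).eq_zero ((hu.gen.flow l).gen)
    (hu.gen.θ.trans (one_smul ℂ u)) (sub_eq_zero.2 ((congrArg π hfx).trans hx))
  exact sub_eq_zero.1 h1

/-- If `f ∘ g` is surjective, then the image of `g` contains a vector `u + β ψ⁺₀ ψ⁻₀ u`, and hence
`u`: the generator lifts from its image under `f`, up to the vacuum vectors of charge `n` in the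
kernel of `f`. -/
theorem essential (hk : k ≠ 0) (hu : M.StdP n u) (hA : A.Nice) (hB : B.Nice) {a : B.W}
    (ha : B.AtypVec n a) {f : M.W →ₗ[ℂ] B.W} (hf : IsHom M B f) (hfa : f u = a)
    {g : A.W →ₗ[ℂ] M.W} (hg' : IsHom A M g) (hsg : Function.Surjective (f ∘ₗ g)) :
    Function.Surjective g := by
  obtain ⟨x, hx, hv, hN⟩ := lift_vac hk hA hB (strip_zero k) (f ∘ₗ g) (hf.comp hg') hsg a ha.vac n
    ha.N0
  have hy := hv.map hg'
  obtain ⟨α, β, hab⟩ := hu.vac_eq hk hy (hg'.eigen rfl hN)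
  set z := M.act psiP 0 (M.act psiM 0 u) with hz
  have hfz : f z = 0 := by
    have h1 := hf.act_odd (a := psiM) rfl 0 u
    rw [hfa, ha.M] at h1
    have h2 := hf.twist.act_odd (a := psiP) rfl 0 (M.act psiM 0 u)
    rw [twist_twist, ← h1, map_zero] at h2
    exact h2.symm
  have hα : α = 1 := by
    have h1 : f (g x) = a := hx
    rw [hab, map_add, map_smul, map_smul, hfz, hfa, smul_zero, add_zero] at h1
    have h2 : (α - 1) • a = 0 := by rw [sub_smul, h1, one_smul, sub_self]
    exact sub_eq_zero.1 ((smul_eq_zero.1 h2).resolve_right ha.ne)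
  rw [hα, one_smul] at hab
  have hθu : M.θ u = u := by rw [hu.gen.θ, one_smul]
  have hθ : M.θ (g x) = (1 : ℂ) • g x := by
    rw [hab]
    simp [hz, θ_act_apply, par, hθu]
  have h3 := hg'.generated_le_range ⟨x, rfl⟩ hθ
  have hanti := M.anti_zero hu.E0
  have hmz : M.act psiM 0 z = 0 := by
    rw [hz, hanti, MM_self, map_zero, neg_zero]
  have hG := (M.generated {g x}).2
  have hgx := M.mem_generated_self (g x)
  have h4 : z ∈ (M.generated {g x}).1 := by
    have h5 := hG.1 psiP 0 (hG.1 psiM 0 hgx)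
    rw [Submodule.mem_comap, hab, map_add, map_smul, hmz, smul_zero, add_zero] at h5
    rw [hab]
    exact h5
  have h6 : u ∈ (M.generated {g x}).1 := by
    have h7 := (M.generated {g x}).1.sub_mem hgx ((M.generated {g x}).1.smul_mem β h4)
    have e : g x - β • z = u := by rw [hab, add_sub_cancel_right]
    rw [e] at h7
    exact h7
  intro w
  exact h3 (hu.gen.top_le _ hG h6 w)

/-- The spectral flow of a module of type `P` is a projective cover of every irreducible module
with a matching highest-weight vector. -/
theorem cover (hk : k ≠ 0) (hu : M.StdP n u) (l : ℤ) {S : AffMod k} (hS : S.IsOfin)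
    (hi : S.IsIrreducible) {a : (S.flow (-l)).W} (ha : (S.flow (-l)).AtypVec n a) :
    ∃ p : (M.flow l).W →ₗ[ℂ] S.W, IsProjectiveCover (M.flow l) S p := by
  obtain ⟨f, hf, hfa⟩ := hu.univ (S.flow (-l)) a ha.vac ha.N0
  obtain ⟨c, hc⟩ := ha.θ
  have hs : Function.Surjective f := by
    rw [← LinearMap.range_eq_top, eq_top_iff]
    have h1 := hf.generated_le_range ⟨u, hfa⟩ hc
    rcases (hi.flow (-l)).2 _ ((S.flow (-l)).generated {a}).2 with h2 | h2
    · refine absurd ?_ ha.ne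
      have := (S.flow (-l)).mem_generated_self a
      rw [h2] at this
      exact this
    · rw [← h2]
      exact h1
  refine ⟨f, hS, hu.isProjective_flow hk l, hf.flow_left, hs, fun X hX g hg hsg => ?_⟩
  have hg' : IsHom (X.flow (-l)) M g := by
    have aux : ∀ l', l' = l → IsHom X (M.flow l') (g : X.W →ₗ[ℂ] M.W) := by
      rintro _ rfl
      exact hg
    exact (aux _ (neg_neg l)).flow_left
  exact hu.essential hk ((hX.nice hk).flow (-l)) ((hS.nice hk).flow (-l)) ha hf hfa hg' hsg

end StdP

end AffMod

end

end AffGL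
namespace AffGL

open Gen

noncomputable section

namespace AffMod

variable {k : ℂ} {M M' A B : AffMod k}

/-! ### The standard projective modules -/

theorem PhatZero_stdP (n : ℂ) : (PhatZero k n).StdP n (ptop k n) where
  gen := ptop_isGen n
  pos := ptop_pos n
  univ A a ha hN := ptop_hom n A a ha.2.1 hN (by rw [ha.1, zero_smul])
  ne := ptop_ne_zero n

theorem generated_conj (M : AffMod k) (s : Set M.W) :
    (M.generated s).1 ≤ (M.conj.generated s).1 :=
  generated_le M s _ (M.conj.generated s).2.of_conj (M.conj.subset_generated s)

/-- A homomorphism from a conjugate module, through the inverse conjugate of its target: conjugation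
has order four, as its square is the parity automorphism. -/
theorem IsHomogHom.of_conj {p : ℕ} {f : M.W →ₗ[ℂ] A.W}
    (hf : IsHomogHom M A.conj.conj.conj p f) : IsHomogHom M.conj A p f := by
  refine ⟨hf.1, fun a r (w : M.W) => ?_⟩
  cases a
  · have h1 : -(-(-(A.act N r (f w)))) = ((-1 : ℂ) ^ (par N * p)) • f (M.act N r w) := hf.2 N r w
    change A.act N r (f w) = ((-1 : ℂ) ^ (par N * p)) • f (-(M.act N r w))
    rw [neg_neg, neg_eq_iff_eq_neg] at h1
    rw [h1, map_neg, smul_neg]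
  · have h1 : -(-(-(A.act E r (f w)))) = ((-1 : ℂ) ^ (par E * p)) • f (M.act E r w) := hf.2 E r w
    change A.act E r (f w) = ((-1 : ℂ) ^ (par E * p)) • f (-(M.act E r w))
    rw [neg_neg, neg_eq_iff_eq_neg] at h1
    rw [h1, map_neg, smul_neg]
  · have h1 : -(A.act psiP r (f w)) = ((-1 : ℂ) ^ (par psiM * p)) • f (M.act psiM r w) :=
      hf.2 psiM r w
    change A.act psiP r (f w) = ((-1 : ℂ) ^ (par psiP * p)) • f (-(M.act psiM r w))
    rw [neg_eq_iff_eq_neg] at h1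
    rw [h1, map_neg, smul_neg]
    rfl
  · have h1 : -(-(A.act psiM r (f w))) = ((-1 : ℂ) ^ (par psiP * p)) • f (M.act psiP r w) :=
      hf.2 psiP r w
    rw [neg_neg] at h1
    exact h1

theorem IsHom.of_conj {f : M.W →ₗ[ℂ] A.W} (hf : IsHom M A.conj.conj.conj f) :
    IsHom M.conj A f := by
  obtain ⟨f₀, f₁, h0, h1, h⟩ := hf
  exact ⟨f₀, f₁, h0.of_conj, h1.of_conj, h⟩

theorem StdP.conj {n : ℂ} {u : M.W} (hu : M.StdP n u) : M.conj.StdP (-n) u where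
  gen :=
    { gen := eq_top_iff.2 (hu.gen.gen.symm.le.trans (M.generated_conj {u}))
      θ := hu.gen.θ
      N0 := by
        change -(M.act N 0 u) = -n • u
        rw [hu.gen.N0, neg_smul]
      E0 := by
        change -(M.act E 0 u) = (0 : ℂ) • u
        rw [hu.E0, zero_smul, neg_zero]
      Nr := fun r hr => by
        change -(M.act N r u) = 0
        rw [hu.pos N r hr, neg_zero]
      Er := fun r hr => by
        change -(M.act E r u) = 0
        rw [hu.pos E r hr, neg_zero]
      bd := ⟨1, fun a r hr => by
        cases a
        · exact neg_eq_zero.2 (hu.pos N r (by omega))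
        · exact neg_eq_zero.2 (hu.pos E r (by omega))
        · exact neg_eq_zero.2 (hu.pos psiM r (by omega))
        · exact hu.pos psiP r (by omega)⟩ }
  pos a r hr := by
    cases a
    · exact neg_eq_zero.2 (hu.pos N r hr)
    · exact neg_eq_zero.2 (hu.pos E r hr)
    · exact neg_eq_zero.2 (hu.pos psiM r hr)
    · exact hu.pos psiP r hr
  univ A a ha hN := by
    have hvac : A.conj.conj.conj.IsVac 0 a := by
      refine ⟨?_, fun b r hr => ?_, fun h => absurd rfl h⟩
      · change -(-(-(A.act E 0 a))) = (0 : ℂ) • (show A.W from a)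
        rw [ha.1, zero_smul, neg_zero, neg_zero, neg_zero]
      · cases b
        · change -(-(-(A.act N r a))) = 0
          rw [ha.2.1 N r hr, neg_zero, neg_zero, neg_zero]
        · change -(-(-(A.act E r a))) = 0
          rw [ha.2.1 E r hr, neg_zero, neg_zero, neg_zero]
        · change -(-(A.act psiM r a)) = 0
          rw [ha.2.1 psiM r hr, neg_zero, neg_zero]
        · change -(A.act psiP r a) = 0
          rw [ha.2.1 psiP r hr, neg_zero]
    have hN' : A.conj.conj.conj.act N 0 a = n • (show A.W from a) := by
      change -(-(-(A.act N 0 a))) = n • a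
      rw [hN, neg_neg, neg_smul, neg_neg]
    obtain ⟨f, hf, hfu⟩ := hu.univ A.conj.conj.conj a hvac hN'
    exact ⟨f, hf.of_conj, hfu⟩
  ne := by
    change -(M.act psiM 0 (M.act psiP 0 u)) ≠ 0
    rw [M.anti_zero hu.E0, neg_neg]
    exact hu.ne

/-- Up to spectral flow, `P_{n-ℓ+ε(ℓ),ℓk}^` is `P_n^` for `ℓ ≤ 0`, and the conjugate of `P_{-n}^` for
`ℓ > 0`; conjugation negates `N₀`. -/
theorem Phat_eq_flow (n : ℂ) (l : ℤ) :
    ∃ (M : AffMod k) (u : M.W), M.StdP n u ∧ Phat k (n - l + eps l) l = M.flow l := by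
  rcases lt_trichotomy l 0 with hl | rfl | hl
  · refine ⟨_, _, PhatZero_stdP n, ?_⟩
    rw [Phat, if_neg hl.ne, if_pos hl, eps, if_neg (by omega), if_neg hl.ne]
    congr 2
    ring
  · refine ⟨_, _, PhatZero_stdP n, ?_⟩
    rw [Phat, if_pos rfl, flow_zero, eps, if_neg (by omega), if_pos rfl]
    congr 1
    push_cast
    ring
  · have h := (PhatZero_stdP (k := k) (-n)).conj
    rw [neg_neg] at h
    refine ⟨_, _, h, ?_⟩
    rw [Phat, if_neg (by omega), if_neg (by omega), eps, if_pos hl]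
    congr 3
    ring

/-! ### Atypical irreducible modules -/

/-- Applying `ψ⁺₀` and `ψ⁻₀` where they do not vanish turns a homogeneous vacuum vector into one
annihilated by both. -/
theorem exists_atypVec (hM : M.Nice) [Nontrivial M.W] (hE : ∀ w, M.act E 0 w = 0) :
    ∃ (n : ℂ) (a : M.W), M.AtypVec n a := by
  have hanti := M.anti_zero hE
  obtain ⟨w, ν, c, h0, hv, hN, hθ⟩ := hM.exists_joint_vac (e := 0) (fun w => by rw [hE, zero_smul])
  have step1 : ∃ (w : M.W) (ν c : ℂ), w ≠ 0 ∧ M.IsVac 0 w ∧ M.act N 0 w = ν • w ∧ M.θ w = c • w ∧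
      M.act psiP 0 w = 0 := by
    by_cases h : M.act psiP 0 w = 0
    · exact ⟨w, ν, c, h0, hv, hN, hθ, h⟩
    · refine ⟨_, ν + 1, -c, h, hv.zero_mode psiP, ?_, ?_, M.PP_self 0 w⟩
      · rw [N0_act, hN, map_smul, add_smul]; simp [chg]
      · simp [θ_act_apply, par, hθ]
  obtain ⟨w, ν, c, h0, hv, hN, hθ, hP⟩ := step1
  by_cases h : M.act psiM 0 w = 0
  · exact ⟨ν, w, h0, hv, hN, ⟨c, hθ⟩, hP, h⟩
  · refine ⟨ν - 1, _, h, hv.zero_mode psiM, ?_, ⟨-c, ?_⟩, ?_, M.MM_self 0 w⟩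
    · rw [N0_act, hN, map_smul, sub_smul]; simp [chg, sub_eq_add_neg]
    · simp [θ_act_apply, par, hθ]
    · rw [← neg_eq_zero, ← hanti, hP, map_zero]

theorem flow_E_eq_zero {S : AffMod k} {l : ℤ} (hE : ∀ w, S.act E 0 w = ((l : ℂ) * k) • w)
    (w : (S.flow (-l)).W) : (S.flow (-l)).act E 0 w = 0 := by
  refine (flow_E_zero S (-l) w).trans ?_
  refine (congrArg (· + (((-l : ℤ) : ℂ) * k) • (show S.W from w)) (hE w)).trans ?_
  refine (add_smul _ _ _).symm.trans ?_
  rw [show (l : ℂ) * k + ((-l : ℤ) : ℂ) * k = 0 by push_cast; ring]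
  exact zero_smul ℂ _

theorem exists_cover_atypical (hk : k ≠ 0) {S : AffMod k} (hS : S.IsGradingRestricted)
    (hi : S.IsIrreducible) {l : ℤ} (hE : ∀ w, S.act E 0 w = ((l : ℂ) * k) • w) :
    ∃ (P : AffMod k) (p : P.W →ₗ[ℂ] S.W), IsProjectiveCover P S p := by
  have hfin := hi.isOfin hk hS
  have : Nontrivial (S.flow (-l)).W := hi.1
  obtain ⟨n, a, ha⟩ := exists_atypVec ((hfin.nice hk).flow (-l)) (flow_E_eq_zero hE)
  obtain ⟨p, hp⟩ := (PhatZero_stdP n).cover hk l hfin hi ha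
  exact ⟨_, p, hp⟩

theorem IsGen.quot {n e c : ℂ} {u : M.W} (hu : M.IsGen n e c u) (X : M.GSub) :
    (M.quot X).IsGen n e c (X.1.mkQ u) := by
  have hm := M.isHomogHom_mkQ X
  refine ⟨?_, ?_, ?_, ?_, ?_, ?_, ?_⟩
  · rw [eq_top_iff]
    intro w _
    obtain ⟨x, rfl⟩ := X.1.mkQ_surjective w
    have hg := ((M.quot X).generated {X.1.mkQ u}).2
    refine hu.top_le (((M.quot X).generated {X.1.mkQ u}).1.comap X.1.mkQ)
      ⟨fun a r x hx => hg.1 a r hx, fun x hx => hg.2 hx⟩ ?_ x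
    exact (M.quot X).mem_generated_self _
  · exact (congrArg X.1.mkQ hu.θ).trans (map_smul _ _ _)
  · exact (congrArg X.1.mkQ hu.N0).trans (map_smul _ _ _)
  · exact (congrArg X.1.mkQ hu.E0).trans (map_smul _ _ _)
  · exact fun r hr => (congrArg X.1.mkQ (hu.Nr r hr)).trans (map_zero _)
  · exact fun r hr => (congrArg X.1.mkQ (hu.Er r hr)).trans (map_zero _)
  · obtain ⟨R, hR⟩ := hu.bd
    exact ⟨R, fun a r hr => (congrArg X.1.mkQ (hR a r hr)).trans (map_zero _)⟩

theorem isIrreducible_quot_sumProper (h : M.sumProper.1 ≠ ⊤) :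
    (M.quot M.sumProper).IsIrreducible := by
  refine ⟨Submodule.Quotient.nontrivial_iff.2 h, fun X hX => ?_⟩
  have hg : M.IsGraded (X.comap M.sumProper.1.mkQ) :=
    ⟨fun a r x hx => hX.1 a r hx, fun x hx => hX.2 hx⟩
  by_cases ht : X.comap M.sumProper.1.mkQ = ⊤
  · right
    rw [eq_top_iff]
    intro w _
    obtain ⟨x, rfl⟩ := M.sumProper.1.mkQ_surjective w
    have : x ∈ X.comap M.sumProper.1.mkQ := ht ▸ Submodule.mem_top
    exact this
  · left
    rw [eq_bot_iff]
    intro w hw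
    obtain ⟨x, rfl⟩ := M.sumProper.1.mkQ_surjective w
    have h1 : X.comap M.sumProper.1.mkQ ≤ M.sumProper.1 := le_sSup ⟨hg, ht⟩
    exact (Submodule.Quotient.mk_eq_zero _).2 (h1 hw)

theorem AhatZero_atypVec (n : ℂ) : (AhatZero k n).AtypVec n (atop k n) where
  ne := atop_ne_zero n
  vac := ⟨(atop_isGen n).E0, atop_pos n, fun h => absurd rfl h⟩
  N0 := (atop_isGen n).N0
  θ := ⟨1, (atop_isGen n).θ⟩
  P := atop_psiP n
  M := atop_psiM n

theorem AhatZero_isIrreducible (hk : k ≠ 0) (n : ℂ) : (AhatZero k n).IsIrreducible := by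
  have ha := AhatZero_atypVec (k := k) n
  obtain ⟨h1, h2⟩ := proper_le hk (n₂ := n + 1) (c₂ := 1) (z := 0) (atop_isGen n) ha.vac ha.ne
    (.zero _ _) (by simp) (by simp) (by simp) (by simp) (by simp)
    (by rw [ha.P]; exact Submodule.zero_mem _) (by rw [ha.M]; exact Submodule.zero_mem _)
  refine ⟨⟨atop k n, 0, ha.ne⟩, fun X hX => or_iff_not_imp_right.2 fun ht => ?_⟩
  rw [eq_bot_iff]
  exact (h2 X hX ht).trans (generated_le _ _ _ (isGraded_bot _) (by simp))

/-- The irreducible quotients of the atypical Verma modules with `ℓ ≠ 0`.  After spectral flow to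
`E₀ = 0`, odd reflections lead from the highest-weight vector to a vacuum vector `v` of charge `n`
that generates the module; one of `ψ^±₀ v` vanishes, depending on the sign of `ℓ`, and the other one
generates the largest proper submodule. -/
theorem Ahat_atypical (hk : k ≠ 0) (n : ℂ) {l : ℤ} (hl : l ≠ 0) :
    let V := Vhat k (n - l + eps l) (l * k)
    (V.quot V.sumProper).IsIrreducible ∧
      ∃ a, ((V.quot V.sumProper).flow (-l)).AtypVec n a := by
  intro V
  set m : ℂ := n - l + eps l with hm
  have e0 : (l : ℂ) * k + ((-l : ℤ) : ℂ) * k = 0 := by push_cast; ring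
  have hgen := (vtop_isGen (k := k) m (l * k)).flow (-l)
  have hvac := (vtop_vacV (k := k) m (l * k)).flow (-l)
  rw [e0] at hgen hvac
  have hE := hgen.E0_apply
  have key : ∃ (v z : (V.flow (-l)).W) (c n₂ c₂ : ℂ), (V.flow (-l)).IsVac 0 v ∧
      (V.flow (-l)).act N 0 v = n • v ∧ (V.flow (-l)).θ v = c • v ∧
      (∀ X, (V.flow (-l)).IsGraded X → v ∈ X → vtop k m (l * k) ∈ X) ∧
      (V.flow (-l)).IsVac 0 z ∧ (V.flow (-l)).act N 0 z = n₂ • z ∧ n ≠ n₂ ∧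
      (V.flow (-l)).θ z = c₂ • z ∧
      (V.flow (-l)).act psiP 0 z = 0 ∧ (V.flow (-l)).act psiM 0 z = 0 ∧
      (V.flow (-l)).act psiP 0 v ∈ Submodule.span ℂ {z} ∧
      (V.flow (-l)).act psiM 0 v ∈ Submodule.span ℂ {z} := by
    have hanti := (V.flow (-l)).anti_zero fun w => (hE w).trans (zero_smul ℂ w)
    rcases lt_or_gt_of_ne hl with hl' | hl'
    · obtain ⟨v, c, hv, hθ, hX⟩ := hvac.reach _ 0 hgen.θ fun j h1 h2 => by
        rw [zero_add]
        refine mul_ne_zero (Int.cast_ne_zero.2 ?_) hk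
        omega
      have hν : m + 1 / 2 + ((0 - -l - 0 : ℤ) : ℂ) = n := by
        rw [hm, eps, if_neg (by omega), if_neg hl]
        push_cast; ring
      rw [hν] at hv
      have hzero := hv.isVac
      have hP := hv.P 0 le_rfl
      refine ⟨v, (V.flow (-l)).act psiM 0 v, c, n - 1, -c, hzero, hv.N0, hθ, hX,
        hzero.zero_mode psiM, ?_, fun h => one_ne_zero (by linear_combination h), ?_, ?_, (V.flow (-l)).MM_self 0 v, ?_,
        Submodule.mem_span_singleton_self _⟩
      · rw [N0_act, hv.N0, map_smul, sub_smul]; simp [chg, sub_eq_add_neg]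
      · rw [θ_act_apply, hθ]; simp [par]
      · rw [← neg_eq_zero, ← hanti, hP, map_zero]
      · rw [hP]; exact Submodule.zero_mem _
    · obtain ⟨v, c, hv, hθ, hX⟩ := hvac.reach _ 1 hgen.θ fun j h1 h2 => by
        rw [zero_add]
        refine mul_ne_zero (Int.cast_ne_zero.2 ?_) hk
        omega
      have hν : m + 1 / 2 + ((0 - -l - 1 : ℤ) : ℂ) = n := by
        rw [hm, eps, if_pos hl']
        push_cast; ring
      rw [hν] at hv
      have hM := hv.M 0 (by omega)
      have hzero : (V.flow (-l)).IsVac 0 v := by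
        refine ⟨hv.E0, fun a r hr => ?_, fun h => absurd rfl h⟩
        cases a
        · exact hv.Nr r hr
        · exact hv.Er r hr
        · exact hv.P r (by omega)
        · exact hv.M r (by omega)
      refine ⟨v, (V.flow (-l)).act psiP 0 v, c, n + 1, -c, hzero, hv.N0, hθ, hX,
        hzero.zero_mode psiP, ?_, fun h => one_ne_zero (by linear_combination -h), ?_, (V.flow (-l)).PP_self 0 v, ?_,
        Submodule.mem_span_singleton_self _, ?_⟩
      · rw [N0_act, hv.N0, map_smul, add_smul]; simp [chg]
      · rw [θ_act_apply, hθ]; simp [par]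
      · rw [hanti, hM, map_zero, neg_zero]
      · rw [hM]; exact Submodule.zero_mem _
  obtain ⟨v, z, c, n₂, c₂, hv, hN, hθ, hX, hz, hzN, hn, hzθ, hzP, hzM, hP, hM⟩ := key
  have hv0 : v ≠ 0 := by
    rintro rfl
    exact vtop_ne_zero m (l * k) (hX ⊥ (isGraded_bot _) (Submodule.zero_mem _))
  have hgenv : (V.flow (-l)).IsGen n 0 c v :=
    { gen := eq_top_iff.2 fun w _ => hgen.top_le _ (AffMod.generated _ _).2
        (hX _ (AffMod.generated _ _).2 (AffMod.mem_generated_self _ v)) w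
      θ := hθ
      N0 := hN
      E0 := hv.1
      Nr := hv.2.1 N
      Er := hv.2.1 E
      bd := ⟨1, fun a r hr => hv.2.1 a r (by omega)⟩ }
  obtain ⟨h1, h2⟩ := proper_le hk hgenv hv hv0 hz hzN hn hzθ hzP hzM hP hM
  have hle : V.sumProper.1 ≤ ((V.flow (-l)).generated {z}).1 :=
    sSup_le fun X hX => h2 X (hX.1.flow (-l)) hX.2
  have hvs : v ∉ V.sumProper.1 := fun h => h1 (hle h)
  have hspan : Submodule.span ℂ {z} ≤ V.sumProper.1 := by
    have h3 : ((V.flow (-l)).generated {z}).1 ≤ V.sumProper.1 :=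
      le_sSup ⟨((V.flow (-l)).generated {z}).2.of_flow, fun ht =>
        h1 (eq_top_iff.1 ht Submodule.mem_top)⟩
    exact (Submodule.span_singleton_le_iff_mem z _).2 (h3 ((V.flow (-l)).mem_generated_self z))
  refine ⟨isIrreducible_quot_sumProper fun ht => hvs (eq_top_iff.1 ht Submodule.mem_top), ?_⟩
  have hmk := (V.isHomogHom_mkQ V.sumProper).isHom_zero.flow (-l)
  have hq0 : ∀ x : V.W, x ∈ V.sumProper.1 → V.sumProper.1.mkQ x = 0 := fun x hx =>
    (Submodule.Quotient.mk_eq_zero _).2 hx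
  refine ⟨V.sumProper.1.mkQ v, ⟨fun h => hvs ((Submodule.Quotient.mk_eq_zero _).1 h),
    hv.map hmk, hmk.eigen rfl hN, ⟨c, ?_⟩, ?_, ?_⟩⟩
  · exact (congrArg V.sumProper.1.mkQ hθ).trans (map_smul _ _ _)
  · exact hq0 _ (hspan hP)
  · exact hq0 _ (hspan hM)

theorem Ahat_properties (hk : k ≠ 0) (n : ℂ) (l : ℤ) :
    (Ahat k (n - l + eps l) (l * k)).IsIrreducible ∧ (Ahat k (n - l + eps l) (l * k)).IsOfin ∧
      ∃ a, ((Ahat k (n - l + eps l) (l * k)).flow (-l)).AtypVec n a := by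
  by_cases hl : l = 0
  · subst hl
    have e1 : Ahat k (n - (0 : ℤ) + eps 0) ((0 : ℤ) * k) = AhatZero k n := by
      rw [Ahat, if_pos (by simp), eps, if_neg (by omega), if_pos rfl]
      congr 1
      push_cast
      ring
    rw [e1, neg_zero, flow_zero]
    have hi := AhatZero_isIrreducible hk n
    exact ⟨hi, (atop_isGen n).isOfin hk hi.hasLength, _, AhatZero_atypVec n⟩
  · have e1 : Ahat k (n - l + eps l) (l * k) = (Vhat k (n - l + eps l) (l * k)).quot
        (Vhat k (n - l + eps l) (l * k)).sumProper := by
      rw [Ahat, if_neg (mul_ne_zero (Int.cast_ne_zero.2 hl) hk)]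
    obtain ⟨hi, ha⟩ := Ahat_atypical hk n hl
    rw [e1]
    exact ⟨hi, ((vtop_isGen _ _).quot _).isOfin hk hi.hasLength, ha⟩

end AffMod

end

end AffGL

theorem mainTheorem7 (k : ℂ) (hk : k ≠ 0) :
    -- every irreducible module has a projective cover in `O_k^fin`
    (∀ S : AffMod k, S.IsGradingRestricted → S.IsIrreducible →
      ∃ (P : AffMod k) (p : P.W →ₗ[ℂ] S.W), AffMod.IsProjectiveCover P S p) ∧
    -- the typical modules are irreducible and projective (hence their own projective covers),
    -- and extensions between them split
    (∀ n e : ℂ, (∀ m : ℤ, e / k ≠ m) →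
      (Vhat k n e).IsIrreducible ∧
      (Vhat k n e).IsProjective ∧
      AffMod.IsProjectiveCover (Vhat k n e) (Vhat k n e) LinearMap.id ∧
      ∀ n' e' : ℂ, (∀ m : ℤ, e' / k ≠ m) → ∀ A : AffMod k, A.IsOfin →
        ∀ (i : (Vhat k n' e').W →ₗ[ℂ] A.W) (π : A.W →ₗ[ℂ] (Vhat k n e).W),
          AffMod.IsHom (Vhat k n' e') A i → AffMod.IsHom A (Vhat k n e) π →
          Function.Injective i → LinearMap.range i = LinearMap.ker π → Function.Surjective π →
          ∃ s : (Vhat k n e).W →ₗ[ℂ] A.W,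
            AffMod.IsHom (Vhat k n e) A s ∧ π ∘ₗ s = LinearMap.id) ∧
    -- the atypical modules are irreducible and have projective covers of length four
    (∀ (n : ℂ) (l : ℤ),
      (Ahat k (n - l + eps l) (l * k)).IsIrreducible ∧
      (Phat k (n - l + eps l) l).HasLength 4 ∧
      ∃ p : (Phat k (n - l + eps l) l).W →ₗ[ℂ] (Ahat k (n - l + eps l) (l * k)).W,
        AffMod.IsProjectiveCover (Phat k (n - l + eps l) l) (Ahat k (n - l + eps l) (l * k)) p) := by
  refine ⟨fun S hS hi => ?_, fun n e he => ⟨AffMod.Vhat_isIrreducible hk n he,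
    AffMod.Vhat_isProjective hk n he, AffMod.Vhat_cover hk n he,
    fun n' e' _ A hA i π _ hπ _ _ hs => AffMod.Vhat_split hk n he hA π hπ hs⟩, fun n l => ?_⟩
  · obtain ⟨⟨e, hE⟩, -⟩ := hi.scalar hk hS
    by_cases he : ∀ m : ℤ, e / k ≠ m
    · exact AffMod.exists_cover_typical hk hS hi hE he
    · push Not at he
      obtain ⟨l, hl⟩ := he
      rw [div_eq_iff hk] at hl
      exact AffMod.exists_cover_atypical hk hS hi (l := l) (hl ▸ hE)
  · obtain ⟨hi, hfin, a, ha⟩ := AffMod.Ahat_properties hk n l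
    obtain ⟨M, u, hu, hP⟩ := AffMod.Phat_eq_flow (k := k) n l
    rw [hP]
    exact ⟨hi, (hu.hasLength hk).flow l, hu.cover hk l hfin hi ha⟩
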